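/- Let $0<h<1$ and let $B=(B_t)_{t\in\mathbb R}$ be a fractional Brownian motion with Hurst index $h$, i.e. a centered real Gaussian process with $B_0=0$ a.s., stationary increments and $\operatorname{Var}(B_t)=|t|^{2h}$. Let $\xi_B$ be a stationary simple point process on $\mathbb R$, almost surely non-empty and with finite intensity, whose Palm distribution is the law of the perturbed lattice $\{n+B_n : n\in\mathbb Z\}$ (identified with the measure $\sum_{n\in\mathbb Z}\delta_{n+B_n}$). Here the law of a random measure $\eta$ is the Palm distribution of a stationary point process $\xi$ with intensity $\lambda=\mathbb E[\xi([0,1])]\in(0,\infty)$ if $\mathbb E\int f(\xi-t,t)\,\xi(\mathrm dt)=\lambda\,\mathbb E\int_{\mathbb R}f(\eta,t)\,\mathrm dt$ for all measurable $f\ge 0$. The structure factor of $\xi_B$ is a measurable function $s\ge 0$ such that $s(t)\,\mathrm dt$ is the Bartlett spectrum of $\xi_B$: $\mathbb E[\xi_B(K)^2]<\infty$ for every compact $K$, $s(t)\,\mathrm dt$ is locally finite, and $$\operatorname{Var}\Big(\int\varphi\,\mathrm d\xi_B\Big)=\frac1{2\pi}\int_{\mathbb R}|\hat\varphi(t)|^2\,s(t)\,\mathrm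 dt,\qquad \hat\varphi(t)=\int_{\mathbb R}e^{-itx}\varphi(x)\,\mathrm dx,$$ for every smooth compactly supported $\varphi:\mathbb R\to\mathbb C$, where $\operatorname{Var}(X)=\mathbb E|X-\mathbb EX|^2$. Then the structure factor $s$ of $\xi_B$ exists and is given by the convergent series $$s(t)=\sum_{n\in\mathbb Z}e^{-\frac12|n|^{2h}t^2}e^{-int},\qquad t\neq 0,$$ and, as $t\to0$, $t\neq0$, $$s(t)\sim\alpha_h|t|^{1-2h},\qquad \alpha_h=2h\,\Gamma(2h)\sin(\pi h).$$ In particular, $\xi_B$ is hyperuniform, i.e. $\operatorname{Var}\big(\xi_B([-r,r])\big)/(2r)\to0$ as $r\to+\infty$, if and only if $h<1/2$. -/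

import Mathlib

open MeasureTheory ProbabilityTheory Filter Asymptotics
open scoped Topology ENNReal

/-- `B` is a fractional Brownian motion on `ℝ` with Hurst index `h`: a centered Gaussian process
with `B 0 = 0`, with stationary increments, and with variogram `Var (B t) = |t| ^ (2 h)`. -/
structure IsFractionalBrownianMotion {Ω : Type*} [MeasurableSpace Ω] (P : Measure Ω) (h : ℝ)
    (B : ℝ → Ω → ℝ) : Prop where
  measurable : ∀ t, Measurable (B t)
  isGaussianProcess : IsGaussianProcess B P
  centered : ∀ t, ∫ ω, B t ω ∂P = 0
  zero : ∀ᵐ ω ∂P, B 0 ω = 0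
  stationary_increments : ∀ s,
    P.map (fun ω (x : ℝ) => B (x + s) ω - B s ω) = P.map (fun ω (x : ℝ) => B x ω)
  variogram : ∀ t, variance (B t) P = |t| ^ (2 * h)

/-- The counting measures of the locally finite configurations of points of `ℝ`. -/
def IsConfiguration (μ : Measure ℝ) : Prop :=
  ∃ S : Set ℝ, (∀ K : Set ℝ, IsCompact K → (S ∩ K).Finite) ∧ μ = Measure.count.restrict S

/-- The configuration `μ` seen from `t`: every point `x` is moved to `x - t`. -/
noncomputable def shift (t : ℝ) (μ : Measure ℝ) : Measure ℝ :=
  μ.map (fun x => x - t)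

/-- A (simple) point process on `ℝ`: a random locally finite configuration of points, identified
with its counting measure. -/
structure IsPointProcess {Ω : Type*} [MeasurableSpace Ω] (ξ : Ω → Measure ℝ) : Prop where
  measurable : Measurable ξ
  isConfiguration : ∀ ω, IsConfiguration (ξ ω)

/-- The law of `ξ` is invariant under all translations. -/
def IsStationaryProcess {Ω : Type*} [MeasurableSpace Ω] (P : Measure Ω) (ξ : Ω → Measure ℝ) : Prop :=
  ∀ t : ℝ, P.map (fun ω => shift t (ξ ω)) = P.map ξ

/-- The intensity `E [ξ [0, 1]]` of a stationary point process. -/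
noncomputable def intensity {Ω : Type*} [MeasurableSpace Ω] (P : Measure Ω)
    (ξ : Ω → Measure ℝ) : ℝ≥0∞ :=
  ∫⁻ ω, ξ ω (Set.Icc 0 1) ∂P

/-- The law of `η` is the Palm distribution of the stationary point process `ξ`: the intensity
`λ` of `ξ` is positive and finite, and Campbell's formula
`E ∫ f (shift t ξ, t) ξ(dt) = λ E ∫ f (η, t) dt` holds for every nonnegative measurable `f`. -/
structure HasPalmVersion {Ω Ω' : Type*} [MeasurableSpace Ω] [MeasurableSpace Ω']
    (P : Measure Ω) (ξ : Ω → Measure ℝ) (P' : Measure Ω') (η : Ω' → Measure ℝ) : Prop where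
  intensity_pos : 0 < intensity P ξ
  intensity_lt_top : intensity P ξ < ∞
  campbell : ∀ f : Measure ℝ × ℝ → ℝ≥0∞, Measurable f →
    ∫⁻ ω, ∫⁻ t, f (shift t (ξ ω), t) ∂(ξ ω) ∂P =
      intensity P ξ * ∫⁻ ω, (∫⁻ t : ℝ, f (η ω, t) ∂volume) ∂P'

/-- The perturbed lattice `{n + B n : n ∈ ℤ}`, identified with the sum of the unit masses at its
points. -/
noncomputable def perturbedLattice {Ω : Type*} (B : ℝ → Ω → ℝ) (ω : Ω) : Measure ℝ :=
  Measure.sum (fun n : ℤ => Measure.dirac ((n : ℝ) + B n ω))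

/-- The Fourier transform `∫ exp (-i t x) φ x dx`. -/
noncomputable def fourierTransform (φ : ℝ → ℂ) (t : ℝ) : ℂ :=
  ∫ x : ℝ, Complex.exp (-Complex.I * t * x) * φ x

/-- `S` is the Bartlett spectrum of the point process `ξ`, normalized as the Fourier transform
`∫ exp (-i t x) C(dx)` of the correlation measure `C`: a locally finite measure with
`Var (∫ φ dξ) = (2 π)⁻¹ ∫ |φ̂| ^ 2 dS` for all smooth compactly supported `φ`.
Complex-valued `φ` are used, because real-valued ones only determine the even part of `S`. -/
structure IsBartlettSpectrum {Ω : Type*} [MeasurableSpace Ω] (P : Measure Ω)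
    (ξ : Ω → Measure ℝ) (S : Measure ℝ) : Prop where
  second_moment : ∀ K : Set ℝ, IsCompact K → ∫⁻ ω, ξ ω K ^ 2 ∂P < ∞
  locallyFinite : IsLocallyFiniteMeasure S
  variance_eq : ∀ φ : ℝ → ℂ, ContDiff ℝ (⊤ : ℕ∞) φ → HasCompactSupport φ →
    ∫⁻ ω, ‖(∫ x, φ x ∂(ξ ω)) - ∫ ω', (∫ x, φ x ∂(ξ ω')) ∂P‖ₑ ^ 2 ∂P =
      ENNReal.ofReal (2 * Real.pi)⁻¹ * ∫⁻ t, ‖fourierTransform φ t‖ₑ ^ 2 ∂S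

/-- `s` is the structure factor of `ξ`: the Bartlett spectrum of `ξ` is absolutely continuous
with respect to Lebesgue measure, with density `s`. -/
structure IsStructureFactor {Ω : Type*} [MeasurableSpace Ω] (P : Measure Ω)
    (ξ : Ω → Measure ℝ) (s : ℝ → ℝ) : Prop where
  measurable : Measurable s
  nonneg : ∀ᵐ t : ℝ, 0 ≤ s t
  isBartlettSpectrum :
    IsBartlettSpectrum P ξ (volume.withDensity (fun t => ENNReal.ofReal (s t)))

/-- Hyperuniformity: the variance of the number of points in the ball of radius `r` centered at
the origin is negligible compared with the volume of the ball as `r → ∞`. The variance is taken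
with values in `[0, ∞]`. -/
def IsHyperuniform {Ω : Type*} [MeasurableSpace Ω] (P : Measure Ω) (ξ : Ω → Measure ℝ) : Prop :=
  Tendsto (fun r : ℝ =>
      evariance (fun ω => (ξ ω (Metric.closedBall 0 r)).toReal) P /
        volume (Metric.closedBall (0 : ℝ) r))
    atTop (𝓝 0)

/-!
Write `α = 2 h ∈ (0, 2)` and `s(t) = ∑ exp (-|n| ^ α t ^ 2 / 2) exp (-i n t)`. Campbell's formula
for the Palm distribution gives the second moments of `ξ` (`HasPalmVersion.map_pairMeasure`): seen
from one of its points, `ξ` has the intensity measure `K = ∑ law (n + B n)` of the perturbed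
lattice, so `E |∫ φ dξ| ^ 2 = λ ∫ ψ dK` with `ψ` the autocorrelation of `φ` and `λ` the intensity.
As `B n` is Gaussian with variance `|n| ^ α`, Fourier inversion turns `2 π ∫ ψ dK` into the sum
over `n` of the integrals of `ψ̂(t) exp (-|n| ^ α t ^ 2 / 2) exp (i n t)`. The sum and the
integral cannot be exchanged, since at `t = 0` the series has the constant terms `1`. The
frequency `0` carries a Dirac mass, the contribution of the mean density, and what is left is the
structure factor (`tsum_latticeCoeff`): `2 π ∫ ψ dK = 2 π ψ̂(0) + ∫ ψ̂(t) s(t) dt`.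

To isolate the Dirac mass, the series is regularized with a factor `exp (-ε |n| ^ α)` and summed
by the Poisson formula (`tsum_stretchedExp_mul_exp`). The term of frequency `0` is the Fourier
transform of a stretched exponential, and the other ones are uniformly small near `t = 0`. The
Fourier transform of `exp (-a |x| ^ α)` at `y ≠ 0` is controlled by moving the half-line of
integration to the ray of argument `π / 4`, on which `exp (i y z)` decays exponentially while
`exp (-a z ^ α)` stays bounded, because `α < 2`. It is thus a Lipschitz function of `a`
(`norm_rayIntegral_sub_le`), which gives an integrable majorant uniform in `ε`, and it is
differentiable at `a = 0` (`tendsto_rayIntegral_sub_div`), with the derivative given by Euler's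
integral for the Gamma function. At `a = t ^ 2 / 2` this is the equivalent `α_h |t| ^ (1 - 2 h)`
of `s` at `0`. The function `s` is nonnegative as a Cesàro limit of mean squares of exponential
sums over the perturbed lattice.

The intensity `λ` is `1`. On the one hand, the variance of `ξ [-r, r] / (2 r)` tends to
`λ - λ ^ 2`, so `λ ≤ 1` (`HasPalmVersion.intensity_le_one`). On the other hand, by Campbell's formula a
ball that contains a point of `ξ` has, in the mean, asymptotic density at least `1` around it, as
the perturbed lattice has density `1`; since `ξ` is not empty, `λ ≥ 1`
(`HasPalmVersion.one_le_intensity`). With `λ = 1` the terms in `ψ̂(0)` cancel in the variance, and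
`s` is the density of the Bartlett spectrum.

The variance formula also holds for the indicator function of `[-r, r]`, whose autocorrelation is
continuous. The substitution `t = u / r` turns the normalized number variance into the integral of
`s(u / r)` against a fixed Fejér kernel. If `h < 1 / 2` then `s` is bounded and tends to `0` at
`0`, and so does the normalized variance, by dominated convergence. If `h ≥ 1 / 2` then `s` is
bounded below near `0`, and so is the normalized variance.
-/

/-! ### Integrals over the positive half-line -/

lemma integral_Ioi_zero_eq_integral_exp (g : ℝ → ℂ) :
    ∫ x in Set.Ioi (0 : ℝ), g x = ∫ u : ℝ, Complex.exp u * g (Real.exp u) := by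
  have hr : Real.exp '' Set.univ = Set.Ioi 0 := by rw [Set.image_univ, Real.range_exp]
  rw [← hr, integral_image_eq_integral_abs_deriv_smul MeasurableSet.univ
    (fun x _ => (Real.hasDerivAt_exp x).hasDerivWithinAt) Real.exp_injective.injOn,
    setIntegral_univ]
  refine integral_congr_ae (Eventually.of_forall fun u => ?_)
  simp [abs_of_pos (Real.exp_pos u)]

lemma integrableOn_Ioi_zero_iff_integrable_exp (g : ℝ → ℂ) :
    IntegrableOn g (Set.Ioi 0) ↔ Integrable (fun u : ℝ => Complex.exp u * g (Real.exp u)) := by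
  have hr : Real.exp '' Set.univ = Set.Ioi 0 := by rw [Set.image_univ, Real.range_exp]
  rw [← hr, integrableOn_image_iff_integrableOn_abs_deriv_smul MeasurableSet.univ
    (fun x _ => (Real.hasDerivAt_exp x).hasDerivWithinAt) Real.exp_injective.injOn,
    integrableOn_univ]
  refine integrable_congr (Eventually.of_forall fun u => ?_)
  simp [abs_of_pos (Real.exp_pos u)]

lemma integrableOn_exp_neg_mul_rpow {α a : ℝ} (hα : 0 < α) (ha : 0 < a) :
    IntegrableOn (fun x : ℝ => Real.exp (-a * x ^ α)) (Set.Ioi 0) := by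
  -- the integral of a function that is not integrable would be `0`
  by_contra hn
  have h1 := integral_exp_neg_mul_rpow hα ha
  rw [integral_undef hn] at h1
  have : 0 < a ^ (-1 / α) * Real.Gamma (1 / α + 1) :=
    mul_pos (Real.rpow_pos_of_pos ha _) (Real.Gamma_pos_of_pos (by positivity))
  linarith

lemma integrableOn_rpow_mul_exp_neg_mul {s a : ℝ} (hs : -1 < s) (ha : 0 < a) :
    IntegrableOn (fun x : ℝ => x ^ s * Real.exp (-a * x)) (Set.Ioi 0) := by
  -- the integral of a function that is not integrable would be `0`
  by_contra hn
  have h1 := integral_rpow_mul_exp_neg_mul_rpow (p := 1) one_pos hs ha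
  simp only [Real.rpow_one] at h1
  rw [integral_undef hn] at h1
  have : 0 < a ^ (-(s + 1) / 1) * (1 / 1) * Real.Gamma ((s + 1) / 1) :=
    mul_pos (mul_pos (Real.rpow_pos_of_pos ha _) (by norm_num))
      (Real.Gamma_pos_of_pos (by simp; linarith))
  linarith

lemma cos_mul_pi_div_four_pos {α : ℝ} (hα : 0 < α) (hα2 : α < 2) :
    0 < Real.cos (α * (Real.pi / 4)) := by
  have hpi := Real.pi_pos
  apply Real.cos_pos_of_mem_Ioo
  constructor <;> nlinarith

/-! ### Rotation of the contour -/

/-- The integrand `exp (-a x ^ α) exp (i y x) dx` in the coordinate `x = exp z`, in which it is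
entire. -/
noncomputable def expIntegrand (α a y : ℝ) (z : ℂ) : ℂ :=
  Complex.exp z * Complex.exp (-a * Complex.exp (α * z) + Complex.I * y * Complex.exp z)

lemma differentiable_expIntegrand (α a y : ℝ) : Differentiable ℂ (expIntegrand α a y) := by
  unfold expIntegrand
  fun_prop

lemma norm_expIntegrand (α a y u θ : ℝ) :
    ‖expIntegrand α a y (u + θ * Complex.I)‖ = Real.exp u *
      Real.exp (-a * (Real.exp (α * u) * Real.cos (α * θ)) - y * (Real.exp u * Real.sin θ)) := by
  unfold expIntegrand
  rw [norm_mul, Complex.norm_exp, Complex.norm_exp]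
  congr 2
  · simp
  · have e1 : (α : ℂ) * (u + θ * Complex.I) =
        ((α * u : ℝ) : ℂ) + ((α * θ : ℝ) : ℂ) * Complex.I := by push_cast; ring
    rw [e1]
    simp [Complex.exp_re, Complex.exp_im, Complex.mul_re, Complex.mul_im]
    ring

/-- In the strip `0 ≤ Im z ≤ π / 4` both exponents have a nonpositive real part, because
`α π / 4 < π / 2`. -/
lemma norm_expIntegrand_le {α a y : ℝ} (hα : 0 < α) (hα2 : α < 2) (ha : 0 ≤ a) (hy : 0 ≤ y)
    (u : ℝ) {θ : ℝ} (hθ : 0 ≤ θ) (hθ2 : θ ≤ Real.pi / 4) :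
    ‖expIntegrand α a y (u + θ * Complex.I)‖ ≤ Real.exp u *
      Real.exp (-(a * Real.cos (α * (Real.pi / 4))) * Real.exp (α * u)) := by
  have hpi := Real.pi_pos
  rw [norm_expIntegrand]
  have h1 : Real.cos (α * (Real.pi / 4)) ≤ Real.cos (α * θ) := by
    apply Real.cos_le_cos_of_nonneg_of_le_pi <;> nlinarith
  have h2 : 0 ≤ Real.sin θ := Real.sin_nonneg_of_nonneg_of_le_pi hθ (by linarith)
  have h3 : 0 ≤ y * (Real.exp u * Real.sin θ) := by positivity
  have h4 := mul_le_mul_of_nonneg_left h1 (mul_nonneg ha (Real.exp_pos (α * u)).le)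
  gcongr
  linarith

lemma integrable_exp_mul_exp_neg {α c : ℝ} (hα : 0 < α) (hc : 0 < c) :
    Integrable (fun u : ℝ => Real.exp u * Real.exp (-c * Real.exp (α * u))) := by
  have h1 := (integrableOn_Ioi_zero_iff_integrable_exp _).1
    (integrableOn_exp_neg_mul_rpow hα hc).ofReal
  refine h1.re.congr (Eventually.of_forall fun u => ?_)
  have : Real.exp (α * u) = Real.exp u ^ α := by rw [← Real.exp_mul, mul_comm]
  simp only [this]
  rw [← Complex.ofReal_exp]
  exact (congrArg Complex.re (Complex.ofReal_mul _ _).symm).trans (Complex.ofReal_re _)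

lemma tendsto_exp_mul_exp_neg_atBot {α c : ℝ} (hc : 0 < c) :
    Tendsto (fun u : ℝ => Real.exp u * Real.exp (-c * Real.exp (α * u))) atBot (𝓝 0) := by
  refine squeeze_zero (fun u => by positivity) (fun u => ?_) Real.tendsto_exp_atBot
  have : Real.exp (-c * Real.exp (α * u)) ≤ 1 := by
    rw [Real.exp_le_one_iff]
    have := Real.exp_pos (α * u)
    nlinarith
  have := Real.exp_pos u
  nlinarith

lemma tendsto_exp_mul_exp_neg_atTop {α c : ℝ} (hα : 0 < α) (hc : 0 < c) :
    Tendsto (fun u : ℝ => Real.exp u * Real.exp (-c * Real.exp (α * u))) atTop (𝓝 0) := by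
  have h1 := (tendsto_rpow_mul_exp_neg_mul_atTop_nhds_zero (1 / α) c hc).comp
    (Real.tendsto_exp_atTop.comp (tendsto_id.const_mul_atTop hα))
  refine h1.congr fun u => ?_
  simp only [Function.comp, id]
  rw [← Real.exp_mul]
  congr 2
  field_simp

/-- The integral of an entire function over a horizontal line does not change when the line is
moved inside a strip in which the function has an integrable majorant that vanishes at infinity. -/
lemma integral_horizontal_shift {f : ℂ → ℂ} (hf : Differentiable ℂ f) {b : ℝ → ℝ} {c : ℝ}
    (hc : 0 ≤ c) (hb : Integrable b) (hbot : Tendsto b atBot (𝓝 0)) (htop : Tendsto b atTop (𝓝 0))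
    (hfb : ∀ u θ : ℝ, 0 ≤ θ → θ ≤ c → ‖f (u + θ * Complex.I)‖ ≤ b u) :
    ∫ u : ℝ, f u = ∫ u : ℝ, f (u + c * Complex.I) := by
  have hint : ∀ θ : ℝ, 0 ≤ θ → θ ≤ c → Integrable (fun u : ℝ => f (u + θ * Complex.I)) := by
    intro θ h0 h1
    refine hb.mono' ?_ (Eventually.of_forall fun u => hfb u θ h0 h1)
    exact (hf.continuous.comp (by fun_prop)).aestronglyMeasurable
  have hint0 : Integrable (fun u : ℝ => f u) := by simpa using hint 0 le_rfl hc
  have hside : ∀ R : ℝ, ‖∫ θ in (0 : ℝ)..c, f (R + θ * Complex.I)‖ ≤ b R * c := by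
    intro R
    have := intervalIntegral.norm_integral_le_of_norm_le_const (a := 0) (b := c)
      (f := fun θ : ℝ => f (R + θ * Complex.I)) (C := b R) ?_
    · rwa [sub_zero, abs_of_nonneg hc] at this
    · intro θ hθ
      rw [Set.uIoc_of_le hc] at hθ
      exact hfb R θ hθ.1.le hθ.2
  have hrect : ∀ R : ℝ, ((∫ u in (-R)..R, f u) - ∫ u in (-R)..R, f (u + c * Complex.I)) =
      -(Complex.I • ∫ θ in (0 : ℝ)..c, f (R + θ * Complex.I)) +
      Complex.I • ∫ θ in (0 : ℝ)..c, f ((-R : ℝ) + θ * Complex.I) := by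
    intro R
    have := Complex.integral_boundary_rect_eq_zero_of_differentiableOn f
      (⟨-R, 0⟩) (⟨R, c⟩) hf.differentiableOn
    simp only [Complex.ofReal_zero, zero_mul, add_zero] at this
    linear_combination this
  have hL : Tendsto (fun R : ℝ => (∫ u in (-R)..R, f u) - ∫ u in (-R)..R, f (u + c * Complex.I))
      atTop (𝓝 ((∫ u : ℝ, f u) - ∫ u : ℝ, f (u + c * Complex.I))) :=
    (intervalIntegral_tendsto_integral hint0 tendsto_neg_atTop_atBot tendsto_id).sub
      (intervalIntegral_tendsto_integral (hint _ hc le_rfl) tendsto_neg_atTop_atBot tendsto_id)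
  have hR : Tendsto (fun R : ℝ => (∫ u in (-R)..R, f u) - ∫ u in (-R)..R, f (u + c * Complex.I))
      atTop (𝓝 0) := by
    simp_rw [hrect]
    have h1 : Tendsto (fun R : ℝ => ∫ θ in (0 : ℝ)..c, f (R + θ * Complex.I)) atTop (𝓝 0) :=
      squeeze_zero_norm hside (by simpa using htop.mul_const c)
    have h2 : Tendsto (fun R : ℝ => ∫ θ in (0 : ℝ)..c, f ((-R : ℝ) + θ * Complex.I)) atTop
        (𝓝 0) := by
      refine squeeze_zero_norm (fun R => hside (-R)) ?_
      simpa using (hbot.comp tendsto_neg_atTop_atBot).mul_const c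
    simpa using (h1.const_smul Complex.I).neg.add (h2.const_smul Complex.I)
  exact sub_eq_zero.1 (tendsto_nhds_unique hL hR)

/-- The line `Im z = π / 4` corresponds to the ray of argument `π / 4` for `x = exp z`. -/
lemma integral_expIntegrand_shift {α a y : ℝ} (hα : 0 < α) (hα2 : α < 2) (ha : 0 < a)
    (hy : 0 ≤ y) :
    ∫ u : ℝ, expIntegrand α a y u =
      ∫ u : ℝ, expIntegrand α a y (u + (Real.pi / 4 : ℝ) * Complex.I) := by
  have hc0 : 0 < a * Real.cos (α * (Real.pi / 4)) := mul_pos ha (cos_mul_pi_div_four_pos hα hα2)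
  exact integral_horizontal_shift (differentiable_expIntegrand α a y) (by positivity)
    (integrable_exp_mul_exp_neg hα hc0) (tendsto_exp_mul_exp_neg_atBot hc0)
    (tendsto_exp_mul_exp_neg_atTop hα hc0)
    (fun u θ h0 h1 => norm_expIntegrand_le hα hα2 ha.le hy u h0 h1)

/-- Euler's integral for the Gamma function along a ray of argument `-π / 4`. -/
lemma integral_rpow_mul_exp_ray {s : ℝ} (hs : 0 < s) :
    ∫ v in Set.Ioi (0 : ℝ), ((v ^ (s - 1) : ℝ) : ℂ) *
      Complex.exp (-(Complex.exp (-((Real.pi / 4 : ℝ) * Complex.I)) * v)) =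
      Complex.exp ((s * (Real.pi / 4) : ℝ) * Complex.I) * Real.Gamma s := by
  have hpi := Real.pi_pos
  have hc : 0 < Real.cos (Real.pi / 4) := by
    have := cos_mul_pi_div_four_pos one_pos one_lt_two
    rwa [one_mul] at this
  set c := Real.cos (Real.pi / 4)
  set ζ : ℂ := (Real.pi / 4 : ℝ) * Complex.I with hζ
  have e1 : ∀ u : ℝ, Real.exp u ^ (s - 1) = Real.exp ((s - 1) * u) := fun u => by
    rw [← Real.exp_mul, mul_comm]
  have e2 : ∀ u : ℝ, Real.exp u * Real.exp ((s - 1) * u) = Real.exp (s * u) := fun u => by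
    rw [← Real.exp_add]; ring_nf
  set f : ℂ → ℂ := fun z => Complex.exp (s * (z - ζ)) * Complex.exp (-Complex.exp (z - ζ)) with hf
  have hfd : Differentiable ℂ f := by rw [hf]; fun_prop
  have hnorm : ∀ u θ : ℝ, ‖f (u + θ * Complex.I)‖ =
      Real.exp (s * u) * Real.exp (-(Real.exp u * Real.cos (θ - Real.pi / 4))) := by
    intro u θ
    have e3 : (u + θ * Complex.I - ζ) = u + ((θ - Real.pi / 4 : ℝ) : ℂ) * Complex.I := by
      rw [hζ]; push_cast; ring
    simp only [hf]
    rw [norm_mul, Complex.norm_exp, Complex.norm_exp, e3]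
    simp [Complex.exp_re]
  have hbound : ∀ u θ : ℝ, 0 ≤ θ → θ ≤ Real.pi / 4 → ‖f (u + θ * Complex.I)‖ ≤
      Real.exp (s * u) * Real.exp (-c * Real.exp u) := by
    intro u θ h0 h1
    rw [hnorm]
    have : c ≤ Real.cos (θ - Real.pi / 4) := by
      rw [← Real.cos_neg (θ - Real.pi / 4)]
      apply Real.cos_le_cos_of_nonneg_of_le_pi <;> linarith
    have h2 := mul_le_mul_of_nonneg_left this (Real.exp_pos u).le
    gcongr
    linarith
  have hbi : Integrable (fun u : ℝ => Real.exp (s * u) * Real.exp (-c * Real.exp u)) := by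
    have h1 := (integrableOn_Ioi_zero_iff_integrable_exp _).1
      (integrableOn_rpow_mul_exp_neg_mul (s := s - 1) (by linarith) hc).ofReal
    refine h1.re.congr (Eventually.of_forall fun u => ?_)
    simp only [e1]
    rw [← e2, mul_assoc, ← Complex.ofReal_exp]
    exact (congrArg Complex.re (Complex.ofReal_mul _ _).symm).trans (Complex.ofReal_re _)
  have hbot : Tendsto (fun u : ℝ => Real.exp (s * u) * Real.exp (-c * Real.exp u)) atBot
      (𝓝 0) := by
    refine squeeze_zero (fun u => by positivity) (fun u => ?_)
      (Real.tendsto_exp_atBot.comp (tendsto_id.const_mul_atBot hs))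
    have h2 : Real.exp (-c * Real.exp u) ≤ 1 := by
      rw [Real.exp_le_one_iff]
      have := Real.exp_pos u
      nlinarith
    exact mul_le_of_le_one_right (Real.exp_pos _).le h2
  have htop : Tendsto (fun u : ℝ => Real.exp (s * u) * Real.exp (-c * Real.exp u)) atTop
      (𝓝 0) := by
    refine ((tendsto_rpow_mul_exp_neg_mul_atTop_nhds_zero s c hc).comp
      Real.tendsto_exp_atTop).congr fun u => ?_
    simp only [Function.comp]
    rw [← Real.exp_mul, mul_comm u s]
  have key := integral_horizontal_shift hfd (by positivity) hbi hbot htop hbound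
  have hright : ∫ u : ℝ, f (u + (Real.pi / 4 : ℝ) * Complex.I) = Real.Gamma s := by
    rw [Real.Gamma_eq_integral hs, ← integral_complex_ofReal,
      integral_Ioi_zero_eq_integral_exp]
    refine integral_congr_ae (Eventually.of_forall fun u => ?_)
    simp only [hf, hζ, add_sub_cancel_right, e1]
    rw [mul_comm (Real.exp (-Real.exp u)), ← Complex.ofReal_exp u, ← Complex.ofReal_mul,
      Complex.ofReal_mul (Real.exp ((s - 1) * u)), ← mul_assoc, ← Complex.ofReal_mul, e2]
    push_cast
    rfl
  have hleft : ∫ u : ℝ, f u = Complex.exp (-(s * ζ)) * ∫ v in Set.Ioi (0 : ℝ),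
      ((v ^ (s - 1) : ℝ) : ℂ) * Complex.exp (-(Complex.exp (-ζ) * v)) := by
    rw [integral_Ioi_zero_eq_integral_exp, ← integral_const_mul]
    refine integral_congr_ae (Eventually.of_forall fun u => ?_)
    simp only [hf, e1]
    rw [sub_eq_add_neg (u : ℂ) ζ, Complex.exp_add, mul_add, Complex.exp_add, ← Complex.ofReal_mul s,
      ← Complex.ofReal_exp (s * u), ← e2]
    push_cast
    ring_nf
  rw [hright, hleft] at key
  rw [← key, ← mul_assoc, ← Complex.exp_add]
  have : ((s * (Real.pi / 4) : ℝ) : ℂ) * Complex.I + -(s * ζ) = 0 := by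
    rw [hζ]; push_cast; ring
  rw [this, Complex.exp_zero, one_mul]

/-- The value at `β` of `∫ exp (-β z ^ α) exp (i z) dz` along the ray of argument `π / 4`. -/
noncomputable def rayIntegral (α β : ℝ) : ℂ :=
  Complex.exp ((Real.pi / 4 : ℝ) * Complex.I) * ∫ v in Set.Ioi (0 : ℝ),
    Complex.exp (-β * (Complex.exp ((α * (Real.pi / 4) : ℝ) * Complex.I) * (v ^ α : ℝ))) *
      Complex.exp (Complex.I * (Complex.exp ((Real.pi / 4 : ℝ) * Complex.I) * v))

/-- The half-line Fourier integral of a stretched exponential: by scaling, it depends on `a` and `y`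
through `a y ^ (-α)` only, up to the factor `1 / y`. -/
lemma integral_Ioi_exp_neg_rpow_mul_exp {α a y : ℝ} (hα : 0 < α) (hα2 : α < 2) (ha : 0 < a)
    (hy : 0 < y) :
    ∫ x in Set.Ioi (0 : ℝ), (Real.exp (-(a * x ^ α)) : ℂ) * Complex.exp (Complex.I * y * x) =
      rayIntegral α (a * y ^ (-α)) / y := by
  have e1 : ∀ u : ℝ, Real.exp u ^ α = Real.exp (α * u) := fun u => by
    rw [← Real.exp_mul, mul_comm]
  rw [integral_Ioi_zero_eq_integral_exp]
  have h1 : ∀ u : ℝ, Complex.exp u * ((Real.exp (-(a * Real.exp u ^ α)) : ℂ) *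
      Complex.exp (Complex.I * y * (Real.exp u : ℝ))) = expIntegrand α a y u := by
    intro u
    rw [expIntegrand, e1, Complex.exp_add]
    push_cast
    ring_nf
  simp_rw [h1]
  rw [integral_expIntegrand_shift hα hα2 ha hy.le]
  set ω : ℂ := Complex.exp ((Real.pi / 4 : ℝ) * Complex.I) with hω
  set ωα : ℂ := Complex.exp ((α * (Real.pi / 4) : ℝ) * Complex.I) with hωα
  set g : ℝ → ℂ := fun v => Complex.exp (-(a * y ^ (-α) : ℝ) * (ωα * (v ^ α : ℝ))) *
      Complex.exp (Complex.I * (ω * v)) with hg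
  have h2 : ∀ u : ℝ, expIntegrand α a y (u + (Real.pi / 4 : ℝ) * Complex.I) =
      Complex.exp u * (ω * g (y * Real.exp u)) := by
    intro u
    have e2 : (α : ℂ) * (u + (Real.pi / 4 : ℝ) * Complex.I) =
        (α * u : ℝ) + (α * (Real.pi / 4) : ℝ) * Complex.I := by push_cast; ring
    have e3 : (y ^ (-α)) * (y * Real.exp u) ^ α = Real.exp (α * u) := by
      rw [Real.mul_rpow hy.le (Real.exp_pos u).le, e1, ← mul_assoc, ← Real.rpow_add hy]
      simp
    have e4 : -((a * y ^ (-α) : ℝ) : ℂ) * (ωα * ((y * Real.exp u) ^ α : ℝ)) =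
        -a * (Real.exp (α * u) * ωα) := by
      rw [← e3]; push_cast; ring
    rw [expIntegrand, e2, Complex.exp_add, Complex.exp_add, Complex.exp_add, ← hω, ← hωα, hg]
    simp only
    rw [e4]
    push_cast
    ring_nf
  simp_rw [h2]
  rw [← integral_Ioi_zero_eq_integral_exp (fun x => ω * g (y * x)), integral_const_mul,
    integral_comp_mul_left_Ioi g 0 hy, mul_zero, rayIntegral]
  rw [Complex.real_smul]
  rw [Complex.ofReal_inv, div_eq_mul_inv]
  ring

/-! ### Dependence of the rotated integral on its parameter -/

/-- `exp (-z)` is `1`-Lipschitz on the right half-plane. -/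
lemma norm_exp_neg_sub_exp_neg_le {z w : ℂ} (hz : 0 ≤ z.re) (hw : 0 ≤ w.re) :
    ‖Complex.exp (-z) - Complex.exp (-w)‖ ≤ ‖z - w‖ := by
  have := Convex.norm_image_sub_le_of_norm_deriv_le (𝕜 := ℂ)
    (f := fun x : ℂ => Complex.exp (-x)) (s := {x : ℂ | 0 ≤ x.re}) (x := w) (y := z) (C := 1)
    (fun x _ => by fun_prop) (fun x hx => ?_) (convex_halfSpace_re_ge 0) hw hz
  · simpa using this
  · have : deriv (fun x : ℂ => Complex.exp (-x)) x = -Complex.exp (-x) := by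
      simpa using ((hasDerivAt_neg x).cexp).deriv
    rw [this, norm_neg, Complex.norm_exp]
    simpa using hx

/-- The kernel `exp (i z) dz` on the ray `z = exp (i π / 4) v`. -/
noncomputable def rayExp (v : ℝ) : ℂ :=
  Complex.exp (Complex.I * (Complex.exp ((Real.pi / 4 : ℝ) * Complex.I) * v))

/-- The direction `exp (i α π / 4)` of `z ^ α` on the ray `z = exp (i π / 4) v`. -/
noncomputable def rayDir (α : ℝ) : ℂ := Complex.exp ((α * (Real.pi / 4) : ℝ) * Complex.I)

lemma rayIntegral_eq (α β : ℝ) : rayIntegral α β = rayDir 1 * ∫ v in Set.Ioi (0 : ℝ),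
    Complex.exp (-(β * (rayDir α * (v ^ α : ℝ)))) * rayExp v := by
  simp only [rayIntegral, rayDir, rayExp, one_mul, neg_mul]

lemma norm_rayDir (α : ℝ) : ‖rayDir α‖ = 1 := Complex.norm_exp_ofReal_mul_I _

lemma rayDir_re_nonneg {α : ℝ} (hα : 0 < α) (hα2 : α < 2) : 0 ≤ (rayDir α).re := by
  rw [rayDir, Complex.exp_ofReal_mul_I_re]
  exact (cos_mul_pi_div_four_pos hα hα2).le

lemma sin_pi_div_four_pos : 0 < Real.sin (Real.pi / 4) := by
  rw [Real.sin_pi_div_four]; positivity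

lemma norm_rayExp (v : ℝ) : ‖rayExp v‖ = Real.exp (-Real.sin (Real.pi / 4) * v) := by
  rw [rayExp, Complex.norm_exp, Complex.I_mul_re, Complex.im_mul_ofReal,
    Complex.exp_ofReal_mul_I_im, neg_mul]

lemma continuous_rayExp : Continuous rayExp := by unfold rayExp; fun_prop

lemma re_mul_rayDir_nonneg {α β v : ℝ} (hα : 0 < α) (hα2 : α < 2) (hβ : 0 ≤ β) (hv : 0 ≤ v) :
    0 ≤ ((β : ℂ) * (rayDir α * (v ^ α : ℝ))).re := by
  rw [Complex.re_ofReal_mul, Complex.re_mul_ofReal]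
  exact mul_nonneg hβ (mul_nonneg (rayDir_re_nonneg hα hα2) (Real.rpow_nonneg hv _))

/-- The constant in the Lipschitz bound of `rayIntegral α`. -/
noncomputable def rayConst (α : ℝ) : ℝ :=
  ∫ v in Set.Ioi (0 : ℝ), v ^ α * Real.exp (-Real.sin (Real.pi / 4) * v)

lemma rayConst_nonneg (α : ℝ) : 0 ≤ rayConst α :=
  setIntegral_nonneg measurableSet_Ioi fun v hv => by
    have : (0 : ℝ) ≤ v ^ α := Real.rpow_nonneg (le_of_lt hv) _
    positivity

lemma integrableOn_rayIntegrand {α β : ℝ} (hα : 0 < α) (hα2 : α < 2) (hβ : 0 ≤ β) :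
    IntegrableOn (fun v : ℝ => Complex.exp (-(β * (rayDir α * (v ^ α : ℝ)))) * rayExp v)
      (Set.Ioi 0) := by
  have h0 := integrableOn_rpow_mul_exp_neg_mul (s := 0) (by norm_num) sin_pi_div_four_pos
  simp only [Real.rpow_zero, one_mul] at h0
  refine Integrable.mono' h0 ?_ ?_
  · refine (Measurable.mul ?_ continuous_rayExp.measurable).aestronglyMeasurable
    have : Measurable fun v : ℝ => v ^ α := by fun_prop
    fun_prop
  · filter_upwards [ae_restrict_mem measurableSet_Ioi] with v hv
    rw [norm_mul, norm_rayExp, Complex.norm_exp]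
    refine mul_le_of_le_one_left (Real.exp_pos _).le ?_
    rw [Real.exp_le_one_iff, Complex.neg_re, neg_nonpos]
    exact re_mul_rayDir_nonneg hα hα2 hβ (le_of_lt hv)

lemma norm_rayIntegrand_sub_le {α β β' v : ℝ} (hα : 0 < α) (hα2 : α < 2) (hβ : 0 ≤ β)
    (hβ' : 0 ≤ β') (hv : 0 < v) :
    ‖Complex.exp (-(β * (rayDir α * (v ^ α : ℝ)))) * rayExp v -
      Complex.exp (-(β' * (rayDir α * (v ^ α : ℝ)))) * rayExp v‖ ≤
      |β - β'| * (v ^ α * Real.exp (-Real.sin (Real.pi / 4) * v)) := by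
  rw [← sub_mul, norm_mul, norm_rayExp, ← mul_assoc |β - β'|]
  refine mul_le_mul_of_nonneg_right ?_ (Real.exp_pos _).le
  refine (norm_exp_neg_sub_exp_neg_le (re_mul_rayDir_nonneg hα hα2 hβ hv.le)
    (re_mul_rayDir_nonneg hα hα2 hβ' hv.le)).trans (le_of_eq ?_)
  rw [← sub_mul, norm_mul, norm_mul, norm_rayDir, one_mul, Complex.norm_real, ← Complex.ofReal_sub,
    Complex.norm_real, Real.norm_eq_abs, Real.norm_eq_abs, abs_of_pos (Real.rpow_pos_of_pos hv α)]

lemma norm_rayIntegral_sub_le {α β β' : ℝ} (hα : 0 < α) (hα2 : α < 2) (hβ : 0 ≤ β)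
    (hβ' : 0 ≤ β') : ‖rayIntegral α β - rayIntegral α β'‖ ≤ rayConst α * |β - β'| := by
  rw [rayIntegral_eq, rayIntegral_eq, ← mul_sub, norm_mul, norm_rayDir, one_mul,
    ← integral_sub (integrableOn_rayIntegrand hα hα2 hβ) (integrableOn_rayIntegrand hα hα2 hβ'),
    rayConst, mul_comm, ← integral_const_mul]
  refine norm_integral_le_of_norm_le ?_ ?_
  · exact (integrableOn_rpow_mul_exp_neg_mul (by linarith) sin_pi_div_four_pos).const_mul _
  · filter_upwards [ae_restrict_mem measurableSet_Ioi] with v hv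
    exact norm_rayIntegrand_sub_le hα hα2 hβ hβ' hv

lemma rayExp_eq (v : ℝ) : rayExp v =
    Complex.exp (-(Complex.exp (-((Real.pi / 4 : ℝ) * Complex.I)) * v)) := by
  rw [rayExp, ← mul_assoc]
  congr 1
  rw [← neg_mul]
  congr 1
  have h1 : Complex.exp ((Real.pi / 2 : ℝ) * Complex.I) = Complex.I := by
    rw [Complex.ofReal_div]; exact_mod_cast Complex.exp_pi_div_two_mul_I
  have h2 : Complex.exp ((Real.pi : ℝ) * Complex.I) = -1 := Complex.exp_pi_mul_I
  rw [← neg_one_mul, ← h2, ← Complex.exp_add]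
  nth_rewrite 1 [← h1]
  rw [← Complex.exp_add]
  congr 1
  push_cast
  ring

/-- Moments of the kernel on the ray. -/
lemma integral_rpow_mul_rayExp {s : ℝ} (hs : 0 < s) :
    rayDir s * ∫ v in Set.Ioi (0 : ℝ), ((v ^ (s - 1) : ℝ) : ℂ) * rayExp v =
      Complex.exp ((s * (Real.pi / 2) : ℝ) * Complex.I) * Real.Gamma s := by
  simp_rw [rayExp_eq]
  rw [integral_rpow_mul_exp_ray hs, ← mul_assoc, rayDir, ← Complex.exp_add]
  congr 2
  push_cast
  ring

/-- This is purely imaginary, so the Fourier transform of the stretched exponential vanishes away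
from `0` in the limit `a → 0`. -/
lemma rayIntegral_zero (α : ℝ) : rayIntegral α 0 = Complex.I := by
  have := integral_rpow_mul_rayExp one_pos
  simp only [sub_self, Real.rpow_zero, one_mul, Complex.ofReal_one, Real.Gamma_one, mul_one] at this
  rw [rayIntegral_eq]
  simp only [Complex.ofReal_zero, zero_mul, neg_zero, Complex.exp_zero, one_mul]
  rw [this, Complex.ofReal_div]
  exact_mod_cast Complex.exp_pi_div_two_mul_I

/-- The right derivative of `rayIntegral α` at `0`. -/
lemma tendsto_rayIntegral_sub_div {α : ℝ} (hα : 0 < α) (hα2 : α < 2) :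
    Tendsto (fun β : ℝ => (rayIntegral α β - rayIntegral α 0) / β) (𝓝[>] 0)
      (𝓝 (-(Complex.exp (((α + 1) * (Real.pi / 2) : ℝ) * Complex.I) * Real.Gamma (α + 1)))) := by
  have hkey : -(Complex.exp (((α + 1) * (Real.pi / 2) : ℝ) * Complex.I) * Real.Gamma (α + 1)) =
      rayDir 1 * ∫ v in Set.Ioi (0 : ℝ), -(rayDir α * (v ^ α : ℝ)) * rayExp v := by
    rw [← integral_rpow_mul_rayExp (by linarith), add_sub_cancel_right]
    have : rayDir (α + 1) = rayDir 1 * rayDir α := by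
      rw [rayDir, rayDir, rayDir, ← Complex.exp_add]; congr 1; push_cast; ring
    rw [this, mul_assoc, ← mul_neg, ← integral_const_mul, ← integral_neg]
    congr 2
    ext v
    ring
  rw [hkey]
  have heq : ∀ β : ℝ, 0 < β → rayDir 1 * ∫ v in Set.Ioi (0 : ℝ),
      ((Complex.exp (-(β * (rayDir α * (v ^ α : ℝ)))) * rayExp v -
        Complex.exp (-((0 : ℝ) * (rayDir α * (v ^ α : ℝ)))) * rayExp v) / β) =
      (rayIntegral α β - rayIntegral α 0) / β := by
    intro β hβ
    rw [integral_div, integral_sub (integrableOn_rayIntegrand hα hα2 hβ.le)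
      (integrableOn_rayIntegrand hα hα2 le_rfl), rayIntegral_eq, rayIntegral_eq]
    ring
  refine Tendsto.congr' (eventually_nhdsWithin_of_forall heq) ?_
  refine Tendsto.const_mul _ ?_
  refine tendsto_integral_filter_of_dominated_convergence
    (fun v => v ^ α * Real.exp (-Real.sin (Real.pi / 4) * v)) ?_ ?_ ?_ ?_
  · filter_upwards [self_mem_nhdsWithin] with β hβ
    exact (((integrableOn_rayIntegrand hα hα2 (le_of_lt hβ)).sub
      (integrableOn_rayIntegrand hα hα2 le_rfl)).div_const _).aestronglyMeasurable
  · filter_upwards [self_mem_nhdsWithin] with β hβ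
    have hβ : 0 < β := hβ
    filter_upwards [ae_restrict_mem measurableSet_Ioi] with v hv
    rw [norm_div, Complex.norm_real, Real.norm_eq_abs, abs_of_pos hβ, div_le_iff₀ hβ]
    have := norm_rayIntegrand_sub_le hα hα2 hβ.le le_rfl hv
    rw [sub_zero, abs_of_pos hβ] at this
    linarith
  · exact integrableOn_rpow_mul_exp_neg_mul (by linarith) sin_pi_div_four_pos
  · refine Eventually.of_forall fun v => ?_
    set κ : ℂ := rayDir α * (v ^ α : ℝ)
    have hd : HasDerivAt (fun β : ℝ => Complex.exp (-(β * κ)) * rayExp v) (-κ * rayExp v) 0 := by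
      have h1 : HasDerivAt (fun β : ℝ => ((β : ℂ) * κ)) κ 0 := by
        simpa using (Complex.ofRealCLM.hasDerivAt (x := (0 : ℝ))).mul_const κ
      have := (h1.neg.cexp).mul_const (rayExp v)
      simpa using this
    have h2 := hd.tendsto_slope_zero_right
    refine h2.congr fun β => ?_
    rw [zero_add, Complex.real_smul, Complex.ofReal_inv]
    field_simp

/-! ### Fourier transform of the stretched exponential and Poisson summation -/

/-- The stretched exponential `exp (-a |x| ^ α)`. -/
noncomputable def stretchedExp (α a x : ℝ) : ℝ := Real.exp (-(a * |x| ^ α))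

/-- A closed form, away from `0`, of the Fourier transform of the stretched exponential. -/
noncomputable def stretchedFourier (α a y : ℝ) : ℝ :=
  2 * (rayIntegral α (a * |y| ^ (-α))).re / |y|

lemma stretchedExp_neg (α a x : ℝ) : stretchedExp α a (-x) = stretchedExp α a x := by
  simp [stretchedExp]

lemma stretchedExp_pos (α a x : ℝ) : 0 < stretchedExp α a x := Real.exp_pos _

lemma stretchedExp_le_one {α a x : ℝ} (ha : 0 ≤ a) : stretchedExp α a x ≤ 1 := by
  rw [stretchedExp, Real.exp_le_one_iff]
  have : 0 ≤ |x| ^ α := Real.rpow_nonneg (abs_nonneg x) _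
  nlinarith

lemma stretchedExp_anti {α a b x : ℝ} (hab : a ≤ b) : stretchedExp α b x ≤ stretchedExp α a x := by
  have : 0 ≤ |x| ^ α := Real.rpow_nonneg (abs_nonneg x) _
  exact Real.exp_le_exp.2 (by nlinarith)

lemma stretchedExp_add (α a b x : ℝ) :
    stretchedExp α (a + b) x = stretchedExp α a x * stretchedExp α b x := by
  rw [stretchedExp, stretchedExp, stretchedExp, ← Real.exp_add]
  ring_nf

lemma continuous_stretchedExp {α : ℝ} (hα : 0 < α) (a : ℝ) : Continuous (stretchedExp α a) := by
  unfold stretchedExp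
  have : Continuous fun x : ℝ => |x| ^ α :=
    continuous_abs.rpow_const fun x => Or.inr hα.le
  fun_prop

lemma integrable_stretchedExp {α a : ℝ} (hα : 0 < α) (ha : 0 < a) :
    Integrable (stretchedExp α a) := by
  -- the integral of a function that is not integrable would be `0`
  by_contra hn
  have h1 : ∫ x : ℝ, stretchedExp α a x = _ :=
    integral_comp_abs (f := fun x : ℝ => Real.exp (-(a * x ^ α)))
  have h2 := integral_exp_neg_mul_rpow hα ha
  simp only [neg_mul] at h2
  rw [integral_undef hn, h2] at h1
  have : 0 < a ^ (-1 / α) * Real.Gamma (1 / α + 1) :=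
    mul_pos (Real.rpow_pos_of_pos ha _) (Real.Gamma_pos_of_pos (by positivity))
  linarith

/-- The integral of a function with Hermitian symmetry. -/
lemma integral_eq_re_of_conj {f : ℝ → ℂ} (hf : Integrable f)
    (hsymm : ∀ x, f (-x) = (starRingEnd ℂ) (f x)) :
    ∫ x : ℝ, f x = ((2 * (∫ x in Set.Ioi (0 : ℝ), f (-x)).re : ℝ) : ℂ) := by
  rw [← intervalIntegral.integral_Iic_add_Ioi (b := 0) hf.integrableOn hf.integrableOn]
  have h1 : ∫ x in Set.Iic (0 : ℝ), f x = ∫ x in Set.Ioi (0 : ℝ), f (-x) := by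
    simp
  have h2 : ∫ x in Set.Ioi (0 : ℝ), f x =
      (starRingEnd ℂ) (∫ x in Set.Ioi (0 : ℝ), f (-x)) := by
    rw [← integral_conj]
    refine integral_congr_ae (Eventually.of_forall fun x => ?_)
    simp [hsymm]
  rw [h1, h2, Complex.add_conj]

lemma integrable_exp_mul_stretchedExp {α a : ℝ} (hα : 0 < α) (ha : 0 < a) (y : ℝ) :
    Integrable (fun x : ℝ => Complex.exp (-Complex.I * y * x) * (stretchedExp α a x : ℂ)) := by
  refine (integrable_stretchedExp hα ha).mono ?_ (Eventually.of_forall fun x => ?_)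
  · have := Complex.continuous_ofReal.comp (continuous_stretchedExp hα a)
    exact (Continuous.mul (by fun_prop) this).aestronglyMeasurable
  · rw [norm_mul, Complex.norm_exp]
    simp

lemma fourierTransform_stretchedExp_of_pos {α a y : ℝ} (hα : 0 < α) (hα2 : α < 2) (ha : 0 < a)
    (hy : 0 < y) :
    fourierTransform (fun x => (stretchedExp α a x : ℂ)) y = (stretchedFourier α a y : ℂ) := by
  rw [fourierTransform, integral_eq_re_of_conj (integrable_exp_mul_stretchedExp hα ha y)]
  · congr 1
    have h1 := integral_Ioi_exp_neg_rpow_mul_exp hα hα2 ha hy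
    have h2 : ∫ x in Set.Ioi (0 : ℝ), Complex.exp (-Complex.I * y * ((-x : ℝ) : ℂ)) *
        (stretchedExp α a (-x) : ℂ) = rayIntegral α (a * y ^ (-α)) / y := by
      rw [← h1]
      refine setIntegral_congr_fun measurableSet_Ioi fun x hx => ?_
      have hx : 0 < x := hx
      simp only [stretchedExp_neg]
      rw [stretchedExp, abs_of_pos hx, mul_comm]
      push_cast
      ring_nf
    rw [h2, stretchedFourier, abs_of_pos hy, Complex.div_ofReal_re]
    ring
  · intro x
    rw [stretchedExp_neg, map_mul, Complex.conj_ofReal, ← Complex.exp_conj]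
    simp

lemma fourierTransform_stretchedExp {α a y : ℝ} (hα : 0 < α) (hα2 : α < 2) (ha : 0 < a)
    (hy : y ≠ 0) :
    fourierTransform (fun x => (stretchedExp α a x : ℂ)) y = (stretchedFourier α a y : ℂ) := by
  rcases hy.lt_or_gt with h | h
  · have h1 := fourierTransform_stretchedExp_of_pos hα hα2 ha (neg_pos.2 h)
    have h2 : stretchedFourier α a (-y) = stretchedFourier α a y := by simp [stretchedFourier]
    rw [h2] at h1
    rw [← h1, fourierTransform, fourierTransform, ← integral_neg_eq_self]
    refine integral_congr_ae (Eventually.of_forall fun x => ?_)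
    simp [stretchedExp_neg]
  · exact fourierTransform_stretchedExp_of_pos hα hα2 ha h

lemma stretchedFourier_zero (α y : ℝ) : stretchedFourier α 0 y = 0 := by
  simp [stretchedFourier, rayIntegral_zero]

lemma abs_stretchedFourier_sub_le {α a b y : ℝ} (hα : 0 < α) (hα2 : α < 2) (ha : 0 ≤ a)
    (hb : 0 ≤ b) (hy : y ≠ 0) : |stretchedFourier α a y - stretchedFourier α b y| ≤
      2 * rayConst α * |a - b| * |y| ^ (-(1 + α)) := by
  have hy' : 0 < |y| := abs_pos.2 hy
  have hp : 0 < |y| ^ (-α) := Real.rpow_pos_of_pos hy' _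
  have h1 := (Complex.abs_re_le_norm _).trans (norm_rayIntegral_sub_le (β := a * |y| ^ (-α))
    (β' := b * |y| ^ (-α)) hα hα2 (by positivity) (by positivity))
  rw [← sub_mul, abs_mul, abs_of_pos hp, Complex.sub_re] at h1
  rw [stretchedFourier, stretchedFourier, ← sub_div, ← mul_sub, abs_div, abs_abs,
    div_le_iff₀ hy', abs_mul, abs_two, mul_assoc (2 * rayConst α * _), neg_add_rev,
    Real.rpow_add hy', mul_assoc (|y| ^ (-α)), Real.rpow_neg_one, inv_mul_cancel₀ hy'.ne', mul_one]
  linarith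

lemma abs_stretchedFourier_le {α a y : ℝ} (hα : 0 < α) (hα2 : α < 2) (ha : 0 ≤ a)
    (hy : y ≠ 0) : |stretchedFourier α a y| ≤ 2 * rayConst α * a * |y| ^ (-(1 + α)) := by
  have := abs_stretchedFourier_sub_le hα hα2 ha le_rfl hy
  rwa [stretchedFourier_zero, sub_zero, sub_zero, abs_of_nonneg ha] at this

/-- The behavior near `0` of the Fourier transform of `exp (-t ^ 2 / 2 |x| ^ α)` at `t`. -/
lemma tendsto_stretchedFourier_div {α : ℝ} (hα : 0 < α) (hα2 : α < 2) :
    Tendsto (fun t : ℝ => stretchedFourier α (t ^ 2 / 2) t / |t| ^ (1 - α)) (𝓝[≠] 0)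
      (𝓝 (Real.Gamma (α + 1) * Real.sin (α * (Real.pi / 2)))) := by
  have h1 := (Complex.continuous_re.tendsto _).comp (tendsto_rayIntegral_sub_div hα hα2)
  have hlim : (-(Complex.exp (((α + 1) * (Real.pi / 2) : ℝ) * Complex.I) *
      Real.Gamma (α + 1))).re = Real.Gamma (α + 1) * Real.sin (α * (Real.pi / 2)) := by
    rw [Complex.neg_re, Complex.re_mul_ofReal, Complex.exp_ofReal_mul_I_re, add_mul, one_mul,
      Real.cos_add_pi_div_two]
    ring
  rw [hlim] at h1
  have hβ : Tendsto (fun t : ℝ => t ^ 2 / 2 * |t| ^ (-α)) (𝓝[≠] 0) (𝓝[>] 0) := by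
    refine tendsto_nhdsWithin_iff.2 ⟨?_, ?_⟩
    · have h2 : Tendsto (fun t : ℝ => |t| ^ (2 - α) / 2) (𝓝[≠] 0) (𝓝 0) := by
        have : Continuous fun t : ℝ => |t| ^ (2 - α) / 2 :=
          (continuous_abs.rpow_const fun x => Or.inr (by linarith)).div_const 2
        have h3 := this.tendsto 0
        rw [abs_zero, Real.zero_rpow (by linarith), zero_div] at h3
        exact h3.mono_left nhdsWithin_le_nhds
      refine h2.congr' (eventually_nhdsWithin_of_forall fun t ht => ?_)
      have ht : t ≠ 0 := ht
      rw [sub_eq_add_neg, Real.rpow_add (abs_pos.2 ht), Real.rpow_two, sq_abs]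
      ring
    · refine eventually_nhdsWithin_of_forall fun t ht => ?_
      have ht : 0 < |t| := abs_pos.2 ht
      have := Real.rpow_pos_of_pos ht (-α)
      rw [Set.mem_Ioi, ← sq_abs]
      positivity
  refine (h1.comp hβ).congr' (eventually_nhdsWithin_of_forall fun t ht => ?_)
  have ht : 0 < |t| := abs_pos.2 ht
  have hp := Real.rpow_pos_of_pos ht (-α)
  simp only [Function.comp]
  rw [Complex.div_ofReal_re, Complex.sub_re, rayIntegral_zero, Complex.I_re, sub_zero,
    stretchedFourier, sub_eq_add_neg, Real.rpow_add ht, Real.rpow_one, ← sq_abs]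
  field_simp

lemma tendsto_rpow_mul_stretchedExp {α a : ℝ} (hα : 0 < α) (ha : 0 < a) (s : ℝ) :
    Tendsto (fun x : ℝ => |x| ^ s * stretchedExp α a x) (cocompact ℝ) (𝓝 0) := by
  have h1 := (tendsto_rpow_mul_exp_neg_mul_atTop_nhds_zero (s / α) a ha).comp
    ((tendsto_rpow_atTop hα).comp (tendsto_norm_cocompact_atTop (E := ℝ)))
  refine h1.congr fun x => ?_
  simp only [Function.comp, Real.norm_eq_abs]
  rw [← Real.rpow_mul (abs_nonneg x), stretchedExp, neg_mul]
  congr 2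
  field_simp

lemma isBigO_stretchedExp {α a : ℝ} (hα : 0 < α) (ha : 0 < a) (s : ℝ) :
    stretchedExp α a =O[cocompact ℝ] fun x : ℝ => |x| ^ (-s) := by
  have h1 := (tendsto_rpow_mul_stretchedExp hα ha s).isBigO_one ℝ
  have h2 := (isBigO_refl (fun x : ℝ => |x| ^ (-s)) (cocompact ℝ)).mul h1
  simp only [mul_one] at h2
  refine h2.congr' ?_ EventuallyEq.rfl
  filter_upwards [(tendsto_norm_cocompact_atTop (E := ℝ)).eventually_gt_atTop 0] with x hx
  rw [Real.norm_eq_abs] at hx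
  rw [← mul_assoc, ← Real.rpow_add hx]
  simp

lemma summable_stretchedExp {α a : ℝ} (hα : 0 < α) (ha : 0 < a) :
    Summable fun n : ℤ => stretchedExp α a n :=
  summable_of_isBigO (Real.summable_abs_int_rpow one_lt_two)
    ((isBigO_stretchedExp hα ha 2).comp_tendsto Int.tendsto_coe_cofinite)

/-- Poisson summation for the stretched exponential. -/
lemma tsum_stretchedExp_mul_exp {α a t : ℝ} (hα : 0 < α) (hα2 : α < 2) (ha : 0 < a)
    (ht : ∀ k : ℤ, 2 * Real.pi * k - t ≠ 0) :
    (Summable fun k : ℤ => stretchedFourier α a (2 * Real.pi * k - t)) ∧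
    ∑' n : ℤ, (stretchedExp α a n : ℂ) * Complex.exp (Complex.I * t * n) =
      ((∑' k : ℤ, stretchedFourier α a (2 * Real.pi * k - t) : ℝ) : ℂ) := by
  have hpi := Real.pi_pos
  set f : ℝ → ℂ := fun x => (stretchedExp α a x : ℂ) * Complex.exp (Complex.I * t * x) with hf
  have hF : ∀ y : ℝ, FourierTransform.fourier f y =
      fourierTransform (fun x => (stretchedExp α a x : ℂ)) (2 * Real.pi * y - t) := by
    intro y
    rw [Real.fourier_real_eq_integral_exp_smul, fourierTransform]
    refine integral_congr_ae (Eventually.of_forall fun x => ?_)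
    simp only [hf, smul_eq_mul]
    rw [mul_comm (stretchedExp α a x : ℂ), ← mul_assoc, ← Complex.exp_add]
    congr 2
    push_cast
    ring
  have hc : Continuous f :=
    (Complex.continuous_ofReal.comp (continuous_stretchedExp hα a)).mul (by fun_prop)
  have hfO : f =O[cocompact ℝ] fun x : ℝ => |x| ^ (-(2 : ℝ)) := by
    refine IsBigO.trans (IsBigO.of_norm_le fun x => ?_) (isBigO_stretchedExp hα ha 2)
    simp only [hf]
    rw [norm_mul, Complex.norm_exp, Complex.norm_real]
    simp [abs_of_pos (stretchedExp_pos α a x)]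
  have hFO : FourierTransform.fourier f =O[cocompact ℝ] fun x : ℝ => |x| ^ (-(1 + α)) := by
    refine IsBigO.of_bound (2 * rayConst α * a) ?_
    filter_upwards [(tendsto_norm_cocompact_atTop (E := ℝ)).eventually_gt_atTop |t|] with y hy
    rw [Real.norm_eq_abs] at hy
    have h0 : 0 < |y| := (abs_nonneg t).trans_lt hy
    have h1 : |y| ≤ |2 * Real.pi * y - t| := by
      have h2 := abs_sub_abs_le_abs_sub (2 * Real.pi * y) t
      rw [abs_mul, abs_of_pos (by positivity : 0 < 2 * Real.pi)] at h2
      nlinarith [Real.pi_gt_three]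
    rw [hF, fourierTransform_stretchedExp hα hα2 ha (abs_pos.1 (h0.trans_le h1)),
      Complex.norm_real, Real.norm_eq_abs, Real.norm_eq_abs,
      abs_of_pos (Real.rpow_pos_of_pos h0 _)]
    refine (abs_stretchedFourier_le hα hα2 ha.le (abs_pos.1 (h0.trans_le h1))).trans ?_
    have := rayConst_nonneg α
    refine mul_le_mul_of_nonneg_left ?_ (by positivity)
    exact Real.rpow_le_rpow_of_nonpos h0 h1 (by linarith)
  have hsum : Summable fun k : ℤ => FourierTransform.fourier f (k : ℝ) :=
    summable_of_isBigO (Real.summable_abs_int_rpow (b := 1 + α) (by linarith))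
      (hFO.comp_tendsto Int.tendsto_coe_cofinite)
  have hFk : ∀ k : ℤ, FourierTransform.fourier f (k : ℝ) =
      (stretchedFourier α a (2 * Real.pi * k - t) : ℂ) := fun k => by
    rw [hF, fourierTransform_stretchedExp hα hα2 ha (ht k)]
  have hP := Real.tsum_eq_tsum_fourier_of_rpow_decay_of_summable hc one_lt_two hfO hsum 0
  simp_rw [hFk] at hsum hP
  refine ⟨by exact_mod_cast hsum, ?_⟩
  rw [Complex.ofReal_tsum]
  simpa [hf] using hP

/-! ### The series of the structure factor -/

/-- The sum over the lattice `ℤ` of the stretched exponential against the character `t`. -/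
noncomputable def latticeSum (α a t : ℝ) : ℝ := ∑' n : ℤ, stretchedExp α a n * Real.cos (n * t)

/-- The structure factor of the lattice perturbed by a fractional Brownian motion with Hurst index
`α / 2`. Its value at `0`, where the series diverges, is `0` by convention. -/
noncomputable def perturbedStructureFactor (α t : ℝ) : ℝ := latticeSum α (t ^ 2 / 2) t

lemma summable_stretchedExp_mul_cos {α a : ℝ} (hα : 0 < α) (ha : 0 < a) (t : ℝ) :
    Summable fun n : ℤ => stretchedExp α a n * Real.cos (n * t) := by
  refine Summable.of_norm_bounded (summable_stretchedExp hα ha) fun n => ?_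
  rw [norm_mul, Real.norm_eq_abs, abs_of_pos (stretchedExp_pos _ _ _)]
  exact mul_le_of_le_one_right (stretchedExp_pos _ _ _).le (Real.abs_cos_le_one _)

lemma hasSum_latticeSum {α a : ℝ} (hα : 0 < α) (ha : 0 < a) (t : ℝ) :
    HasSum (fun n : ℤ => (stretchedExp α a n : ℂ) * Complex.exp (Complex.I * t * n))
      (latticeSum α a t : ℂ) := by
  have h1 : ∀ n : ℤ, (stretchedExp α a n : ℂ) * Complex.exp (Complex.I * t * n) =
      ((stretchedExp α a n * Real.cos (n * t) : ℝ) : ℂ) +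
        ((stretchedExp α a n * Real.sin (n * t) : ℝ) : ℂ) * Complex.I := by
    intro n
    have : Complex.I * t * n = ((n * t : ℝ) : ℂ) * Complex.I := by push_cast; ring
    rw [this, Complex.exp_mul_I]
    push_cast
    ring
  have hs : Summable fun n : ℤ => stretchedExp α a n * Real.sin (n * t) := by
    refine Summable.of_norm_bounded (summable_stretchedExp hα ha) fun n => ?_
    rw [norm_mul, Real.norm_eq_abs, abs_of_pos (stretchedExp_pos _ _ _)]
    exact mul_le_of_le_one_right (stretchedExp_pos _ _ _).le (Real.abs_sin_le_one _)
  have h0 : ∑' n : ℤ, stretchedExp α a n * Real.sin (n * t) = 0 := by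
    have := (Equiv.neg ℤ).tsum_eq fun n : ℤ => stretchedExp α a n * Real.sin (n * t)
    simp only [Equiv.neg_apply, Int.cast_neg, stretchedExp_neg, neg_mul, Real.sin_neg, mul_neg,
      tsum_neg] at this
    linarith
  simp_rw [h1]
  have h2 := (Complex.hasSum_ofReal.2 (summable_stretchedExp_mul_cos hα ha t).hasSum).add
    ((Complex.hasSum_ofReal.2 hs.hasSum).mul_right Complex.I)
  rw [h0] at h2
  simpa [latticeSum] using h2

lemma latticeSum_zero_right (α a : ℝ) : latticeSum α a 0 = ∑' n : ℤ, stretchedExp α a n := by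
  simp [latticeSum]

lemma latticeSum_neg (α a t : ℝ) : latticeSum α a (-t) = latticeSum α a t := by
  simp [latticeSum]

lemma abs_latticeSum_le {α a b t : ℝ} (hα : 0 < α) (hb : 0 < b) (hab : b ≤ a) :
    |latticeSum α a t| ≤ latticeSum α b 0 := by
  rw [latticeSum_zero_right, latticeSum, ← Real.norm_eq_abs]
  refine tsum_of_norm_bounded (summable_stretchedExp hα hb).hasSum fun n => ?_
  rw [norm_mul, Real.norm_eq_abs, abs_of_pos (stretchedExp_pos _ _ _)]
  exact (mul_le_of_le_one_right (stretchedExp_pos _ _ _).le (Real.abs_cos_le_one _)).trans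
    (stretchedExp_anti hab)

/-- The contribution of the nonzero frequencies in Poisson summation. -/
lemma abs_latticeSum_sub_stretchedFourier_le {α a t : ℝ} (hα : 0 < α) (hα2 : α < 2) (ha : 0 < a)
    (ht : t ≠ 0) (ht1 : |t| ≤ 1) : |latticeSum α a t - stretchedFourier α a t| ≤
      (2 * rayConst α * ∑' k : ℤ, |(k : ℝ)| ^ (-(1 + α))) * a := by
  have hpi := Real.pi_gt_three
  have hk : ∀ k : ℤ, k ≠ 0 → |(k : ℝ)| ≤ |2 * Real.pi * k - t| := by
    intro k hk
    have h1 : (1 : ℝ) ≤ |(k : ℝ)| := by exact_mod_cast Int.one_le_abs hk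
    have h2 := abs_sub_abs_le_abs_sub (2 * Real.pi * k) t
    rw [abs_mul, abs_of_pos (by positivity : 0 < 2 * Real.pi)] at h2
    nlinarith
  have hk0 : ∀ k : ℤ, k ≠ 0 → 0 < |(k : ℝ)| := fun k hk => abs_pos.2 (Int.cast_ne_zero.2 hk)
  obtain ⟨hs, hP⟩ := tsum_stretchedExp_mul_exp (t := t) hα hα2 ha (by
    intro k
    rcases eq_or_ne k 0 with rfl | h
    · simpa using ht
    · exact abs_pos.1 ((hk0 k h).trans_le (hk k h)))
  rw [(hasSum_latticeSum hα ha t).tsum_eq] at hP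
  have hP' := Complex.ofReal_injective hP
  -- the term of frequency `0` is split off, the other ones stay away from the singularity at `0`
  rw [hs.tsum_eq_add_tsum_ite 0] at hP'
  have h0 : stretchedFourier α a (2 * Real.pi * (0 : ℤ) - t) = stretchedFourier α a t := by
    simp [stretchedFourier]
  rw [hP', h0, add_sub_cancel_left, ← Real.norm_eq_abs]
  have hsum := (Real.summable_abs_int_rpow (b := 1 + α) (by linarith)).hasSum
  refine tsum_of_norm_bounded ((hsum.mul_left (2 * rayConst α)).mul_right a) fun k => ?_
  have hC := rayConst_nonneg α
  split_ifs with h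
  · rw [norm_zero]; positivity
  · refine (abs_stretchedFourier_le hα hα2 ha.le
      (abs_pos.1 ((hk0 k h).trans_le (hk k h)))).trans ?_
    have := Real.rpow_le_rpow_of_nonpos (hk0 k h) (hk k h) (by linarith : -(1 + α) ≤ 0)
    have h3 := mul_le_mul_of_nonneg_left this (by positivity : 0 ≤ 2 * rayConst α * a)
    linarith

/-- A locally integrable majorant, up to a constant factor, of the structure factor. -/
noncomputable def spectralMajorant (α t : ℝ) : ℝ :=
  1 + (Set.Icc (-1 : ℝ) 1).indicator (fun t => |t| ^ (1 - α)) t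

lemma one_le_spectralMajorant (α t : ℝ) : 1 ≤ spectralMajorant α t := by
  have : 0 ≤ (Set.Icc (-1 : ℝ) 1).indicator (fun t => |t| ^ (1 - α)) t :=
    Set.indicator_nonneg (fun x _ => Real.rpow_nonneg (abs_nonneg x) _) _
  rw [spectralMajorant]
  linarith

lemma integrable_indicator_abs_rpow {α : ℝ} (hα2 : α < 2) :
    Integrable ((Set.Icc (-1 : ℝ) 1).indicator (fun t => |t| ^ (1 - α))) := by
  rw [integrable_indicator_iff measurableSet_Icc]
  have h1 : IntervalIntegrable (fun t : ℝ => |t| ^ (1 - α)) volume 0 1 := by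
    refine (intervalIntegral.intervalIntegrable_rpow' (r := 1 - α) (by linarith)).congr ?_
    intro t ht
    rw [Set.uIoc_of_le zero_le_one] at ht
    simp only [abs_of_pos ht.1]
  have h2 : IntervalIntegrable (fun t : ℝ => |t| ^ (1 - α)) volume (-1) 0 := by
    have := (IntervalIntegrable.iff_comp_neg (by simp)).1 h1
    simpa using this.symm
  have := h2.trans h1
  rw [intervalIntegrable_iff_integrableOn_Ioc_of_le (by norm_num)] at this
  exact (integrableOn_Icc_iff_integrableOn_Ioc (by simp)).2 this

lemma locallyIntegrable_spectralMajorant {α : ℝ} (hα2 : α < 2) :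
    LocallyIntegrable (spectralMajorant α) :=
  (locallyIntegrable_const 1).add (integrable_indicator_abs_rpow hα2).locallyIntegrable

lemma integrable_mul_spectralMajorant {α : ℝ} (hα2 : α < 2) {G : ℝ → ℝ} (hG : Integrable G)
    {M : ℝ} (hM : ∀ t, |G t| ≤ M) : Integrable fun t => G t * spectralMajorant α t := by
  simp only [spectralMajorant, mul_add, mul_one]
  refine hG.add ?_
  exact (integrable_indicator_abs_rpow hα2).bdd_mul hG.aestronglyMeasurable
    (Eventually.of_forall hM)

/-- Uniformly in the regularization `ε`, the regularized structure factor minus the approximate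
Dirac mass at `0` has an integrable majorant near `0`. -/
lemma exists_abs_latticeSum_sub_le {α : ℝ} (hα : 0 < α) (hα2 : α < 2) :
    ∃ K : ℝ, 0 ≤ K ∧ ∀ ε : ℝ, 0 < ε → ε ≤ 1 → ∀ t : ℝ, t ≠ 0 →
      |latticeSum α (t ^ 2 / 2 + ε) t - stretchedFourier α ε t| ≤ K * spectralMajorant α t := by
  have hC := rayConst_nonneg α
  set C1 : ℝ := 2 * rayConst α * ∑' k : ℤ, |(k : ℝ)| ^ (-(1 + α)) with hC1
  have hC1n : 0 ≤ C1 := mul_nonneg (by positivity) (tsum_nonneg fun k => by positivity)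
  have hL : 0 ≤ latticeSum α (1 / 2) 0 := by
    rw [latticeSum_zero_right]
    exact tsum_nonneg fun n => (stretchedExp_pos _ _ _).le
  refine ⟨2 * C1 + 2 * rayConst α + latticeSum α (1 / 2) 0, by positivity, ?_⟩
  intro ε hε hε1 t ht
  have hta : 0 < |t| := abs_pos.2 ht
  have hm := one_le_spectralMajorant α t
  -- near `0`, Poisson summation and the Lipschitz bound in the parameter; away from `0`, the series
  -- converges uniformly
  by_cases h1 : |t| ≤ 1
  · have ht2 : t ^ 2 ≤ 1 := by rw [← sq_abs]; nlinarith
    have e1 := abs_latticeSum_sub_stretchedFourier_le hα hα2 (by positivity : 0 < t ^ 2 / 2 + ε)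
      ht h1
    rw [← hC1] at e1
    have e2 := abs_stretchedFourier_sub_le hα hα2 (by positivity : 0 ≤ t ^ 2 / 2 + ε) hε.le ht
    rw [add_sub_cancel_right, abs_of_nonneg (by positivity : 0 ≤ t ^ 2 / 2)] at e2
    have hpow : t ^ 2 * |t| ^ (-(1 + α)) = |t| ^ (1 - α) := by
      rw [← sq_abs, ← Real.rpow_two, ← Real.rpow_add hta]
      ring_nf
    have hmaj : spectralMajorant α t = 1 + |t| ^ (1 - α) := by
      rw [spectralMajorant, Set.indicator_of_mem (show t ∈ Set.Icc (-1 : ℝ) 1 from abs_le.1 h1)]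
    have hp : 0 < |t| ^ (1 - α) := Real.rpow_pos_of_pos hta _
    have e3 := abs_sub_le (latticeSum α (t ^ 2 / 2 + ε) t)
      (stretchedFourier α (t ^ 2 / 2 + ε) t) (stretchedFourier α ε t)
    have e4 : 2 * rayConst α * (t ^ 2 / 2) * |t| ^ (-(1 + α)) = rayConst α * |t| ^ (1 - α) := by
      rw [← hpow]; ring
    have e5 : C1 * (t ^ 2 / 2 + ε) ≤ C1 * 2 :=
      mul_le_mul_of_nonneg_left (by linarith) hC1n
    rw [hmaj]
    nlinarith [mul_nonneg hC1n hp.le, mul_nonneg hC hp.le, mul_nonneg hL hp.le]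
  · push Not at h1
    have ht2 : 1 ≤ t ^ 2 := by rw [← sq_abs]; nlinarith
    have e1 := abs_latticeSum_le (t := t) hα (by norm_num : (0 : ℝ) < 1 / 2)
      (by linarith : 1 / 2 ≤ t ^ 2 / 2 + ε)
    have e2 := abs_stretchedFourier_le hα hα2 hε.le ht
    have e3 : |t| ^ (-(1 + α)) ≤ 1 := Real.rpow_le_one_of_one_le_of_nonpos h1.le (by linarith)
    have e4 : 2 * rayConst α * ε * |t| ^ (-(1 + α)) ≤ 2 * rayConst α * 1 * 1 := by
      have := Real.rpow_nonneg (abs_nonneg t) (-(1 + α))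
      gcongr
    have e5 := abs_sub (latticeSum α (t ^ 2 / 2 + ε) t) (stretchedFourier α ε t)
    nlinarith

lemma tendsto_latticeSum_add {α t : ℝ} (hα : 0 < α) (ht : t ≠ 0) :
    Tendsto (fun ε : ℝ => latticeSum α (t ^ 2 / 2 + ε) t) (𝓝[>] 0)
      (𝓝 (perturbedStructureFactor α t)) := by
  have ht2 : 0 < t ^ 2 / 2 := by positivity
  refine tendsto_tsum_of_dominated_convergence (summable_stretchedExp hα ht2) (fun n => ?_) ?_
  · refine Tendsto.mul_const _ ?_
    have : Continuous fun ε : ℝ => stretchedExp α (t ^ 2 / 2 + ε) n := by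
      unfold stretchedExp; fun_prop
    simpa using (this.tendsto 0).mono_left nhdsWithin_le_nhds
  · filter_upwards [self_mem_nhdsWithin] with ε hε n
    have hε : 0 < ε := hε
    rw [norm_mul, Real.norm_eq_abs, abs_of_pos (stretchedExp_pos _ _ _)]
    exact (mul_le_of_le_one_right (stretchedExp_pos _ _ _).le (Real.abs_cos_le_one _)).trans
      (stretchedExp_anti (by linarith))

/-- The approximate Dirac mass vanishes in the limit away from `0`. -/
lemma tendsto_stretchedFourier_zero {α t : ℝ} (hα : 0 < α) (hα2 : α < 2) (ht : t ≠ 0) :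
    Tendsto (fun ε : ℝ => stretchedFourier α ε t) (𝓝[>] 0) (𝓝 0) := by
  have h1 : Tendsto (fun ε : ℝ => 2 * rayConst α * ε * |t| ^ (-(1 + α))) (𝓝[>] 0) (𝓝 0) := by
    have : Continuous fun ε : ℝ => 2 * rayConst α * ε * |t| ^ (-(1 + α)) := by fun_prop
    simpa using (this.tendsto 0).mono_left nhdsWithin_le_nhds
  refine squeeze_zero_norm' ?_ h1
  filter_upwards [self_mem_nhdsWithin] with ε hε
  exact abs_stretchedFourier_le hα hα2 (le_of_lt hε) ht

/-- The bound on the structure factor, from its regularizations in the limit `ε → 0`. -/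
lemma exists_abs_perturbedStructureFactor_le {α : ℝ} (hα : 0 < α) (hα2 : α < 2) :
    ∃ K : ℝ, 0 ≤ K ∧ ∀ t : ℝ, t ≠ 0 →
      |perturbedStructureFactor α t| ≤ K * spectralMajorant α t := by
  obtain ⟨K, hK, h⟩ := exists_abs_latticeSum_sub_le hα hα2
  refine ⟨K, hK, fun t ht => ?_⟩
  have h1 := ((tendsto_latticeSum_add hα ht).sub (tendsto_stretchedFourier_zero hα hα2 ht)).abs
  rw [sub_zero] at h1
  refine le_of_tendsto h1 ?_
  filter_upwards [Ioc_mem_nhdsGT (zero_lt_one' ℝ)] with ε hε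
  exact h ε hε.1 hε.2 t ht

/-- The structure factor is equivalent to a power law at `0`. -/
lemma tendsto_perturbedStructureFactor_div {α : ℝ} (hα : 0 < α) (hα2 : α < 2) :
    Tendsto (fun t : ℝ => perturbedStructureFactor α t / |t| ^ (1 - α)) (𝓝[≠] 0)
      (𝓝 (Real.Gamma (α + 1) * Real.sin (α * (Real.pi / 2)))) := by
  set C1 : ℝ := 2 * rayConst α * ∑' k : ℤ, |(k : ℝ)| ^ (-(1 + α)) with hC1
  have h1 : Tendsto (fun t : ℝ => C1 / 2 * |t| ^ (1 + α)) (𝓝[≠] 0) (𝓝 0) := by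
    have : Continuous fun t : ℝ => C1 / 2 * |t| ^ (1 + α) :=
      continuous_const.mul (continuous_abs.rpow_const fun x => Or.inr (by linarith))
    have h2 := (this.tendsto 0).mono_left (nhdsWithin_le_nhds (s := {0}ᶜ))
    rwa [abs_zero, Real.zero_rpow (by linarith), mul_zero] at h2
  have h2 : Tendsto (fun t : ℝ => (perturbedStructureFactor α t -
      stretchedFourier α (t ^ 2 / 2) t) / |t| ^ (1 - α)) (𝓝[≠] 0) (𝓝 0) := by
    refine squeeze_zero_norm' ?_ h1
    have hball : ∀ᶠ t : ℝ in 𝓝[≠] 0, |t| ≤ 1 := by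
      refine nhdsWithin_le_nhds ?_
      filter_upwards [Metric.closedBall_mem_nhds (0 : ℝ) one_pos] with t ht
      simpa using ht
    filter_upwards [hball, self_mem_nhdsWithin] with t ht1 ht
    have ht : t ≠ 0 := ht
    have hta : 0 < |t| := abs_pos.2 ht
    have e := abs_latticeSum_sub_stretchedFourier_le hα hα2 (by positivity : 0 < t ^ 2 / 2) ht ht1
    rw [norm_div, Real.norm_eq_abs, Real.norm_eq_abs,
      abs_of_pos (Real.rpow_pos_of_pos hta (1 - α)), div_le_iff₀ (Real.rpow_pos_of_pos hta _),
      mul_assoc, ← Real.rpow_add hta]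
    have e2 : |t| ^ (1 + α + (1 - α)) = t ^ 2 := by
      rw [← sq_abs t, ← Real.rpow_two]; ring_nf
    rw [e2]
    rw [perturbedStructureFactor]
    linarith
  have h3 := h2.add (tendsto_stretchedFourier_div hα hα2)
  rw [zero_add] at h3
  refine h3.congr fun t => ?_
  ring

lemma perturbedStructureFactor_zero (α : ℝ) : perturbedStructureFactor α 0 = 0 := by
  rw [perturbedStructureFactor, latticeSum]
  -- all terms are `1`, and the sum of a divergent series is `0` by convention
  refine tsum_eq_zero_of_not_summable fun hs => ?_
  have h1 : ∀ n : ℤ, stretchedExp α (0 ^ 2 / 2) n * Real.cos (n * 0) = 1 := by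
    intro n; simp [stretchedExp]
  simp_rw [h1] at hs
  exact one_ne_zero (summable_const_iff _ |>.1 hs)

lemma measurable_perturbedStructureFactor {α : ℝ} (hα : 0 < α) :
    Measurable (perturbedStructureFactor α) := by
  have hlim : Tendsto (fun (s : Finset ℤ) (t : ℝ) => ({0}ᶜ : Set ℝ).indicator (fun t => ∑ n ∈ s,
      stretchedExp α (t ^ 2 / 2) n * Real.cos (n * t)) t) atTop
      (𝓝 (perturbedStructureFactor α)) := by
    rw [tendsto_pi_nhds]
    intro t
    by_cases ht : t = 0
    · subst ht
      simp [perturbedStructureFactor_zero]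
    · simp only [Set.indicator_of_mem (show t ∈ ({0}ᶜ : Set ℝ) from ht)]
      exact (summable_stretchedExp_mul_cos hα (by positivity : 0 < t ^ 2 / 2) t).hasSum
  refine measurable_of_tendsto_metrizable' atTop (fun s => ?_) hlim
  refine Measurable.indicator ?_ (measurableSet_singleton 0).compl
  unfold stretchedExp
  fun_prop

/-! ### Pairing of the structure factor with a Fourier transform -/

lemma ae_ne_zero : ∀ᵐ t : ℝ, t ≠ 0 := by simp [ae_iff]

lemma norm_exp_neg_I_mul (t x : ℝ) : ‖Complex.exp (-Complex.I * t * x)‖ = 1 := by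
  rw [Complex.norm_exp]; simp

lemma norm_exp_I_mul (t x : ℝ) : ‖Complex.exp (Complex.I * t * x)‖ = 1 := by
  rw [Complex.norm_exp]; simp

lemma fourierTransform_eq_fourier (φ : ℝ → ℂ) (t : ℝ) :
    fourierTransform φ t = FourierTransform.fourier φ (t / (2 * Real.pi)) := by
  have hpi := Real.pi_ne_zero
  rw [Real.fourier_real_eq_integral_exp_smul, fourierTransform]
  refine integral_congr_ae (Eventually.of_forall fun x => ?_)
  simp only [smul_eq_mul]
  congr 2
  push_cast
  have : (Real.pi : ℂ) ≠ 0 := by exact_mod_cast hpi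
  field_simp

lemma continuous_fourierTransform {φ : ℝ → ℂ} (hφ : Integrable φ) :
    Continuous (fourierTransform φ) := by
  have h1 : fourierTransform φ = fun t => FourierTransform.fourier φ (t / (2 * Real.pi)) :=
    funext fun t => fourierTransform_eq_fourier φ t
  have h2 : Continuous (FourierTransform.fourier φ) := by
    exact VectorFourier.fourierIntegral_continuous Real.continuous_fourierChar
      (innerSL ℝ).continuous₂ hφ
  rw [h1]
  exact h2.comp (by fun_prop)

lemma norm_fourierTransform_le (φ : ℝ → ℂ) (t : ℝ) :
    ‖fourierTransform φ t‖ ≤ ∫ x, ‖φ x‖ := by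
  refine (norm_integral_le_integral_norm _).trans (le_of_eq ?_)
  refine integral_congr_ae (Eventually.of_forall fun x => ?_)
  simp only [norm_mul, norm_exp_neg_I_mul, one_mul]

/-- Fourier inversion. -/
lemma integral_fourierTransform_mul_exp {ψ : ℝ → ℂ} (hc : Continuous ψ) (hi : Integrable ψ)
    (hG : Integrable (fourierTransform ψ)) (x : ℝ) :
    ∫ t : ℝ, fourierTransform ψ t * Complex.exp (Complex.I * t * x) = 2 * Real.pi * ψ x := by
  have hpi := Real.pi_pos
  have hF : Integrable (FourierTransform.fourier ψ) := by
    have := hG.comp_mul_left' (R := 2 * Real.pi) (by positivity)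
    refine this.congr (Eventually.of_forall fun t => ?_)
    simp only [fourierTransform_eq_fourier]
    field_simp
  have h1 := congrFun (hc.fourierInv_fourier_eq hi hF) x
  rw [Real.fourierInv_eq_fourier_neg, Real.fourier_real_eq_integral_exp_smul] at h1
  rw [← h1]
  have h2 := Measure.integral_comp_div (fun t : ℝ => FourierTransform.fourier ψ t *
    Complex.exp (2 * Real.pi * Complex.I * t * x)) (2 * Real.pi)
  rw [abs_of_pos (by positivity), Complex.real_smul] at h2
  push_cast at h2
  have h3 : ∀ v : ℝ, Complex.exp (((-2 * Real.pi * v * -x : ℝ) : ℂ) * Complex.I) •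
      FourierTransform.fourier ψ v = FourierTransform.fourier ψ v *
        Complex.exp (2 * Real.pi * Complex.I * v * x) := by
    intro v
    rw [smul_eq_mul, mul_comm]
    congr 2
    push_cast
    ring
  simp_rw [h3]
  rw [← h2]
  refine integral_congr_ae (Eventually.of_forall fun t => ?_)
  simp only [fourierTransform_eq_fourier]
  congr 2
  have : (Real.pi : ℂ) ≠ 0 := by exact_mod_cast hpi.ne'
  field_simp

/-- Parseval's identity against the stretched exponential. -/
lemma integral_fourierTransform_mul_stretchedFourier {α ε : ℝ} (hα : 0 < α) (hα2 : α < 2)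
    (hε : 0 < ε) {ψ : ℝ → ℂ} (hc : Continuous ψ) (hi : Integrable ψ)
    (hG : Integrable (fourierTransform ψ)) :
    ∫ t : ℝ, fourierTransform ψ t * (stretchedFourier α ε t : ℂ) =
      2 * Real.pi * ∫ x : ℝ, (stretchedExp α ε x : ℂ) * ψ (-x) := by
  have h0 : ∫ t : ℝ, fourierTransform ψ t * (stretchedFourier α ε t : ℂ) =
      ∫ t : ℝ, ∫ x : ℝ, fourierTransform ψ t *
        (Complex.exp (-Complex.I * t * x) * (stretchedExp α ε x : ℂ)) := by
    refine integral_congr_ae ?_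
    filter_upwards [ae_ne_zero] with t ht
    rw [← fourierTransform_stretchedExp hα hα2 hε ht, fourierTransform, integral_const_mul]
    rfl
  rw [h0, integral_integral_swap, ← integral_const_mul]
  · refine integral_congr_ae (Eventually.of_forall fun x => ?_)
    simp only
    have := integral_fourierTransform_mul_exp hc hi hG (-x)
    rw [mul_left_comm, ← this, ← integral_const_mul]
    refine integral_congr_ae (Eventually.of_forall fun t => ?_)
    simp only
    push_cast
    ring_nf
  · have h2 : Integrable (Function.uncurry fun t x : ℝ =>
        fourierTransform ψ t * (stretchedExp α ε x : ℂ)) (volume.prod volume) :=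
      hG.mul_prod (integrable_stretchedExp hα hε).ofReal
    refine h2.mono ?_ (Eventually.of_forall fun p => ?_)
    · have h3 : Continuous (stretchedExp α ε) := continuous_stretchedExp hα ε
      have h4 := continuous_fourierTransform hi
      refine Continuous.aestronglyMeasurable ?_
      simp only [Function.uncurry_def]
      fun_prop
    · simp only [Function.uncurry, norm_mul, norm_exp_neg_I_mul, one_mul]
      exact le_rfl

lemma integrable_norm_fourierTransform_mul_spectralMajorant {α : ℝ} (hα2 : α < 2) {ψ : ℝ → ℂ}
    (hG : Integrable (fourierTransform ψ)) :
    Integrable fun t => ‖fourierTransform ψ t‖ * spectralMajorant α t :=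
  integrable_mul_spectralMajorant hα2 hG.norm
    (M := ∫ x, ‖ψ x‖) fun t => by
      rw [abs_of_nonneg (norm_nonneg _)]; exact norm_fourierTransform_le ψ t

lemma integrable_fourierTransform_mul_perturbedStructureFactor {α : ℝ} (hα : 0 < α) (hα2 : α < 2)
    {ψ : ℝ → ℂ} (hG : Integrable (fourierTransform ψ)) :
    Integrable fun t => fourierTransform ψ t * (perturbedStructureFactor α t : ℂ) := by
  obtain ⟨K, hK, h⟩ := exists_abs_perturbedStructureFactor_le hα hα2
  refine ((integrable_norm_fourierTransform_mul_spectralMajorant hα2 hG).const_mul K).mono' ?_ ?_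
  · exact hG.aestronglyMeasurable.mul
      (Complex.measurable_ofReal.comp (measurable_perturbedStructureFactor hα)).aestronglyMeasurable
  · filter_upwards [ae_ne_zero] with t ht
    rw [norm_mul, Complex.norm_real, Real.norm_eq_abs]
    have := mul_le_mul_of_nonneg_left (h t ht) (norm_nonneg (fourierTransform ψ t))
    linarith

/-- The mean of `2 π ψ` at the lattice point `n` with its Gaussian perturbation, in terms of the
Fourier transform of `ψ`. -/
noncomputable def latticeCoeff (α : ℝ) (ψ : ℝ → ℂ) (n : ℤ) : ℂ :=
  ∫ t : ℝ, fourierTransform ψ t *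
    ((stretchedExp α (t ^ 2 / 2) n : ℂ) * Complex.exp (Complex.I * t * n))

lemma continuous_stretchedExp_sq (α : ℝ) (x : ℝ) :
    Continuous fun t : ℝ => stretchedExp α (t ^ 2 / 2) x := by
  unfold stretchedExp; fun_prop

lemma norm_latticeTerm_le (α : ℝ) (ψ : ℝ → ℂ) (n : ℤ) (t : ℝ) :
    ‖fourierTransform ψ t * ((stretchedExp α (t ^ 2 / 2) n : ℂ) *
      Complex.exp (Complex.I * t * n))‖ ≤ ‖fourierTransform ψ t‖ := by
  have h1 := norm_exp_I_mul t n
  push_cast at h1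
  rw [norm_mul, norm_mul, h1, mul_one, Complex.norm_real, Real.norm_eq_abs,
    abs_of_pos (stretchedExp_pos _ _ _)]
  exact mul_le_of_le_one_right (norm_nonneg _) (stretchedExp_le_one (by positivity))

lemma integrable_latticeTerm (α : ℝ) {ψ : ℝ → ℂ} (hi : Integrable ψ)
    (hG : Integrable (fourierTransform ψ)) (n : ℤ) :
    Integrable fun t : ℝ => fourierTransform ψ t *
      ((stretchedExp α (t ^ 2 / 2) n : ℂ) * Complex.exp (Complex.I * t * n)) := by
  refine hG.mono ?_ (Eventually.of_forall fun t => norm_latticeTerm_le α ψ n t)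
  have h3 := continuous_stretchedExp_sq α n
  have h4 := continuous_fourierTransform hi
  exact Continuous.aestronglyMeasurable (by fun_prop)

/-- The regularization by a stretched exponential allows to exchange the sum and the integral. -/
lemma tsum_latticeCoeff_mul {α ε : ℝ} (hα : 0 < α) (hε : 0 < ε) {ψ : ℝ → ℂ}
    (hi : Integrable ψ) (hG : Integrable (fourierTransform ψ)) :
    ∑' n : ℤ, latticeCoeff α ψ n * (stretchedExp α ε n : ℂ) =
      ∫ t : ℝ, fourierTransform ψ t * (latticeSum α (t ^ 2 / 2 + ε) t : ℂ) := by
  have h1 := hasSum_integral_of_summable_integral_norm (μ := (volume : Measure ℝ))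
    (F := fun (n : ℤ) (t : ℝ) => fourierTransform ψ t *
      ((stretchedExp α (t ^ 2 / 2) n : ℂ) * Complex.exp (Complex.I * t * n)) *
        (stretchedExp α ε n : ℂ))
    (fun n => (integrable_latticeTerm α hi hG n).mul_const _) ?_
  · simp_rw [integral_mul_const] at h1
    have h2 := h1.tsum_eq
    unfold latticeCoeff
    rw [h2]
    refine integral_congr_ae (Eventually.of_forall fun t => ?_)
    simp only
    rw [← (hasSum_latticeSum hα (by positivity : 0 < t ^ 2 / 2 + ε) t).tsum_eq, ← tsum_mul_left]
    refine tsum_congr fun n => ?_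
    rw [stretchedExp_add]
    push_cast
    ring
  · refine Summable.of_nonneg_of_le (fun n => integral_nonneg fun t => norm_nonneg _) (fun n => ?_)
      ((summable_stretchedExp hα hε).mul_left (∫ t, ‖fourierTransform ψ t‖))
    rw [← integral_mul_const]
    refine integral_mono ((integrable_latticeTerm α hi hG n).mul_const _).norm
      (hG.norm.mul_const _) fun t => ?_
    simp only
    rw [norm_mul, Complex.norm_real, Real.norm_eq_abs, abs_of_pos (stretchedExp_pos _ _ _)]
    exact mul_le_mul_of_nonneg_right (norm_latticeTerm_le α ψ n t) (stretchedExp_pos _ _ _).le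

lemma measurable_latticeSum_add {α ε : ℝ} (hα : 0 < α) (hε : 0 < ε) :
    Measurable fun t : ℝ => latticeSum α (t ^ 2 / 2 + ε) t := by
  have hlim : Tendsto (fun (s : Finset ℤ) (t : ℝ) => ∑ n ∈ s,
      stretchedExp α (t ^ 2 / 2 + ε) n * Real.cos (n * t)) atTop
      (𝓝 fun t : ℝ => latticeSum α (t ^ 2 / 2 + ε) t) := by
    rw [tendsto_pi_nhds]
    intro t
    exact (summable_stretchedExp_mul_cos hα (by positivity : 0 < t ^ 2 / 2 + ε) t).hasSum
  refine measurable_of_tendsto_metrizable' atTop (fun s => ?_) hlim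
  unfold stretchedExp
  fun_prop

lemma aestronglyMeasurable_stretchedFourier {α ε : ℝ} (hα : 0 < α) (hα2 : α < 2) (hε : 0 < ε) :
    AEStronglyMeasurable (fun t : ℝ => stretchedFourier α ε t) volume := by
  have h1 : Continuous (fourierTransform fun x => (stretchedExp α ε x : ℂ)) :=
    continuous_fourierTransform (integrable_stretchedExp hα hε).ofReal
  refine (Complex.continuous_re.comp h1).aestronglyMeasurable.congr ?_
  filter_upwards [ae_ne_zero] with t ht
  simp only [Function.comp]
  rw [fourierTransform_stretchedExp hα hα2 hε ht, Complex.ofReal_re]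

/-- The summation formula behind the structure factor: summing over the lattice produces a Dirac
mass at the frequency `0`, coming from the mean density, and the structure factor. -/
lemma tsum_latticeCoeff {α : ℝ} (hα : 0 < α) (hα2 : α < 2) {ψ : ℝ → ℂ} (hc : Continuous ψ)
    (hi : Integrable ψ) (hG : Integrable (fourierTransform ψ))
    (hs : Summable fun n : ℤ => latticeCoeff α ψ n) :
    ∑' n : ℤ, latticeCoeff α ψ n = 2 * Real.pi * fourierTransform ψ 0 +
      ∫ t : ℝ, fourierTransform ψ t * (perturbedStructureFactor α t : ℂ) := by
  obtain ⟨K, hK, hbound⟩ := exists_abs_latticeSum_sub_le hα hα2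
  have hcont : ∀ x : ℝ, Tendsto (fun ε : ℝ => (stretchedExp α ε x : ℂ)) (𝓝[>] 0) (𝓝 1) := by
    intro x
    have : Continuous fun ε : ℝ => (stretchedExp α ε x : ℂ) := by unfold stretchedExp; fun_prop
    have h := (this.tendsto 0).mono_left (nhdsWithin_le_nhds (s := Set.Ioi 0))
    simpa [stretchedExp] using h
  -- the regularized sum tends to the sum over the lattice
  have hL : Tendsto (fun ε : ℝ => ∑' n : ℤ, latticeCoeff α ψ n * (stretchedExp α ε n : ℂ))
      (𝓝[>] 0) (𝓝 (∑' n : ℤ, latticeCoeff α ψ n)) := by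
    refine tendsto_tsum_of_dominated_convergence hs.norm (fun n => ?_) ?_
    · simpa using (hcont n).const_mul (latticeCoeff α ψ n)
    · filter_upwards [self_mem_nhdsWithin] with ε hε n
      rw [norm_mul, Complex.norm_real, Real.norm_eq_abs, abs_of_pos (stretchedExp_pos _ _ _)]
      exact mul_le_of_le_one_right (norm_nonneg _) (stretchedExp_le_one (le_of_lt hε))
  -- the term of frequency `0` in Poisson summation tends to a Dirac mass
  have h1 : Tendsto (fun ε : ℝ => ∫ t : ℝ, fourierTransform ψ t * (stretchedFourier α ε t : ℂ))
      (𝓝[>] 0) (𝓝 (2 * Real.pi * fourierTransform ψ 0)) := by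
    have h2 : Tendsto (fun ε : ℝ => 2 * Real.pi * ∫ x : ℝ, (stretchedExp α ε x : ℂ) * ψ (-x))
        (𝓝[>] 0) (𝓝 (2 * Real.pi * ∫ x : ℝ, ψ (-x))) := by
      refine Tendsto.const_mul _ ?_
      refine tendsto_integral_filter_of_dominated_convergence (fun x => ‖ψ (-x)‖) ?_ ?_
        hi.comp_neg.norm ?_
      · refine Eventually.of_forall fun ε => Continuous.aestronglyMeasurable ?_
        have := continuous_stretchedExp hα ε
        fun_prop
      · filter_upwards [self_mem_nhdsWithin] with ε hε
        refine Eventually.of_forall fun x => ?_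
        rw [norm_mul, Complex.norm_real, Real.norm_eq_abs, abs_of_pos (stretchedExp_pos _ _ _)]
        exact mul_le_of_le_one_left (norm_nonneg _) (stretchedExp_le_one (le_of_lt hε))
      · refine Eventually.of_forall fun x => ?_
        simpa using (hcont x).mul_const (ψ (-x))
    have h3 : ∫ x : ℝ, ψ (-x) = fourierTransform ψ 0 := by
      rw [integral_neg_eq_self (fun x => ψ x), fourierTransform]
      simp
    rw [h3] at h2
    refine h2.congr' ?_
    filter_upwards [self_mem_nhdsWithin] with ε hε
    exact (integral_fourierTransform_mul_stretchedFourier hα hα2 hε hc hi hG).symm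
  have hmeas : ∀ ε : ℝ, 0 < ε → AEStronglyMeasurable (fun t : ℝ => fourierTransform ψ t *
      ((latticeSum α (t ^ 2 / 2 + ε) t - stretchedFourier α ε t : ℝ) : ℂ)) volume := by
    intro ε hε
    have h5 := (measurable_latticeSum_add hα hε).aestronglyMeasurable (μ := volume)
    exact hG.aestronglyMeasurable.mul (Complex.continuous_ofReal.comp_aestronglyMeasurable
      (h5.sub (aestronglyMeasurable_stretchedFourier hα hα2 hε)))
  have hdom : ∀ ε : ℝ, 0 < ε → ε ≤ 1 → ∀ᵐ t : ℝ, ‖fourierTransform ψ t *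
      ((latticeSum α (t ^ 2 / 2 + ε) t - stretchedFourier α ε t : ℝ) : ℂ)‖ ≤
        K * (‖fourierTransform ψ t‖ * spectralMajorant α t) := by
    intro ε hε hε1
    filter_upwards [ae_ne_zero] with t ht
    rw [norm_mul, Complex.norm_real, Real.norm_eq_abs]
    have := mul_le_mul_of_nonneg_left (hbound ε hε hε1 t ht) (norm_nonneg (fourierTransform ψ t))
    linarith
  have hmaj := (integrable_norm_fourierTransform_mul_spectralMajorant hα2 hG).const_mul K
  -- the other terms tend to the structure factor
  have h4 : Tendsto (fun ε : ℝ => ∫ t : ℝ, fourierTransform ψ t *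
      ((latticeSum α (t ^ 2 / 2 + ε) t - stretchedFourier α ε t : ℝ) : ℂ)) (𝓝[>] 0)
      (𝓝 (∫ t : ℝ, fourierTransform ψ t * (perturbedStructureFactor α t : ℂ))) := by
    refine tendsto_integral_filter_of_dominated_convergence _ ?_ ?_ hmaj ?_
    · filter_upwards [self_mem_nhdsWithin] with ε hε using hmeas ε hε
    · filter_upwards [Ioc_mem_nhdsGT (zero_lt_one' ℝ)] with ε hε using hdom ε hε.1 hε.2
    · filter_upwards [ae_ne_zero] with t ht
      refine Tendsto.const_mul _ ((Complex.continuous_ofReal.tendsto _).comp ?_)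
      simpa using (tendsto_latticeSum_add hα ht).sub (tendsto_stretchedFourier_zero hα hα2 ht)
  refine tendsto_nhds_unique hL ((h1.add h4).congr' ?_)
  filter_upwards [Ioc_mem_nhdsGT (zero_lt_one' ℝ)] with ε hε
  have h6 : Integrable fun t : ℝ => fourierTransform ψ t * (stretchedFourier α ε t : ℂ) := by
    refine hG.mul_bdd (c := ∫ x, ‖(stretchedExp α ε x : ℂ)‖)
      (Complex.continuous_ofReal.comp_aestronglyMeasurable
        (aestronglyMeasurable_stretchedFourier hα hα2 hε.1)) ?_
    filter_upwards [ae_ne_zero] with t ht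
    rw [← fourierTransform_stretchedExp hα hα2 hε.1 ht]
    exact norm_fourierTransform_le _ t
  rw [tsum_latticeCoeff_mul hα hε.1 hi hG,
    ← integral_add h6 (hmaj.mono' (hmeas ε hε.1) (hdom ε hε.1 hε.2))]
  refine integral_congr_ae (Eventually.of_forall fun t => ?_)
  simp only
  push_cast
  ring

/-! ### Fractional Brownian motion and the intensity of the perturbed lattice -/

section FractionalBrownianMotion

variable {Ω : Type*} [MeasurableSpace Ω] {P : Measure Ω} {h : ℝ} {B : ℝ → Ω → ℝ}

lemma IsFractionalBrownianMotion.map_eq (hB : IsFractionalBrownianMotion P h B) (x : ℝ) :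
    P.map (B x) = gaussianReal 0 (|x| ^ (2 * h)).toNNReal := by
  rw [(hB.isGaussianProcess.hasGaussianLaw_eval x).map_eq_gaussianReal, hB.variogram x,
    hB.centered x]

lemma IsFractionalBrownianMotion.map_sub (hB : IsFractionalBrownianMotion P h B) (x y : ℝ) :
    P.map (fun ω => B x ω - B y ω) = gaussianReal 0 (|x - y| ^ (2 * h)).toNNReal := by
  have h1 := congrArg (Measure.map fun f : ℝ → ℝ => f (x - y)) (hB.stationary_increments y)
  have hm := hB.measurable
  rw [Measure.map_map (measurable_pi_apply _) (measurable_pi_lambda _ fun z => by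
    exact (hm _).sub (hm _)), Measure.map_map (measurable_pi_apply _)
    (measurable_pi_lambda _ fun z => hm z)] at h1
  rw [← hB.map_eq (x - y)]
  simpa [Function.comp_def] using h1

/-- The characteristic function of a centered Gaussian variable of variance `|x| ^ α`. -/
lemma integral_exp_I_mul_of_map_eq {X : Ω → ℝ} (hX : AEMeasurable X P) {x α : ℝ}
    (hmap : P.map X = gaussianReal 0 (|x| ^ α).toNNReal) (t : ℝ) :
    ∫ ω, Complex.exp (Complex.I * t * X ω) ∂P = (stretchedExp α (t ^ 2 / 2) x : ℂ) := by
  have h1 := charFun_gaussianReal (μ := 0) (v := (|x| ^ α).toNNReal) t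
  rw [← hmap, charFun_apply_real, integral_map hX (by fun_prop),
    Real.coe_toNNReal _ (Real.rpow_nonneg (abs_nonneg x) _)] at h1
  rw [stretchedExp]
  push_cast
  calc _ = ∫ ω, Complex.exp (t * X ω * Complex.I) ∂P := by
        congr 1; ext ω; congr 1; ring
    _ = _ := by
        rw [h1]; congr 1; push_cast; ring

/-- The Gaussian tail bound, by Chernoff's inequality. -/
lemma measureReal_le_abs_of_map_eq [IsProbabilityMeasure P] {X : Ω → ℝ} {v c : ℝ} (hv : 0 < v)
    (hc : 0 ≤ c) (hmap : P.map X = gaussianReal 0 v.toNNReal) :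
    P.real {ω | c ≤ |X ω|} ≤ 2 * Real.exp (-(c ^ 2 / (2 * v))) := by
  have hmgf := mgf_gaussianReal hmap
  have hint : ∀ t, Integrable (fun ω => Real.exp (t * X ω)) P := by
    intro t
    by_contra hn
    have h1 := hmgf t
    rw [mgf_undef hn] at h1
    exact (Real.exp_pos _).ne h1
  rw [Real.coe_toNNReal _ hv.le] at hmgf
  have h1 := measure_ge_le_exp_mul_mgf (μ := P) (X := X) (t := c / v) c (by positivity) (hint _)
  have h2 := measure_le_le_exp_mul_mgf (μ := P) (X := X) (t := -(c / v)) (-c)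
    (by rw [neg_nonpos]; positivity) (hint _)
  rw [hmgf, ← Real.exp_add] at h1 h2
  have e1 : -(c / v) * c + (0 * (c / v) + v * (c / v) ^ 2 / 2) = -(c ^ 2 / (2 * v)) := by
    field_simp; ring
  have e2 : - -(c / v) * -c + (0 * -(c / v) + v * (-(c / v)) ^ 2 / 2) = -(c ^ 2 / (2 * v)) := by
    field_simp; ring
  rw [e1] at h1
  rw [e2] at h2
  have h3 : {ω | c ≤ |X ω|} ⊆ {ω | c ≤ X ω} ∪ {ω | X ω ≤ -c} := by
    intro ω hω
    rcases le_abs.1 (show c ≤ |X ω| from hω) with h | h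
    · exact Or.inl h
    · exact Or.inr (by simp only [Set.mem_ofPred_eq]; linarith)
  calc P.real {ω | c ≤ |X ω|} ≤ P.real ({ω | c ≤ X ω} ∪ {ω | X ω ≤ -c}) := measureReal_mono h3
    _ ≤ P.real {ω | c ≤ X ω} + P.real {ω | X ω ≤ -c} := measureReal_union_le _ _
    _ ≤ _ := by linarith

/-- The intensity measure of the perturbed lattice. -/
noncomputable def latticeIntensity (P : Measure Ω) (B : ℝ → Ω → ℝ) : Measure ℝ :=
  Measure.sum fun n : ℤ => P.map fun ω => (n : ℝ) + B n ω

/-- The probability that the lattice point `n` is moved near the origin, which is summable in `n`.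
For `|n| ≤ 2 m` the bound is at least `1`; for `|n| > 2 m` the displacement is at least
`|n| / 2`. -/
lemma IsFractionalBrownianMotion.measure_abs_add_le [IsProbabilityMeasure P]
    (hB : IsFractionalBrownianMotion P h B) (h_lt_one : h < 1) {m : ℝ} (hm : 0 ≤ m) (n : ℤ) :
    P {ω | |(n : ℝ) + B n ω| ≤ m} ≤ ENNReal.ofReal
      (2 * Real.exp (1 / 8 * (2 * m) ^ (2 - 2 * h)) * stretchedExp (2 - 2 * h) (1 / 8) n) := by
  have hpow : ∀ x : ℝ, 0 ≤ x → 0 ≤ x ^ (2 - 2 * h) := fun x hx => Real.rpow_nonneg hx _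
  rcases le_or_gt |(n : ℝ)| (2 * m) with hn | hn
  · refine prob_le_one.trans ?_
    rw [← ENNReal.ofReal_one]
    refine ENNReal.ofReal_le_ofReal ?_
    rw [stretchedExp, mul_assoc, ← Real.exp_add]
    have h1 := Real.rpow_le_rpow (abs_nonneg (n : ℝ)) hn (by linarith : 0 ≤ 2 - 2 * h)
    have h2 : (1 : ℝ) ≤ Real.exp (1 / 8 * (2 * m) ^ (2 - 2 * h) +
        -(1 / 8 * |(n : ℝ)| ^ (2 - 2 * h))) := Real.one_le_exp (by linarith)
    linarith
  · have hn0 : 0 < |(n : ℝ)| := by linarith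
    have h1 := measureReal_le_abs_of_map_eq (P := P) (X := B n)
      (Real.rpow_pos_of_pos hn0 (2 * h)) (by positivity : 0 ≤ |(n : ℝ)| / 2) (hB.map_eq n)
    have h2 : {ω | |(n : ℝ) + B n ω| ≤ m} ⊆ {ω | |(n : ℝ)| / 2 ≤ |B n ω|} := by
      intro ω hω
      have hω : |(n : ℝ) + B n ω| ≤ m := hω
      have h3 := abs_sub_abs_le_abs_sub (n : ℝ) (-B n ω)
      rw [abs_neg, sub_neg_eq_add] at h3
      simp only [Set.mem_ofPred_eq]
      linarith
    have e : (|(n : ℝ)| / 2) ^ 2 / (2 * |(n : ℝ)| ^ (2 * h)) =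
        1 / 8 * |(n : ℝ)| ^ (2 - 2 * h) := by
      rw [Real.rpow_sub hn0, Real.rpow_two]
      field_simp
      norm_num
    rw [e] at h1
    rw [← ofReal_measureReal]
    refine ENNReal.ofReal_le_ofReal ((measureReal_mono h2).trans (h1.trans ?_))
    rw [stretchedExp]
    have h4 : 1 ≤ Real.exp (1 / 8 * (2 * m) ^ (2 - 2 * h)) :=
      Real.one_le_exp (mul_nonneg (by norm_num) (hpow _ (by positivity)))
    have h5 := Real.exp_pos (-(1 / 8 * |(n : ℝ)| ^ (2 - 2 * h)))
    nlinarith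

lemma IsFractionalBrownianMotion.measurable_add (hB : IsFractionalBrownianMotion P h B) (n : ℤ) :
    Measurable fun ω => (n : ℝ) + B n ω := (hB.measurable n).const_add _

lemma IsFractionalBrownianMotion.latticeIntensity_closedBall_lt_top [IsProbabilityMeasure P]
    (hB : IsFractionalBrownianMotion P h B) (h_lt_one : h < 1) {m : ℝ} (hm : 0 ≤ m) :
    latticeIntensity P B (Metric.closedBall 0 m) < ∞ := by
  rw [latticeIntensity, Measure.sum_apply _ measurableSet_closedBall]
  have hs := (summable_stretchedExp (α := 2 - 2 * h) (a := 1 / 8) (by linarith)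
    (by norm_num)).mul_left (2 * Real.exp (1 / 8 * (2 * m) ^ (2 - 2 * h)))
  refine lt_of_le_of_lt (ENNReal.tsum_le_tsum fun n => ?_) hs.tsum_ofReal_lt_top
  rw [Measure.map_apply (hB.measurable_add n) measurableSet_closedBall]
  refine le_trans (measure_mono fun ω hω => ?_) (hB.measure_abs_add_le h_lt_one hm n)
  simpa using hω

lemma IsFractionalBrownianMotion.isFiniteMeasureOnCompacts [IsProbabilityMeasure P]
    (hB : IsFractionalBrownianMotion P h B) (h_lt_one : h < 1) :
    IsFiniteMeasureOnCompacts (latticeIntensity P B) where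
  lt_top_of_isCompact := by
    intro K hK
    obtain ⟨r, hr⟩ := hK.isBounded.subset_closedBall 0
    refine lt_of_le_of_lt (measure_mono (hr.trans (Metric.closedBall_subset_closedBall
      (le_max_left r 0)))) (hB.latticeIntensity_closedBall_lt_top h_lt_one (le_max_right r 0))

/-- The mean of `ψ` at the perturbed lattice point `n`. -/
lemma IsFractionalBrownianMotion.integral_comp_add [IsProbabilityMeasure P]
    (hB : IsFractionalBrownianMotion P h B) {ψ : ℝ → ℂ} (hc : Continuous ψ) (hi : Integrable ψ)
    (hG : Integrable (fourierTransform ψ)) (n : ℤ) :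
    2 * Real.pi * ∫ ω, ψ (n + B n ω) ∂P = latticeCoeff (2 * h) ψ n := by
  have hpi := Real.pi_pos
  rw [← integral_const_mul]
  simp_rw [← integral_fourierTransform_mul_exp hc hi hG]
  rw [integral_integral_swap]
  · rw [latticeCoeff]
    refine integral_congr_ae (Eventually.of_forall fun t => ?_)
    simp only
    rw [← integral_exp_I_mul_of_map_eq (hB.measurable n).aemeasurable (hB.map_eq n) t,
      mul_comm (∫ ω, _ ∂P), ← integral_const_mul, ← integral_const_mul]
    refine integral_congr_ae (Eventually.of_forall fun ω => ?_)
    simp only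
    rw [← Complex.exp_add]
    congr 2
    push_cast
    ring
  · have h2 : Integrable (Function.uncurry fun (ω : Ω) (t : ℝ) =>
        (1 : ℂ) * fourierTransform ψ t) (P.prod volume) :=
      (integrable_const (1 : ℂ)).mul_prod hG
    refine h2.mono ?_ (Eventually.of_forall fun p => ?_)
    · have h4 := (continuous_fourierTransform hi).measurable
      have h5 := hB.measurable n
      refine Measurable.aestronglyMeasurable ?_
      simp only [Function.uncurry_def]
      fun_prop
    · simp only [Function.uncurry, norm_mul, one_mul]
      have := norm_exp_I_mul p.2 (n + B n p.1)
      push_cast at this ⊢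
      rw [this, mul_one]

/-- Campbell's formula for the perturbed lattice, in the frequency domain. -/
lemma IsFractionalBrownianMotion.integral_latticeIntensity [IsProbabilityMeasure P]
    (hB : IsFractionalBrownianMotion P h B) (h_pos : 0 < h) (h_lt_one : h < 1) {ψ : ℝ → ℂ}
    (hc : Continuous ψ) (hs : HasCompactSupport ψ) (hG : Integrable (fourierTransform ψ)) :
    2 * Real.pi * ∫ x, ψ x ∂latticeIntensity P B = 2 * Real.pi * fourierTransform ψ 0 +
      ∫ t : ℝ, fourierTransform ψ t * (perturbedStructureFactor (2 * h) t : ℂ) := by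
  have hi : Integrable ψ := hc.integrable_of_hasCompactSupport hs
  have := hB.isFiniteMeasureOnCompacts h_lt_one
  have hi' : Integrable ψ (latticeIntensity P B) := hc.integrable_of_hasCompactSupport hs
  have h1 := (hasSum_integral_measure (μ := fun n : ℤ => P.map fun ω => (n : ℝ) + B n ω)
    hi').mul_left (2 * Real.pi : ℂ)
  have h2 : ∀ n : ℤ, 2 * Real.pi * ∫ x, ψ x ∂(P.map fun ω => (n : ℝ) + B n ω) =
      latticeCoeff (2 * h) ψ n := by
    intro n
    rw [integral_map (hB.measurable_add n).aemeasurable hc.aestronglyMeasurable]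
    simpa using hB.integral_comp_add hc hi hG n
  simp_rw [h2] at h1
  rw [← tsum_latticeCoeff (by positivity) (by linarith) hc hi hG h1.summable, h1.tsum_eq]
  rfl

/-- The sum of a Toeplitz matrix is a sum of partial sums. -/
lemma sum_range_sum_range_succ_of_even {a : ℤ → ℝ} (ha : ∀ n, a (-n) = a n) (N : ℕ) :
    ∑ j ∈ Finset.range N, ∑ k ∈ Finset.range N, a ((j : ℤ) - k) =
      ∑ M ∈ Finset.range N, (a 0 + 2 * ∑ j ∈ Finset.range M, a (j + 1)) := by
  induction N with
  | zero => simp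
  | succ N ih =>
    rw [Finset.sum_range_succ (fun M => a 0 + _), ← ih, Finset.sum_range_succ]
    simp_rw [Finset.sum_range_succ _ N]
    rw [Finset.sum_add_distrib]
    have h1 : ∑ k ∈ Finset.range N, a ((N : ℤ) - k) = ∑ j ∈ Finset.range N, a (j + 1) := by
      rw [← Finset.sum_range_reflect]
      refine Finset.sum_congr rfl fun j hj => ?_
      have := Finset.mem_range.1 hj
      congr 1
      omega
    have h2 : ∑ j ∈ Finset.range N, a ((j : ℤ) - N) = ∑ j ∈ Finset.range N, a (j + 1) := by
      rw [← h1]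
      refine Finset.sum_congr rfl fun j _ => ?_
      rw [← ha]
      congr 1
      ring
    rw [h1, h2, sub_self]
    ring

/-- The structure factor is nonnegative, as a Cesàro limit of the normalized mean squares of the
exponential sums over the perturbed lattice. -/
lemma IsFractionalBrownianMotion.perturbedStructureFactor_nonneg [IsProbabilityMeasure P]
    (hB : IsFractionalBrownianMotion P h B) (h_pos : 0 < h) {t : ℝ} (ht : t ≠ 0) :
    0 ≤ perturbedStructureFactor (2 * h) t := by
  have ht2 : 0 < t ^ 2 / 2 := by positivity
  set a : ℤ → ℝ := fun n => stretchedExp (2 * h) (t ^ 2 / 2) n * Real.cos (n * t) with ha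
  have heven : ∀ n, a (-n) = a n := fun n => by simp [ha, stretchedExp_neg]
  have hsum : Summable a := summable_stretchedExp_mul_cos (by positivity) ht2 t
  have hlim : Tendsto (fun M : ℕ => a 0 + 2 * ∑ j ∈ Finset.range M, a (j + 1)) atTop
      (𝓝 (perturbedStructureFactor (2 * h) t)) := by
    have h1 : Summable fun n : ℕ => a (n + 1) :=
      hsum.comp_injective (i := fun n : ℕ => (n : ℤ) + 1) fun m n hmn => by
        simpa using hmn
    have h2 : perturbedStructureFactor (2 * h) t = a 0 + 2 * ∑' n : ℕ, a (n + 1) := by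
      have h3 : ∀ n : ℕ, a (-((n : ℤ) + 1)) = a (n + 1) := fun n => heven _
      have h4 := (HasSum.of_add_one_of_neg_add_one (f := a) h1.hasSum
        (by simpa only [h3] using h1.hasSum)).tsum_eq
      rw [perturbedStructureFactor, latticeSum, h4]
      ring
    rw [h2]
    exact (h1.hasSum.tendsto_sum_nat.const_mul 2).const_add _
  refine ge_of_tendsto' hlim.cesaro fun N => ?_
  refine mul_nonneg (by positivity) ?_
  rw [← sum_range_sum_range_succ_of_even heven]
  have hexp : ∀ j k : ℕ, ∫ ω, Complex.exp (Complex.I * t * (j + B j ω : ℝ)) *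
      (starRingEnd ℂ) (Complex.exp (Complex.I * t * (k + B k ω : ℝ))) ∂P =
      Complex.exp (Complex.I * t * ((j : ℝ) - k : ℝ)) *
        (stretchedExp (2 * h) (t ^ 2 / 2) ((j : ℝ) - k) : ℂ) := by
    intro j k
    rw [← integral_exp_I_mul_of_map_eq ((hB.measurable j).sub (hB.measurable k)).aemeasurable
      (hB.map_sub j k) t, ← integral_const_mul]
    refine integral_congr_ae (Eventually.of_forall fun ω => ?_)
    simp only [← Complex.exp_conj, map_mul, Complex.conj_I, Complex.conj_ofReal]
    rw [← Complex.exp_add, ← Complex.exp_add, Pi.sub_apply]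
    congr 1
    push_cast
    ring
  have hre : ∀ j k : ℕ, a ((j : ℤ) - k) = (∫ ω, Complex.exp (Complex.I * t * (j + B j ω : ℝ)) *
      (starRingEnd ℂ) (Complex.exp (Complex.I * t * (k + B k ω : ℝ))) ∂P).re := by
    intro j k
    have : Complex.I * t * ((j : ℝ) - k : ℝ) = ((((j : ℝ) - k) * t : ℝ) : ℂ) * Complex.I := by
      push_cast; ring
    rw [hexp, Complex.re_mul_ofReal, this, Complex.exp_ofReal_mul_I_re, ha]
    push_cast
    ring
  have hint : ∀ j k : ℕ, Integrable (fun ω => Complex.exp (Complex.I * t * (j + B j ω : ℝ)) *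
      (starRingEnd ℂ) (Complex.exp (Complex.I * t * (k + B k ω : ℝ)))) P := by
    intro j k
    refine Integrable.of_bound (C := 1) (Measurable.aestronglyMeasurable ?_)
      (Eventually.of_forall fun ω => ?_)
    · have h1 := hB.measurable j
      have h2 := hB.measurable k
      have h3 := Complex.continuous_conj.measurable
      fun_prop
    · rw [norm_mul, RCLike.norm_conj, norm_exp_I_mul, norm_exp_I_mul, one_mul]
  simp_rw [hre, ← Complex.re_sum]
  simp_rw [← integral_finsetSum _ fun k _ => hint _ k]
  rw [← integral_finsetSum _ fun j _ => integrable_finsetSum _ fun k _ => hint j k]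
  have hsq : ∀ ω, ∑ j ∈ Finset.range N, ∑ k ∈ Finset.range N,
      Complex.exp (Complex.I * t * (j + B j ω : ℝ)) *
      (starRingEnd ℂ) (Complex.exp (Complex.I * t * (k + B k ω : ℝ))) =
      ((‖∑ j ∈ Finset.range N, Complex.exp (Complex.I * t * (j + B j ω : ℝ))‖ ^ 2 : ℝ) : ℂ) := by
    intro ω
    rw [← Finset.sum_mul_sum, ← map_sum, Complex.mul_conj, Complex.normSq_eq_norm_sq]
  simp_rw [hsq]
  rw [integral_complex_ofReal, Complex.ofReal_re]
  exact integral_nonneg fun ω => by positivity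

end FractionalBrownianMotion

/-! ### Second moments of a point process from its Palm distribution -/

lemma isSFiniteKernel_of_forall_lt_top {α β : Type*} [MeasurableSpace α] [MeasurableSpace β]
    (κ : Kernel α β) (hκ : ∀ a, κ a Set.univ < ∞) : IsSFiniteKernel κ := by
  classical
  -- the source is split according to the integer part of the total mass
  set A : ℕ → Set α := fun j => {a | ⌊(κ a Set.univ).toReal⌋₊ = j} with hA
  have hAm : ∀ j, MeasurableSet (A j) := fun j =>
    (Nat.measurable_floor.comp (κ.measurable_coe MeasurableSet.univ).ennreal_toReal)
      (measurableSet_singleton j)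
  have hfin : ∀ j, IsFiniteKernel (Kernel.piecewise (hAm j) κ 0) := by
    intro j
    refine ⟨⟨ENNReal.ofReal (j + 1), ENNReal.ofReal_lt_top, fun a => ?_⟩⟩
    rw [Kernel.piecewise_apply]
    split_ifs with ha
    · rw [← ENNReal.ofReal_toReal (hκ a).ne]
      refine ENNReal.ofReal_le_ofReal ?_
      have h1 := (Nat.lt_floor_add_one (κ a Set.univ).toReal).le
      have h2 : ⌊(κ a Set.univ).toReal⌋₊ = j := ha
      rwa [h2] at h1
    · simp
  have hsum : κ = Kernel.sum fun j => Kernel.piecewise (hAm j) κ 0 := by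
    ext a s hs
    rw [Kernel.sum_apply' _ _ hs, tsum_eq_single ⌊(κ a Set.univ).toReal⌋₊]
    · rw [Kernel.piecewise_apply, if_pos (show a ∈ A _ from rfl)]
    · intro j hj
      rw [Kernel.piecewise_apply, if_neg (show a ∉ A j from fun h => hj (Eq.symm h))]
      simp
  rw [hsum]
  exact Kernel.isSFiniteKernel_sum

lemma IsConfiguration.lt_top {μ : Measure ℝ} (hμ : IsConfiguration μ) {K : Set ℝ}
    (hK : IsCompact K) : μ K < ∞ := by
  obtain ⟨S, hS, rfl⟩ := hμ
  rw [Measure.restrict_apply hK.measurableSet, Set.inter_comm]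
  exact Measure.count_apply_lt_top.2 (hS K hK)

lemma IsConfiguration.isFiniteMeasureOnCompacts {μ : Measure ℝ} (hμ : IsConfiguration μ) :
    IsFiniteMeasureOnCompacts μ := ⟨fun _ hK => hμ.lt_top hK⟩

section PointProcess

variable {Ω' : Type*} [MeasurableSpace Ω'] {ξ : Ω' → Measure ℝ}

/-- A point process as a kernel from the probability space to `ℝ`. -/
noncomputable def IsPointProcess.kernel (hξ : IsPointProcess ξ) : Kernel Ω' ℝ :=
  ⟨ξ, hξ.measurable⟩

lemma IsPointProcess.kernel_apply (hξ : IsPointProcess ξ) (ω : Ω') : hξ.kernel ω = ξ ω := rfl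

instance IsPointProcess.isSFiniteKernel (hξ : IsPointProcess ξ) : IsSFiniteKernel hξ.kernel := by
  have hfin : ∀ k : ℤ, IsSFiniteKernel
      (hξ.kernel.restrict (measurableSet_Ico (a := (k : ℝ)) (b := (k : ℝ) + 1))) := by
    intro k
    refine isSFiniteKernel_of_forall_lt_top _ fun ω => ?_
    rw [Kernel.restrict_apply, Measure.restrict_apply MeasurableSet.univ, Set.univ_inter]
    exact (measure_mono Set.Ico_subset_Icc_self).trans_lt
      ((hξ.isConfiguration ω).lt_top isCompact_Icc)
  have hsum : hξ.kernel = Kernel.sum fun k : ℤ =>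
      hξ.kernel.restrict (measurableSet_Ico (a := (k : ℝ)) (b := (k : ℝ) + 1)) := by
    ext1 ω
    rw [Kernel.sum_apply]
    simp only [Kernel.restrict_apply]
    rw [← Measure.restrict_iUnion (Set.pairwise_disjoint_Ico_intCast ℝ)
      (fun k => measurableSet_Ico), iUnion_Ico_intCast ℝ, Measure.restrict_univ]
  rw [hsum]
  exact Kernel.isSFiniteKernel_sum

/-- The measure `P'(dω) ξ ω(dx) ξ ω(dy)` of the pairs `(x, y)` of points of the process, together
with the outcome `ω`. -/
noncomputable def IsPointProcess.pairMeasure (hξ : IsPointProcess ξ) (P' : Measure Ω') :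
    Measure (Ω' × ℝ × ℝ) := P' ⊗ₘ (hξ.kernel ×ₖ hξ.kernel)

variable {Ω : Type*} [MeasurableSpace Ω] {P' : Measure Ω'} [IsProbabilityMeasure P']
  {P : Measure Ω} {B : ℝ → Ω → ℝ} {h : ℝ}

lemma measurable_perturbedLattice_apply (hB : IsFractionalBrownianMotion P h B) {S : Set ℝ}
    (hS : MeasurableSet S) : Measurable fun ω => perturbedLattice B ω S := by
  unfold perturbedLattice
  simp_rw [Measure.sum_apply _ hS, Measure.dirac_apply' _ hS]
  exact Measurable.tsum fun n => (measurable_one.indicator hS).comp (hB.measurable_add n)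

lemma lintegral_perturbedLattice_apply (hB : IsFractionalBrownianMotion P h B) {S : Set ℝ}
    (hS : MeasurableSet S) : ∫⁻ ω, perturbedLattice B ω S ∂P = latticeIntensity P B S := by
  unfold perturbedLattice latticeIntensity
  simp_rw [Measure.sum_apply _ hS]
  have h1 : ∀ (n : ℤ) ω, Measure.dirac ((n : ℝ) + B n ω) S =
      S.indicator 1 ((n : ℝ) + B n ω) := fun n ω => Measure.dirac_apply' _ hS
  simp_rw [h1]
  rw [lintegral_tsum]
  · refine tsum_congr fun n => ?_
    rw [Measure.map_apply (hB.measurable_add n) hS,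
      ← lintegral_indicator_one ((hB.measurable_add n) hS)]
    rfl
  · intro n
    exact ((measurable_one.indicator hS).comp (hB.measurable_add n)).aemeasurable

/-- Campbell's formula for points. -/
lemma HasPalmVersion.map_snd_compProd [IsProbabilityMeasure P] (hξ : IsPointProcess ξ)
    {η : Ω → Measure ℝ} (hpalm : HasPalmVersion P' ξ P η) :
    (P' ⊗ₘ hξ.kernel).map Prod.snd = intensity P' ξ • volume := by
  ext S hS
  rw [Measure.map_apply measurable_snd hS, Measure.compProd_apply (measurable_snd hS),
    Measure.smul_apply, smul_eq_mul]
  have h1 := hpalm.campbell (fun p => S.indicator 1 p.2)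
    ((measurable_one.indicator hS).comp measurable_snd)
  simp only [lintegral_indicator_one hS] at h1
  simp only [lintegral_const, measure_univ, mul_one] at h1
  exact h1

/-- Campbell's formula for pairs: seen from one of its points, the process has the intensity
measure of the perturbed lattice. -/
lemma HasPalmVersion.map_pairMeasure [IsProbabilityMeasure P]
    (hξ : IsPointProcess ξ) (hB : IsFractionalBrownianMotion P h B) (h_lt_one : h < 1)
    (hpalm : HasPalmVersion P' ξ P (perturbedLattice B)) :
    (hξ.pairMeasure P').map (fun p => (p.2.1, p.2.2 - p.2.1)) =
      intensity P' ξ • (volume.prod (latticeIntensity P B)) := by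
  have := hB.isFiniteMeasureOnCompacts h_lt_one
  set lam := intensity P' ξ with hlam
  have hlam0 : lam ≠ ∞ := hpalm.intensity_lt_top.ne
  have : IsFiniteMeasureOnCompacts (lam • latticeIntensity P B) := by
    refine ⟨fun K hK => ?_⟩
    rw [Measure.smul_apply, smul_eq_mul]
    exact ENNReal.mul_lt_top hpalm.intensity_lt_top hK.measure_lt_top
  rw [← Measure.prod_smul_right]
  refine (Measure.prod_eq fun s t hs ht => ?_).symm
  have hT : Measurable fun p : Ω' × ℝ × ℝ => (p.2.1, p.2.2 - p.2.1) := by fun_prop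
  rw [Measure.map_apply hT (hs.prod ht), IsPointProcess.pairMeasure,
    Measure.compProd_apply (hT (hs.prod ht)), Measure.smul_apply, smul_eq_mul]
  have h1 := hpalm.campbell (fun p => s.indicator 1 p.2 * p.1 t)
    (((measurable_one.indicator hs).comp measurable_snd).mul
      ((Measure.measurable_coe ht).comp measurable_fst))
  have h2 : ∀ ω, ∫⁻ x, s.indicator 1 x * perturbedLattice B ω t =
      volume s * perturbedLattice B ω t := by
    intro ω
    rw [lintegral_mul_const _ (measurable_one.indicator hs), lintegral_indicator_one hs]
  simp only [h2] at h1
  rw [lintegral_const_mul _ (measurable_perturbedLattice_apply hB ht),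
    lintegral_perturbedLattice_apply hB ht] at h1
  rw [← mul_assoc, mul_comm (volume s), mul_assoc, ← h1]
  refine lintegral_congr fun ω => ?_
  have : SFinite (ξ ω) := by
    rw [← hξ.kernel_apply]; infer_instance
  rw [Kernel.prod_apply, hξ.kernel_apply, Measure.prod_apply]
  · refine lintegral_congr fun x => ?_
    rw [shift, Measure.map_apply (measurable_sub_const x) ht]
    by_cases hx : x ∈ s
    · rw [Set.indicator_of_mem hx, Pi.one_apply, one_mul]
      congr 1
      ext y
      simp [hx]
    · rw [Set.indicator_of_notMem hx, zero_mul]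
      convert measure_empty (μ := ξ ω)
      ext y
      simp [hx]
  · exact (hT.comp measurable_prodMk_left) (hs.prod ht)

end PointProcess

/-! ### Linear statistics -/

/-- Measurable functions that are bounded by `C` and vanish outside the closed ball of radius
`m`. -/
structure IsTestFunction (φ : ℝ → ℂ) (C m : ℝ) : Prop where
  measurable : Measurable φ
  norm_le : ∀ x, ‖φ x‖ ≤ (Metric.closedBall (0 : ℝ) m).indicator (fun _ => C) x

/-- The autocorrelation of `φ`, which is the convolution of `φ` with its Hermitian reflection. -/
noncomputable def autocorrelation (φ : ℝ → ℂ) (u : ℝ) : ℂ :=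
  ∫ x : ℝ, (starRingEnd ℂ) (φ x) * φ (x + u)

lemma IsTestFunction.integrable {φ : ℝ → ℂ} {C m : ℝ} (hφ : IsTestFunction φ C m) (μ : Measure ℝ)
    [IsFiniteMeasureOnCompacts μ] : Integrable φ μ := by
  refine Integrable.mono' (g := (Metric.closedBall (0 : ℝ) m).indicator fun _ => C) ?_
    hφ.measurable.aestronglyMeasurable (Eventually.of_forall hφ.norm_le)
  rw [integrable_indicator_iff measurableSet_closedBall]
  exact integrableOn_const (isCompact_closedBall 0 m).measure_lt_top.ne

lemma IsTestFunction.eq_zero {φ : ℝ → ℂ} {C m : ℝ} (hφ : IsTestFunction φ C m) {x : ℝ}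
    (hx : m < |x|) : φ x = 0 := by
  have h1 := hφ.norm_le x
  rw [Set.indicator_of_notMem (by simpa using hx)] at h1
  exact norm_le_zero_iff.1 h1

lemma IsTestFunction.autocorrelation_eq_zero {φ : ℝ → ℂ} {C m : ℝ} (hφ : IsTestFunction φ C m)
    {u : ℝ} (hu : 2 * m < |u|) : autocorrelation φ u = 0 := by
  rw [autocorrelation]
  refine integral_eq_zero_of_ae (Eventually.of_forall fun x => ?_)
  simp only [Pi.zero_apply, mul_eq_zero]
  by_contra! hx
  have h1 : |x| ≤ m := not_lt.1 fun hlt => hx.1 (by rw [hφ.eq_zero hlt, map_zero])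
  have h2 : |x + u| ≤ m := not_lt.1 fun hlt => hx.2 (hφ.eq_zero hlt)
  have h3 := abs_sub (x + u) x
  rw [add_sub_cancel_left] at h3
  linarith

lemma IsTestFunction.hasCompactSupport_autocorrelation {φ : ℝ → ℂ} {C m : ℝ}
    (hφ : IsTestFunction φ C m) : HasCompactSupport (autocorrelation φ) := by
  refine HasCompactSupport.of_support_subset_isCompact (isCompact_closedBall (0 : ℝ) (2 * m)) ?_
  intro u hu
  rw [Metric.mem_closedBall, dist_zero_right, Real.norm_eq_abs]
  exact not_lt.1 fun hlt => hu (hφ.autocorrelation_eq_zero hlt)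

lemma IsTestFunction.fourierTransform_autocorrelation {φ : ℝ → ℂ} {C m : ℝ}
    (hφ : IsTestFunction φ C m) (t : ℝ) :
    fourierTransform (autocorrelation φ) t = ((‖fourierTransform φ t‖ ^ 2 : ℝ) : ℂ) := by
  have hi := hφ.integrable volume
  have h1 : Integrable (fun p : ℝ × ℝ => (starRingEnd ℂ) (φ p.1) * φ (p.1 + p.2))
      (volume.prod volume) := by
    have h2 : Integrable (fun p : ℝ × ℝ => (starRingEnd ℂ) (φ p.1) * φ p.2)
        (volume.prod volume) := by
      refine Integrable.mul_prod (f := fun x => (starRingEnd ℂ) (φ x)) ?_ hi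
      exact Complex.conjCLE.toContinuousLinearMap.integrable_comp hi
    exact (measurePreserving_prod_add volume volume).integrable_comp_of_integrable h2
  have h3 : Integrable (Function.uncurry fun u x : ℝ => Complex.exp (-Complex.I * t * u) *
      ((starRingEnd ℂ) (φ x) * φ (x + u))) (volume.prod volume) := by
    refine h1.swap.mono ?_ (Eventually.of_forall fun p => ?_)
    · exact (Continuous.aestronglyMeasurable (by fun_prop)).mul h1.swap.aestronglyMeasurable
    · simp only [Function.uncurry, norm_mul, norm_exp_neg_I_mul, one_mul, Function.comp,
        Prod.fst_swap, Prod.snd_swap]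
      exact le_rfl
  rw [fourierTransform]
  simp only [autocorrelation]
  simp_rw [← integral_const_mul]
  rw [integral_integral_swap h3]
  have h4 : ∀ x : ℝ, ∫ u : ℝ, Complex.exp (-Complex.I * t * u) *
      ((starRingEnd ℂ) (φ x) * φ (x + u)) =
      (starRingEnd ℂ) (Complex.exp (-Complex.I * t * x) * φ x) * fourierTransform φ t := by
    intro x
    rw [fourierTransform, ← integral_const_mul,
      ← integral_add_left_eq_self (fun u : ℝ => (starRingEnd ℂ)
        (Complex.exp (-Complex.I * t * x) * φ x) * (Complex.exp (-Complex.I * t * u) * φ u)) x]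
    refine integral_congr_ae (Eventually.of_forall fun u => ?_)
    simp only
    have h5 : (starRingEnd ℂ) (Complex.exp (-Complex.I * t * x)) *
        Complex.exp (-Complex.I * t * (x + u : ℝ)) = Complex.exp (-Complex.I * t * u) := by
      rw [← Complex.exp_conj, ← Complex.exp_add]
      congr 1
      simp
      ring
    rw [← h5, map_mul]
    ring
  simp_rw [h4]
  rw [integral_mul_const, integral_conj, ← fourierTransform, mul_comm, Complex.mul_conj,
    Complex.normSq_eq_norm_sq]

section PointProcess

variable {Ω Ω' : Type*} [MeasurableSpace Ω] [MeasurableSpace Ω'] {ξ : Ω' → Measure ℝ}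
  {P' : Measure Ω'} [IsProbabilityMeasure P'] {P : Measure Ω} [IsProbabilityMeasure P]
  {B : ℝ → Ω → ℝ} {h : ℝ}

lemma pairMeasure_closedBall (hξ : IsPointProcess ξ) (m : ℝ) :
    hξ.pairMeasure P' (Set.univ ×ˢ (Metric.closedBall 0 m ×ˢ Metric.closedBall 0 m)) =
      ∫⁻ ω, ξ ω (Metric.closedBall 0 m) ^ 2 ∂P' := by
  rw [IsPointProcess.pairMeasure, Measure.compProd_apply (MeasurableSet.univ.prod
    (measurableSet_closedBall.prod measurableSet_closedBall))]
  refine lintegral_congr fun ω => ?_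
  trans (hξ.kernel ×ₖ hξ.kernel) ω (Metric.closedBall (0 : ℝ) m ×ˢ Metric.closedBall (0 : ℝ) m)
  · congr 1
    ext p
    simp
  rw [Kernel.prod_apply, hξ.kernel_apply]
  have : SFinite (ξ ω) := by rw [← hξ.kernel_apply]; infer_instance
  rw [Measure.prod_prod, sq]

lemma HasPalmVersion.lintegral_sq_closedBall_lt_top (hξ : IsPointProcess ξ)
    (hB : IsFractionalBrownianMotion P h B) (h_lt_one : h < 1)
    (hpalm : HasPalmVersion P' ξ P (perturbedLattice B)) (m : ℝ) :
    ∫⁻ ω, ξ ω (Metric.closedBall 0 m) ^ 2 ∂P' < ∞ := by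
  have h1 := hpalm.map_pairMeasure hξ hB h_lt_one
  have := hB.isFiniteMeasureOnCompacts h_lt_one
  rw [← pairMeasure_closedBall hξ]
  have hT : Measurable fun p : Ω' × ℝ × ℝ => (p.2.1, p.2.2 - p.2.1) := by fun_prop
  refine lt_of_le_of_lt (measure_mono (t := (fun p : Ω' × ℝ × ℝ => (p.2.1, p.2.2 - p.2.1)) ⁻¹'
    (Metric.closedBall (0 : ℝ) m ×ˢ Metric.closedBall (0 : ℝ) (2 * m))) ?_) ?_
  · rintro ⟨ω, x, y⟩ ⟨-, hx, hy⟩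
    simp only [Metric.mem_closedBall, dist_zero_right, Real.norm_eq_abs] at hx hy
    simp only [Set.mem_preimage, Set.mem_prod, Metric.mem_closedBall, dist_zero_right,
      Real.norm_eq_abs]
    exact ⟨hx, (abs_sub y x).trans (by linarith)⟩
  · rw [← Measure.map_apply hT (measurableSet_closedBall.prod measurableSet_closedBall), h1,
      Measure.smul_apply, Measure.prod_prod, smul_eq_mul]
    exact ENNReal.mul_lt_top hpalm.intensity_lt_top (ENNReal.mul_lt_top
      (isCompact_closedBall _ _).measure_lt_top (isCompact_closedBall _ _).measure_lt_top)

omit [IsProbabilityMeasure P'] in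
lemma IsTestFunction.stronglyMeasurable_integral {φ : ℝ → ℂ} {C m : ℝ} (hφ : IsTestFunction φ C m)
    (hξ : IsPointProcess ξ) : StronglyMeasurable fun ω => ∫ x, φ x ∂ξ ω :=
  hφ.measurable.stronglyMeasurable.integral_kernel (κ := hξ.kernel)

lemma IsTestFunction.memLp_integral {φ : ℝ → ℂ} {C m : ℝ} (hφ : IsTestFunction φ C m)
    (hξ : IsPointProcess ξ) (hB : IsFractionalBrownianMotion P h B) (h_lt_one : h < 1)
    (hpalm : HasPalmVersion P' ξ P (perturbedLattice B)) :
    MemLp (fun ω => ∫ x, φ x ∂ξ ω) 2 P' := by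
  have h1 : MemLp (fun ω => (ξ ω (Metric.closedBall 0 m)).toReal) 2 P' := by
    have hmeas : Measurable fun ω => (ξ ω (Metric.closedBall 0 m)).toReal :=
      (((Measure.measurable_coe measurableSet_closedBall).comp hξ.measurable)).ennreal_toReal
    refine ⟨hmeas.aestronglyMeasurable, ?_⟩
    rw [eLpNorm_lt_top_iff_lintegral_rpow_enorm_lt_top (by norm_num) (by norm_num)]
    refine lt_of_le_of_lt (le_of_eq ?_)
      (hpalm.lintegral_sq_closedBall_lt_top hξ hB h_lt_one m)
    refine lintegral_congr fun ω => ?_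
    have h2 := ((hξ.isConfiguration ω).lt_top (isCompact_closedBall (0 : ℝ) m)).ne
    rw [ENNReal.toReal_ofNat, ENNReal.rpow_two, Real.enorm_eq_ofReal ENNReal.toReal_nonneg,
      ENNReal.ofReal_toReal h2]
  refine (h1.const_mul C).mono' (hφ.stronglyMeasurable_integral hξ).aestronglyMeasurable
    (Eventually.of_forall fun ω => ?_)
  have := (hξ.isConfiguration ω).isFiniteMeasureOnCompacts
  refine (norm_integral_le_integral_norm _).trans ?_
  refine (integral_mono (hφ.integrable _).norm ?_ hφ.norm_le).trans (le_of_eq ?_)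
  · rw [integrable_indicator_iff measurableSet_closedBall]
    exact integrableOn_const (isCompact_closedBall 0 m).measure_lt_top.ne
  · rw [integral_indicator measurableSet_closedBall, setIntegral_const, smul_eq_mul, mul_comm]
    rfl

/-- The mean of a linear statistic. -/
lemma IsTestFunction.integral_integral {φ : ℝ → ℂ} {C m : ℝ} (hφ : IsTestFunction φ C m)
    (hξ : IsPointProcess ξ) (hpalm : HasPalmVersion P' ξ P (perturbedLattice B)) :
    ∫ ω, ∫ x, φ x ∂ξ ω ∂P' = (intensity P' ξ).toReal * fourierTransform φ 0 := by
  have h1 := hpalm.map_snd_compProd hξ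
  have h2 : Integrable (fun p : Ω' × ℝ => φ p.2) (P' ⊗ₘ hξ.kernel) := by
    have h3 : Integrable φ ((P' ⊗ₘ hξ.kernel).map Prod.snd) := by
      rw [h1]
      exact (hφ.integrable volume).smul_measure hpalm.intensity_lt_top.ne
    exact h3.comp_measurable measurable_snd
  have h4 := Measure.integral_compProd h2
  simp only [hξ.kernel_apply] at h4
  rw [← h4, ← integral_map (φ := Prod.snd) measurable_snd.aemeasurable
    hφ.measurable.aestronglyMeasurable, h1, integral_smul_measure, fourierTransform,
    Complex.real_smul]
  simp

/-- The second moment of a linear statistic: the integral over pairs `(x, y)` of points is computed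
in the coordinates `x` and `y - x`, in which the pair measure is a product. -/
lemma IsTestFunction.integral_norm_sq {φ : ℝ → ℂ} {C m : ℝ} (hφ : IsTestFunction φ C m)
    (hξ : IsPointProcess ξ) (hB : IsFractionalBrownianMotion P h B) (h_lt_one : h < 1)
    (hpalm : HasPalmVersion P' ξ P (perturbedLattice B)) :
    ((∫ ω, ‖∫ x, φ x ∂ξ ω‖ ^ 2 ∂P' : ℝ) : ℂ) =
      (intensity P' ξ).toReal * ∫ u, autocorrelation φ u ∂latticeIntensity P B := by
  have := hB.isFiniteMeasureOnCompacts h_lt_one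
  have hφm := hφ.measurable
  have hconj : Measurable fun z : ℂ => (starRingEnd ℂ) z := Complex.continuous_conj.measurable
  have h1 := hpalm.map_pairMeasure hξ hB h_lt_one
  have hT : Measurable fun p : Ω' × ℝ × ℝ => (p.2.1, p.2.2 - p.2.1) := by fun_prop
  have hF : Measurable fun p : ℝ × ℝ => (starRingEnd ℂ) (φ p.1) * φ (p.1 + p.2) :=
    (hconj.comp (hφm.comp measurable_fst)).mul (hφm.comp (measurable_fst.add measurable_snd))
  have h2 : Integrable (fun p : Ω' × ℝ × ℝ => (starRingEnd ℂ) (φ p.2.1) * φ p.2.2)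
      (hξ.pairMeasure P') := by
    set S : Set (Ω' × ℝ × ℝ) :=
      Set.univ ×ˢ (Metric.closedBall 0 m ×ˢ Metric.closedBall 0 m) with hS
    have hSm : MeasurableSet S := MeasurableSet.univ.prod
      (measurableSet_closedBall.prod measurableSet_closedBall)
    refine Integrable.mono' (g := S.indicator fun _ => C * C) ?_ ?_
      (Eventually.of_forall fun p => ?_)
    · rw [integrable_indicator_iff hSm]
      refine integrableOn_const ?_
      rw [hS, pairMeasure_closedBall hξ]
      exact (hpalm.lintegral_sq_closedBall_lt_top hξ hB h_lt_one m).ne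
    · exact ((hconj.comp (hφm.comp (measurable_fst.comp measurable_snd))).mul
        (hφm.comp (measurable_snd.comp measurable_snd))).aestronglyMeasurable
    · have e1 := hφ.norm_le p.2.1
      have e2 := hφ.norm_le p.2.2
      rw [norm_mul, RCLike.norm_conj]
      refine (mul_le_mul e1 e2 (norm_nonneg _) ((norm_nonneg _).trans e1)).trans (le_of_eq ?_)
      by_cases hx : p.2.1 ∈ Metric.closedBall (0 : ℝ) m <;>
      by_cases hy : p.2.2 ∈ Metric.closedBall (0 : ℝ) m <;>
      simp only [hS, Set.indicator, Set.mem_prod, Set.mem_univ, true_and, hx, hy] <;> simp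
  have h2' : Integrable (fun p : ℝ × ℝ => (starRingEnd ℂ) (φ p.1) * φ (p.1 + p.2))
      ((hξ.pairMeasure P').map fun p => (p.2.1, p.2.2 - p.2.1)) := by
    rw [integrable_map_measure hF.aestronglyMeasurable hT.aemeasurable]
    refine h2.congr (Eventually.of_forall fun p => ?_)
    simp
  have h3 := Measure.integral_compProd h2
  have h4 : ∫ ω, ∫ p : ℝ × ℝ, (starRingEnd ℂ) (φ p.1) * φ p.2
      ∂((hξ.kernel ×ₖ hξ.kernel) ω) ∂P' = ((∫ ω, ‖∫ x, φ x ∂ξ ω‖ ^ 2 ∂P' : ℝ) : ℂ) := by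
    rw [← integral_complex_ofReal]
    refine integral_congr_ae (Eventually.of_forall fun ω => ?_)
    have : SFinite (ξ ω) := by rw [← hξ.kernel_apply]; infer_instance
    simp only
    rw [Kernel.prod_apply, hξ.kernel_apply,
      integral_prod_mul (fun x => (starRingEnd ℂ) (φ x)) φ, integral_conj, mul_comm,
      Complex.mul_conj, Complex.normSq_eq_norm_sq]
  have h5 : ∫ p, (starRingEnd ℂ) (φ p.2.1) * φ p.2.2 ∂(hξ.pairMeasure P') =
      (intensity P' ξ).toReal * ∫ u, autocorrelation φ u ∂latticeIntensity P B := by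
    have h6 : ∫ p, (starRingEnd ℂ) (φ p.2.1) * φ p.2.2 ∂(hξ.pairMeasure P') =
        ∫ p, (starRingEnd ℂ) (φ p.1) * φ (p.1 + p.2)
          ∂((hξ.pairMeasure P').map fun p => (p.2.1, p.2.2 - p.2.1)) := by
      rw [integral_map hT.aemeasurable hF.aestronglyMeasurable]
      simp
    rw [h6, h1, integral_smul_measure, Complex.real_smul, integral_prod_symm]
    · rfl
    · rw [h1] at h2'
      rwa [integrable_smul_measure hpalm.intensity_pos.ne' hpalm.intensity_lt_top.ne] at h2'
  rw [← h4, ← h5]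
  exact h3.symm

/-- The centered second moment of a linear statistic, in the frequency domain. The second summand
disappears once the intensity is known to be `1`. -/
lemma IsTestFunction.integral_norm_sub_sq {φ : ℝ → ℂ} {C m : ℝ} (hφ : IsTestFunction φ C m)
    (hc : Continuous (autocorrelation φ))
    (hG : Integrable fun t => ‖fourierTransform φ t‖ ^ 2)
    (hξ : IsPointProcess ξ) (hB : IsFractionalBrownianMotion P h B) (h_pos : 0 < h)
    (h_lt_one : h < 1) (hpalm : HasPalmVersion P' ξ P (perturbedLattice B)) :
    ∫ ω, ‖(∫ x, φ x ∂ξ ω) - ∫ ω', ∫ x, φ x ∂ξ ω' ∂P'‖ ^ 2 ∂P' =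
      (intensity P' ξ).toReal * ((2 * Real.pi)⁻¹ *
        ∫ t, ‖fourierTransform φ t‖ ^ 2 * perturbedStructureFactor (2 * h) t) +
      ((intensity P' ξ).toReal - (intensity P' ξ).toReal ^ 2) * ‖fourierTransform φ 0‖ ^ 2 := by
  have hpi := Real.pi_pos
  set lam := (intensity P' ξ).toReal with hlam
  set X : Ω' → ℂ := fun ω => ∫ x, φ x ∂ξ ω with hX
  have hXL := hφ.memLp_integral hξ hB h_lt_one hpalm
  have hXi : Integrable X P' := hXL.integrable (by norm_num)
  have hFT := fun t => hφ.fourierTransform_autocorrelation t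
  have hGc : Integrable (fourierTransform (autocorrelation φ)) := by
    refine hG.ofReal.congr (Eventually.of_forall fun t => ?_)
    exact (hFT t).symm
  have h1 := hB.integral_latticeIntensity h_pos h_lt_one hc hφ.hasCompactSupport_autocorrelation
    hGc
  have h2 := hφ.integral_norm_sq hξ hB h_lt_one hpalm
  rw [← hlam] at h2
  simp_rw [hFT, ← Complex.ofReal_mul] at h1
  rw [integral_complex_ofReal] at h1
  have h3 : ∫ ω, ‖X ω‖ ^ 2 ∂P' = lam * (‖fourierTransform φ 0‖ ^ 2 + (2 * Real.pi)⁻¹ *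
      ∫ t, ‖fourierTransform φ t‖ ^ 2 * perturbedStructureFactor (2 * h) t) := by
    apply Complex.ofReal_injective
    rw [h2]
    have hpc : (Real.pi : ℂ) ≠ 0 := by exact_mod_cast hpi.ne'
    have h4 : ∫ u, autocorrelation φ u ∂latticeIntensity P B = (2 * Real.pi : ℂ)⁻¹ *
      (2 * Real.pi * ∫ u, autocorrelation φ u ∂latticeIntensity P B) := by
      field_simp
    rw [h4, h1]
    push_cast
    field_simp
  have h5 : ∫ ω, X ω ∂P' = lam * fourierTransform φ 0 := hφ.integral_integral hξ hpalm
  set c : ℂ := ∫ ω, X ω ∂P' with hcdef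
  have h6 : ∀ ω, ‖X ω - c‖ ^ 2 = ‖X ω‖ ^ 2 - 2 * ((starRingEnd ℂ) c * X ω).re + ‖c‖ ^ 2 := by
    intro ω
    rw [← Complex.normSq_eq_norm_sq, ← Complex.normSq_eq_norm_sq, ← Complex.normSq_eq_norm_sq,
      Complex.normSq_sub, mul_comm (X ω)]
    ring
  have h7 : Integrable (fun ω => ‖X ω‖ ^ 2) P' := hXL.integrable_norm_pow (by norm_num)
  have h8 : Integrable (fun ω => ((starRingEnd ℂ) c * X ω).re) P' := (hXi.const_mul _).re
  have h9 : ∫ ω, ((starRingEnd ℂ) c * X ω).re ∂P' = ‖c‖ ^ 2 := by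
    have : ∫ ω, ((starRingEnd ℂ) c * X ω).re ∂P' = (∫ ω, (starRingEnd ℂ) c * X ω ∂P').re :=
      integral_re (hXi.const_mul ((starRingEnd ℂ) c))
    rw [this, integral_const_mul, ← hcdef, mul_comm, Complex.mul_conj, Complex.ofReal_re,
      Complex.normSq_eq_norm_sq]
  have h10 : Integrable (fun ω => ‖X ω‖ ^ 2 - 2 * ((starRingEnd ℂ) c * X ω).re) P' :=
    h7.sub (h8.const_mul 2)
  rw [integral_congr_ae (Eventually.of_forall h6), integral_add h10 (integrable_const _),
    integral_sub h7 (h8.const_mul 2), integral_const_mul, h9, h3, h5]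
  simp only [integral_const, probReal_univ, one_smul, norm_mul, Complex.norm_real,
    Real.norm_eq_abs, mul_pow, sq_abs]
  ring

end PointProcess

/-! ### Lower bound for the intensity -/

section PointProcess

variable {Ω Ω' : Type*} [MeasurableSpace Ω] [MeasurableSpace Ω'] {ξ : Ω' → Measure ℝ}
  {P' : Measure Ω'} [IsProbabilityMeasure P'] {P : Measure Ω} [IsProbabilityMeasure P]
  {B : ℝ → Ω → ℝ} {h : ℝ}

omit [MeasurableSpace Ω] in
/-- The perturbed lattice has at least `2 M + 1` points in the ball of radius `N`, up to the lattice
points that are displaced by more than `N - M`. -/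
lemma card_le_perturbedLattice_closedBall {M : ℕ} {N D : ℝ} (hMN : M + D ≤ N) (ω : Ω) :
    ((2 * M + 1 : ℕ) : ℝ≥0∞) ≤ perturbedLattice B ω (Metric.closedBall 0 N) +
      ∑ n ∈ Finset.Icc (-(M : ℤ)) M, {ω | D ≤ |B n ω|}.indicator 1 ω := by
  have hcard : (Finset.Icc (-(M : ℤ)) M).card = 2 * M + 1 := by
    rw [Int.card_Icc]; omega
  have h1 : ∑ n ∈ Finset.Icc (-(M : ℤ)) M,
      (Metric.closedBall (0 : ℝ) N).indicator (1 : ℝ → ℝ≥0∞) ((n : ℝ) + B n ω) ≤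
      perturbedLattice B ω (Metric.closedBall 0 N) := by
    rw [perturbedLattice, Measure.sum_apply _ measurableSet_closedBall]
    simp_rw [Measure.dirac_apply' _ measurableSet_closedBall]
    exact ENNReal.sum_le_tsum _
  refine le_trans ?_ (add_le_add_left h1 _)
  rw [← hcard, ← Finset.sum_add_distrib, Finset.card_eq_sum_ones, Nat.cast_sum]
  refine Finset.sum_le_sum fun n hn => ?_
  rw [Nat.cast_one]
  by_cases hD : D ≤ |B n ω|
  · rw [Set.indicator_of_mem (show ω ∈ {ω | D ≤ |B n ω|} from hD)]
    exact le_add_self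
  · have hn' : |(n : ℝ)| ≤ M := by
      rw [Finset.mem_Icc] at hn
      rw [abs_le]
      exact ⟨by exact_mod_cast hn.1, by exact_mod_cast hn.2⟩
    rw [Set.indicator_of_mem (s := Metric.closedBall (0 : ℝ) N)]
    · exact le_self_add
    · rw [Metric.mem_closedBall, dist_zero_right, Real.norm_eq_abs]
      have := abs_add_le (n : ℝ) (B n ω)
      linarith

lemma IsFractionalBrownianMotion.measure_le_abs (hB : IsFractionalBrownianMotion P h B) (x : ℝ)
    {D : ℝ} (hD : 0 < D) : P {ω | D ≤ |B x ω|} ≤ ENNReal.ofReal (|x| ^ (2 * h) / D ^ 2) := by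
  have h1 := meas_ge_le_variance_div_sq
    (hB.isGaussianProcess.hasGaussianLaw_eval x).memLp_two hD
  rw [hB.variogram x, hB.centered x] at h1
  simpa using h1

/-- The mean lack of points of the perturbed lattice in the ball of radius `N`: a boundary layer of
width `D` is given up, and displacements larger than `D` are rare. -/
lemma IsFractionalBrownianMotion.lintegral_one_sub_le (hB : IsFractionalBrownianMotion P h B)
    (h_pos : 0 < h) {N D : ℝ} (hD : 0 < D) (hDN : D ≤ N) :
    ∫⁻ ω, (1 - perturbedLattice B ω (Metric.closedBall 0 N) / ENNReal.ofReal (2 * N)) ∂P ≤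
      ENNReal.ofReal ((2 * D + 1) / (2 * N) + (2 * N + 1) / (2 * N) * (N ^ (2 * h) / D ^ 2)) := by
  have hN : 0 < N := hD.trans_le hDN
  set M : ℕ := ⌊N - D⌋₊ with hM
  have hM1 : (M : ℝ) ≤ N - D := Nat.floor_le (by linarith)
  have hM2 : N - D < M + 1 := Nat.lt_floor_add_one _
  have hcard : (Finset.Icc (-(M : ℤ)) M).card = 2 * M + 1 := by
    rw [Int.card_Icc]; omega
  have hpt : ∀ ω, 1 - perturbedLattice B ω (Metric.closedBall 0 N) / ENNReal.ofReal (2 * N) ≤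
      (ENNReal.ofReal (2 * D + 1) + ∑ n ∈ Finset.Icc (-(M : ℤ)) M,
        {ω | D ≤ |B n ω|}.indicator 1 ω) / ENNReal.ofReal (2 * N) := by
    intro ω
    rw [tsub_le_iff_right, ← ENNReal.add_div, ENNReal.le_div_iff_mul_le (by simp [hN])
      (Or.inl ENNReal.ofReal_ne_top),
      one_mul]
    have h1 := card_le_perturbedLattice_closedBall (B := B) (M := M) (N := N) (D := D)
      (by linarith) ω
    have h2 : ENNReal.ofReal (2 * N) ≤ ENNReal.ofReal (2 * D + 1) + ((2 * M + 1 : ℕ) : ℝ≥0∞) := by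
      rw [← ENNReal.ofReal_natCast, ← ENNReal.ofReal_add (by positivity) (by positivity)]
      refine ENNReal.ofReal_le_ofReal ?_
      push_cast
      linarith
    refine h2.trans ((add_le_add_right h1 _).trans (le_of_eq ?_))
    ring
  have hmeas : ∀ n : ℤ, MeasurableSet {ω | D ≤ |B n ω|} := fun n =>
    measurableSet_le measurable_const (hB.measurable n).abs
  refine (lintegral_mono hpt).trans ?_
  simp_rw [div_eq_mul_inv]
  rw [lintegral_mul_const' _ _ (by simp [hN]), lintegral_add_left measurable_const,
    lintegral_finsetSum _ fun n _ => measurable_one.indicator (hmeas n)]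
  simp_rw [lintegral_indicator_one (hmeas _)]
  have hsum : ∑ n ∈ Finset.Icc (-(M : ℤ)) M, P {ω | D ≤ |B n ω|} ≤
      ENNReal.ofReal ((2 * N + 1) * (N ^ (2 * h) / D ^ 2)) := by
    refine (Finset.sum_le_card_nsmul _ _ (ENNReal.ofReal (N ^ (2 * h) / D ^ 2))
      fun n hn => ?_).trans ?_
    · refine (hB.measure_le_abs n hD).trans (ENNReal.ofReal_le_ofReal ?_)
      have hn' : |(n : ℝ)| ≤ N := by
        rw [Finset.mem_Icc] at hn
        refine le_trans (b := (M : ℝ)) ?_ (by linarith)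
        rw [abs_le]
        exact ⟨by exact_mod_cast hn.1, by exact_mod_cast hn.2⟩
      have := Real.rpow_le_rpow (abs_nonneg (n : ℝ)) hn' (by positivity : 0 ≤ 2 * h)
      gcongr
    · rw [hcard, nsmul_eq_mul, ← ENNReal.ofReal_natCast, ← ENNReal.ofReal_mul (by positivity)]
      refine ENNReal.ofReal_le_ofReal ?_
      have : 0 ≤ N ^ (2 * h) / D ^ 2 := by positivity
      refine mul_le_mul_of_nonneg_right ?_ this
      push_cast
      linarith
  have hfin : (ENNReal.ofReal (2 * D + 1) + ENNReal.ofReal ((2 * N + 1) * (N ^ (2 * h) / D ^ 2))) *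
      (ENNReal.ofReal (2 * N))⁻¹ = ENNReal.ofReal ((2 * D + 1) * (2 * N)⁻¹ +
        (2 * N + 1) * (2 * N)⁻¹ * (N ^ (2 * h) * (D ^ 2)⁻¹)) := by
    rw [← ENNReal.ofReal_inv_of_pos (by positivity), ← ENNReal.ofReal_add (by positivity)
      (by positivity), ← ENNReal.ofReal_mul (by positivity)]
    congr 1
    ring
  rw [← hfin]
  simp only [lintegral_const, measure_univ, mul_one]
  gcongr

/-- The perturbed lattice has asymptotic density at least `1` in the mean. -/
lemma IsFractionalBrownianMotion.tendsto_lintegral_one_sub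
    (hB : IsFractionalBrownianMotion P h B) (h_pos : 0 < h) (h_lt_one : h < 1) :
    Tendsto (fun N : ℝ => ∫⁻ ω,
      (1 - perturbedLattice B ω (Metric.closedBall 0 N) / ENNReal.ofReal (2 * N)) ∂P)
      atTop (𝓝 0) := by
  -- the displacements of the points of the ball of radius `N` are of order `N ^ h`, so a boundary
  -- layer of width `N ^ β` suffices when `h < β < 1`
  set β : ℝ := (1 + h) / 2 with hβ
  have hlim : Tendsto (fun N : ℝ => (2 * N ^ β + 1) / (2 * N) +
      (2 * N + 1) / (2 * N) * (N ^ (2 * h) / (N ^ β) ^ 2)) atTop (𝓝 0) := by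
    have h1 : Tendsto (fun N : ℝ => N ^ (-(1 - β))) atTop (𝓝 0) :=
      tendsto_rpow_neg_atTop (by rw [hβ]; linarith)
    have h2 : Tendsto (fun N : ℝ => N ^ (-(1 - h))) atTop (𝓝 0) :=
      tendsto_rpow_neg_atTop (by linarith)
    have h3 : Tendsto (fun N : ℝ => (2 * N)⁻¹) atTop (𝓝 0) :=
      tendsto_inv_atTop_zero.comp (tendsto_id.const_mul_atTop two_pos)
    have h4 := (h1.add h3).add ((h3.const_add 1).mul h2)
    simp only [add_zero, mul_zero] at h4
    refine h4.congr' ?_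
    filter_upwards [eventually_gt_atTop 0] with N hN
    have e1 : N ^ (-(1 - β)) = N ^ β / N := by
      rw [neg_sub, Real.rpow_sub hN, Real.rpow_one]
    have e2 : N ^ (-(1 - h)) = N ^ (2 * h) / (N ^ β) ^ 2 := by
      rw [← Real.rpow_natCast (N ^ β), ← Real.rpow_mul hN.le, ← Real.rpow_sub hN]
      congr 1
      rw [hβ]
      push_cast
      ring
    rw [e1, e2]
    field_simp
  have hlim' := (ENNReal.continuous_ofReal.tendsto 0).comp hlim
  rw [ENNReal.ofReal_zero] at hlim'
  refine tendsto_of_tendsto_of_tendsto_of_le_of_le' tendsto_const_nhds hlim'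
    (Eventually.of_forall fun N => zero_le) ?_
  filter_upwards [eventually_ge_atTop 1] with N hN
  refine hB.lintegral_one_sub_le h_pos (by positivity) ?_
  calc N ^ β ≤ N ^ (1 : ℝ) := Real.rpow_le_rpow_of_exponent_le hN (by rw [hβ]; linarith)
    _ = N := Real.rpow_one N

lemma IsConfiguration.one_le {μ : Measure ℝ} (hμ : IsConfiguration μ) {K : Set ℝ}
    (hK : MeasurableSet K) (h0 : μ K ≠ 0) : 1 ≤ μ K := by
  obtain ⟨S, hS, rfl⟩ := hμ
  rw [Measure.restrict_apply hK] at h0 ⊢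
  rw [← not_lt]
  intro hlt
  exact h0 (Measure.count_eq_zero_iff.2 (by
    by_contra hne
    obtain ⟨x, hx⟩ := Set.nonempty_iff_ne_empty.2 hne
    have h1 : Measure.count {x} ≤ Measure.count (K ∩ S) :=
      measure_mono (Set.singleton_subset_iff.2 hx)
    rw [Measure.count_singleton] at h1
    exact absurd hlt (not_lt.2 h1)))

lemma HasPalmVersion.lintegral_apply (hξ : IsPointProcess ξ) {η : Ω → Measure ℝ}
    (hpalm : HasPalmVersion P' ξ P η) {S : Set ℝ} (hS : MeasurableSet S) :
    ∫⁻ ω, ξ ω S ∂P' = intensity P' ξ * volume S := by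
  have h1 := congrArg (fun μ : Measure ℝ => μ S) (hpalm.map_snd_compProd hξ)
  simp only [Measure.smul_apply, smul_eq_mul] at h1
  rw [Measure.map_apply measurable_snd hS, Measure.compProd_apply (measurable_snd hS)] at h1
  exact h1

omit [IsProbabilityMeasure P'] [IsProbabilityMeasure P] in
/-- The mean number of points near the origin, weighted by the lack of points at a larger scale, is
controlled by the lack of points of the perturbed lattice. -/
lemma HasPalmVersion.lintegral_mul_one_sub_le
    (hpalm : HasPalmVersion P' ξ P (perturbedLattice B)) (m N : ℝ) :
    ∫⁻ ω, ξ ω (Metric.closedBall 0 m) *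
      (1 - ξ ω (Metric.closedBall 0 (N + m)) / ENNReal.ofReal (2 * N)) ∂P' ≤
      intensity P' ξ * volume (Metric.closedBall (0 : ℝ) m) * ∫⁻ ω,
        (1 - perturbedLattice B ω (Metric.closedBall 0 N) / ENNReal.ofReal (2 * N)) ∂P := by
  have hf : Measurable fun p : Measure ℝ × ℝ => (Metric.closedBall (0 : ℝ) m).indicator
      (1 : ℝ → ℝ≥0∞) p.2 * (1 - p.1 (Metric.closedBall 0 N) / ENNReal.ofReal (2 * N)) :=
    ((measurable_one.indicator measurableSet_closedBall).comp measurable_snd).mul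
      (measurable_const.sub (((Measure.measurable_coe measurableSet_closedBall).comp
        measurable_fst).div_const _))
  have h1 := hpalm.campbell _ hf
  have h2 : ∀ ω, ∫⁻ x, (Metric.closedBall (0 : ℝ) m).indicator (1 : ℝ → ℝ≥0∞) x *
      (1 - perturbedLattice B ω (Metric.closedBall 0 N) / ENNReal.ofReal (2 * N)) =
      volume (Metric.closedBall (0 : ℝ) m) *
      (1 - perturbedLattice B ω (Metric.closedBall 0 N) / ENNReal.ofReal (2 * N)) := by
    intro ω
    rw [lintegral_mul_const _ (measurable_one.indicator measurableSet_closedBall),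
      lintegral_indicator_one measurableSet_closedBall]
  simp only [h2] at h1
  rw [lintegral_const_mul' _ _ (isCompact_closedBall (0 : ℝ) m).measure_lt_top.ne,
    ← mul_assoc] at h1
  rw [← h1]
  refine lintegral_mono fun ω => ?_
  simp only
  rw [← lintegral_indicator_one measurableSet_closedBall, ← lintegral_mul_const _
    (measurable_one.indicator measurableSet_closedBall)]
  refine lintegral_mono fun x => ?_
  simp only
  by_cases hx : x ∈ Metric.closedBall (0 : ℝ) m
  · gcongr _ * (1 - ?_ / _)
    rw [shift, Measure.map_apply (measurable_sub_const x) measurableSet_closedBall]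
    refine measure_mono fun y hy => ?_
    simp only [Set.mem_preimage, Metric.mem_closedBall, dist_zero_right, Real.norm_eq_abs]
      at hx hy ⊢
    have := abs_add_le (y - x) x
    rw [sub_add_cancel] at this
    linarith
  · simp [hx]

/-- The mean of `1 = a + (1 - a)`, with `a` the density of points in a large ball: it is bounded by
the intensity plus the mean of `1 - a`, and `1 - a` is small when there is a point near the
origin. -/
lemma HasPalmVersion.one_le_add (hξ : IsPointProcess ξ)
    (hB : IsFractionalBrownianMotion P h B) (h_pos : 0 < h) (h_lt_one : h < 1)
    (hpalm : HasPalmVersion P' ξ P (perturbedLattice B)) {m : ℝ} (hm : 0 ≤ m) :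
    1 ≤ intensity P' ξ + P' {ω | ξ ω (Metric.closedBall 0 m) = 0} := by
  have hZ : MeasurableSet {ω | ξ ω (Metric.closedBall 0 m) = 0} :=
    ((Measure.measurable_coe measurableSet_closedBall).comp hξ.measurable)
      (measurableSet_singleton 0)
  have hmN : ∀ N : ℝ, Measurable fun ω =>
      ξ ω (Metric.closedBall 0 (N + m)) / ENNReal.ofReal (2 * N) := fun N =>
    ((Measure.measurable_coe measurableSet_closedBall).comp hξ.measurable).div_const _
  have key : ∀ N : ℝ, 0 < N → 1 ≤ intensity P' ξ * ENNReal.ofReal (1 + m * N⁻¹) +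
      (P' {ω | ξ ω (Metric.closedBall 0 m) = 0} +
      intensity P' ξ * volume (Metric.closedBall (0 : ℝ) m) * ∫⁻ ω,
        (1 - perturbedLattice B ω (Metric.closedBall 0 N) / ENNReal.ofReal (2 * N)) ∂P) := by
    intro N hN
    have hpt : ∀ ω, (1 : ℝ≥0∞) ≤ ξ ω (Metric.closedBall 0 (N + m)) / ENNReal.ofReal (2 * N) +
        ({ω | ξ ω (Metric.closedBall 0 m) = 0}.indicator 1 ω + ξ ω (Metric.closedBall 0 m) *
          (1 - ξ ω (Metric.closedBall 0 (N + m)) / ENNReal.ofReal (2 * N))) := by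
      intro ω
      rw [← tsub_le_iff_left]
      by_cases h0 : ξ ω (Metric.closedBall 0 m) = 0
      · rw [Set.indicator_of_mem (show ω ∈ {ω | ξ ω (Metric.closedBall 0 m) = 0} from h0)]
        exact tsub_le_self.trans le_self_add
      · have h1 := (hξ.isConfiguration ω).one_le measurableSet_closedBall h0
        refine le_trans ?_ le_add_self
        exact le_mul_of_one_le_left zero_le h1
    have h2 := lintegral_mono (μ := P') hpt
    rw [lintegral_const, measure_univ, mul_one, lintegral_add_left (hmN N),
      lintegral_add_left (measurable_one.indicator hZ), lintegral_indicator_one hZ] at h2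
    refine h2.trans (add_le_add (le_of_eq ?_) (add_le_add_right
      (hpalm.lintegral_mul_one_sub_le m N) _))
    simp_rw [div_eq_mul_inv]
    rw [lintegral_mul_const' _ _ (by simp [hN]), hpalm.lintegral_apply hξ measurableSet_closedBall,
      Real.volume_closedBall, mul_assoc, ← ENNReal.ofReal_inv_of_pos (by positivity),
      ← ENNReal.ofReal_mul (by positivity)]
    congr 2
    field_simp
  have hlim1 : Tendsto (fun N : ℝ => intensity P' ξ * ENNReal.ofReal (1 + m * N⁻¹)) atTop
      (𝓝 (intensity P' ξ)) := by
    have h3 : Tendsto (fun N : ℝ => 1 + m * N⁻¹) atTop (𝓝 1) := by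
      simpa using (tendsto_inv_atTop_zero.const_mul m).const_add 1
    have h4 := (ENNReal.continuous_ofReal.tendsto 1).comp h3
    rw [ENNReal.ofReal_one] at h4
    simpa using ENNReal.Tendsto.const_mul h4 (Or.inl one_ne_zero)
  have hlim2 := ENNReal.Tendsto.const_mul (a := intensity P' ξ *
    volume (Metric.closedBall (0 : ℝ) m)) (hB.tendsto_lintegral_one_sub h_pos h_lt_one)
    (Or.inr (ENNReal.mul_ne_top hpalm.intensity_lt_top.ne
      (isCompact_closedBall (0 : ℝ) m).measure_lt_top.ne))
  rw [mul_zero] at hlim2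
  have hlim := hlim1.add (hlim2.const_add (P' {ω | ξ ω (Metric.closedBall 0 m) = 0}))
  rw [add_zero] at hlim
  refine ge_of_tendsto hlim ?_
  filter_upwards [eventually_gt_atTop 0] with N hN using key N hN

/-- As `ξ` is not empty, the probability that a ball has no point tends to `0` with the radius. -/
lemma HasPalmVersion.one_le_intensity (hξ : IsPointProcess ξ)
    (hξ_nonempty : ∀ᵐ ω ∂P', ξ ω ≠ 0)
    (hB : IsFractionalBrownianMotion P h B) (h_pos : 0 < h) (h_lt_one : h < 1)
    (hpalm : HasPalmVersion P' ξ P (perturbedLattice B)) : 1 ≤ intensity P' ξ := by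
  set Z : ℕ → Set Ω' := fun m => {ω | ξ ω (Metric.closedBall 0 (m : ℝ)) = 0} with hZ
  have hZm : ∀ m, MeasurableSet (Z m) := fun m =>
    ((Measure.measurable_coe measurableSet_closedBall).comp hξ.measurable)
      (measurableSet_singleton 0)
  have hanti : Antitone Z := by
    intro m n hmn ω hω
    refine measure_mono_null (Metric.closedBall_subset_closedBall ?_) hω
    exact_mod_cast hmn
  have hlim := tendsto_measure_iInter_atTop (μ := P') (fun m => (hZm m).nullMeasurableSet) hanti
    ⟨0, measure_ne_top _ _⟩
  have hnull : P' (⋂ m, Z m) = 0 := by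
    refine measure_mono_null (fun ω hω => ?_) (ae_iff.1 hξ_nonempty)
    simp only [Set.mem_ofPred_eq, not_not]
    rw [← Measure.measure_univ_eq_zero, ← Metric.iUnion_closedBall_nat (0 : ℝ),
      measure_iUnion_null_iff]
    exact fun m => Set.mem_iInter.1 hω m
  rw [hnull] at hlim
  have h1 := hlim.const_add (intensity P' ξ)
  rw [add_zero] at h1
  exact ge_of_tendsto' h1 fun m => hpalm.one_le_add hξ hB h_pos h_lt_one (Nat.cast_nonneg m)

end PointProcess

/-! ### Statistics of balls and the value of the intensity -/

/-- The indicator function of the ball of radius `r`, with complex values. -/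
noncomputable def ballIndicator (r : ℝ) : ℝ → ℂ := (Metric.closedBall (0 : ℝ) r).indicator 1

lemma isTestFunction_ballIndicator (r : ℝ) : IsTestFunction (ballIndicator r) 1 r where
  measurable := measurable_one.indicator measurableSet_closedBall
  norm_le x := by
    rw [ballIndicator, norm_indicator_eq_indicator_norm]
    simp

lemma integral_ballIndicator (r : ℝ) (μ : Measure ℝ) :
    ∫ x, ballIndicator r x ∂μ = ((μ (Metric.closedBall 0 r)).toReal : ℂ) := by
  rw [ballIndicator, Pi.one_def, integral_indicator_const _ measurableSet_closedBall]
  simp [Measure.real]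

lemma fourierTransform_ballIndicator {r t : ℝ} (hr : 0 ≤ r) (ht : t ≠ 0) :
    fourierTransform (ballIndicator r) t = ((2 * Real.sin (r * t) / t : ℝ) : ℂ) := by
  have htc : (t : ℂ) ≠ 0 := by exact_mod_cast ht
  have h1 : ∀ x : ℝ, Complex.exp (-Complex.I * t * x) * ballIndicator r x =
      (Set.Icc (-r) r).indicator (fun x : ℝ => Complex.exp (-Complex.I * t * x)) x := by
    intro x
    rw [ballIndicator, Real.closedBall_eq_Icc, zero_sub, zero_add]
    by_cases hx : x ∈ Set.Icc (-r) r <;> simp [hx]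
  rw [fourierTransform]
  simp_rw [h1]
  rw [integral_indicator measurableSet_Icc, integral_Icc_eq_integral_Ioc,
    ← intervalIntegral.integral_of_le (by linarith),
    integral_exp_mul_complex (by simp [htc])]
  have e1 : -Complex.I * t * r = -((r * t : ℝ) : ℂ) * Complex.I := by push_cast; ring
  have e2 : -Complex.I * t * (-r : ℝ) = ((r * t : ℝ) : ℂ) * Complex.I := by push_cast; ring
  rw [e1, e2]
  push_cast
  rw [Complex.sin]
  field_simp
  rw [Complex.I_sq]
  ring_nf

lemma fourierTransform_ballIndicator_zero {r : ℝ} (hr : 0 ≤ r) :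
    fourierTransform (ballIndicator r) 0 = ((2 * r : ℝ) : ℂ) := by
  have h1 := integral_ballIndicator r volume
  rw [Real.volume_closedBall, ENNReal.toReal_ofReal (by positivity)] at h1
  rw [← h1, fourierTransform]
  simp

lemma norm_sq_fourierTransform_ballIndicator {r t : ℝ} (hr : 0 ≤ r) (ht : t ≠ 0) :
    ‖fourierTransform (ballIndicator r) t‖ ^ 2 = (2 * Real.sin (r * t) / t) ^ 2 := by
  rw [fourierTransform_ballIndicator hr ht, Complex.norm_real, Real.norm_eq_abs, sq_abs]

lemma norm_sq_fourierTransform_ballIndicator_le {r t : ℝ} (hr : 0 ≤ r) (ht : t ≠ 0) :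
    ‖fourierTransform (ballIndicator r) t‖ ^ 2 ≤ 4 * (r ^ 2 + 1) * (1 + t ^ 2)⁻¹ := by
  rw [norm_sq_fourierTransform_ballIndicator hr ht, div_pow, ← div_eq_mul_inv,
    div_le_div_iff₀ (by positivity) (by positivity)]
  have h1 : Real.sin (r * t) ^ 2 ≤ r ^ 2 * t ^ 2 := by
    rw [← mul_pow]
    exact sq_le_sq.2 (Real.abs_sin_le_abs)
  have h2 := Real.sin_sq_le_one (r * t)
  nlinarith [mul_le_mul_of_nonneg_right h2 (sq_nonneg t)]

lemma integrable_norm_sq_fourierTransform_ballIndicator {r : ℝ} (hr : 0 ≤ r) :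
    Integrable fun t => ‖fourierTransform (ballIndicator r) t‖ ^ 2 := by
  refine (integrable_inv_one_add_sq.const_mul (4 * (r ^ 2 + 1))).mono' ?_ ?_
  · have := continuous_fourierTransform ((isTestFunction_ballIndicator r).integrable volume)
    exact Continuous.aestronglyMeasurable (by fun_prop)
  · filter_upwards [ae_ne_zero] with t ht
    rw [Real.norm_eq_abs, abs_of_nonneg (by positivity)]
    exact norm_sq_fourierTransform_ballIndicator_le hr ht

/-- The autocorrelation of an indicator function of an interval is a triangular function. -/
lemma continuous_autocorrelation_ballIndicator (r : ℝ) :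
    Continuous (autocorrelation (ballIndicator r)) := by
  have h1 : autocorrelation (ballIndicator r) = fun u : ℝ =>
      ((max (min r (r - u) - max (-r) (-r - u)) 0 : ℝ) : ℂ) := by
    ext u
    have h2 : ∀ x : ℝ, (starRingEnd ℂ) (ballIndicator r x) * ballIndicator r (x + u) =
        (Set.Icc (max (-r) (-r - u)) (min r (r - u))).indicator (fun _ => (1 : ℂ)) x := by
      intro x
      rw [← Set.Icc_inter_Icc, ballIndicator, Real.closedBall_eq_Icc, zero_sub, zero_add]
      have h3 : x + u ∈ Set.Icc (-r) r ↔ x ∈ Set.Icc (-r - u) (r - u) := by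
        simp only [Set.mem_Icc]
        constructor <;> rintro ⟨h4, h5⟩ <;> constructor <;> linarith
      by_cases hx : x ∈ Set.Icc (-r) r <;> by_cases hy : x + u ∈ Set.Icc (-r) r
      · simp [Set.indicator, hx, hy, h3.1 hy]
      · simp [Set.indicator, hx, hy, mt h3.2 hy]
      · simp [Set.indicator, hx]
      · simp [Set.indicator, hx]
    rw [autocorrelation]
    simp_rw [h2]
    rw [integral_indicator_const _ measurableSet_Icc, Real.volume_real_Icc]
    simp
  rw [h1]
  fun_prop

lemma integrable_norm_sq_fourierTransform_mul_perturbedStructureFactor {α : ℝ} (hα : 0 < α)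
    (hα2 : α < 2) {φ : ℝ → ℂ} {C m : ℝ} (hφ : IsTestFunction φ C m)
    (hG : Integrable fun t => ‖fourierTransform φ t‖ ^ 2) :
    Integrable fun t => ‖fourierTransform φ t‖ ^ 2 * perturbedStructureFactor α t := by
  have hGc : Integrable (fourierTransform (autocorrelation φ)) := by
    refine hG.ofReal.congr (Eventually.of_forall fun t => ?_)
    exact (hφ.fourierTransform_autocorrelation t).symm
  have h1 := (integrable_fourierTransform_mul_perturbedStructureFactor hα hα2 hGc).re
  refine h1.congr (Eventually.of_forall fun t => ?_)
  simp only [hφ.fourierTransform_autocorrelation, ← Complex.ofReal_mul]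
  exact Complex.ofReal_re _

section PointProcess

variable {Ω Ω' : Type*} [MeasurableSpace Ω] [MeasurableSpace Ω'] {ξ : Ω' → Measure ℝ}
  {P' : Measure Ω'} [IsProbabilityMeasure P'] {P : Measure Ω} [IsProbabilityMeasure P]
  {B : ℝ → Ω → ℝ} {h : ℝ}

/-- The variance of `ξ [-r, r] / (2 r)`, which is nonnegative, tends to `λ - λ ^ 2`. -/
lemma HasPalmVersion.intensity_le_one (hξ : IsPointProcess ξ)
    (hB : IsFractionalBrownianMotion P h B) (h_pos : 0 < h) (h_lt_one : h < 1)
    (hpalm : HasPalmVersion P' ξ P (perturbedLattice B)) : intensity P' ξ ≤ 1 := by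
  have hα2 : 2 * h < 2 := by linarith
  obtain ⟨K, hK, hs⟩ := exists_abs_perturbedStructureFactor_le (α := 2 * h) (by positivity) hα2
  set lam := (intensity P' ξ).toReal with hlam
  set F : ℝ → ℝ → ℝ := fun r t => ‖fourierTransform (ballIndicator r) t‖ ^ 2 *
    perturbedStructureFactor (2 * h) t / (2 * r) ^ 2 with hF
  have hvar : ∀ r : ℝ, 1 ≤ r → 0 ≤ lam * ((2 * Real.pi)⁻¹ * ∫ t, F r t) + (lam - lam ^ 2) := by
    intro r hr
    have hr0 : 0 < r := by linarith
    have h1 := (isTestFunction_ballIndicator r).integral_norm_sub_sq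
      (continuous_autocorrelation_ballIndicator r)
      (integrable_norm_sq_fourierTransform_ballIndicator hr0.le) hξ hB h_pos h_lt_one hpalm
    have h2 : 0 ≤ ∫ ω, ‖(∫ x, ballIndicator r x ∂ξ ω) -
        ∫ ω', ∫ x, ballIndicator r x ∂ξ ω' ∂P'‖ ^ 2 ∂P' :=
      integral_nonneg fun ω => by positivity
    rw [h1, fourierTransform_ballIndicator_zero hr0.le, Complex.norm_real, Real.norm_eq_abs,
      sq_abs] at h2
    have h3 : ∫ t, F r t = (∫ t, ‖fourierTransform (ballIndicator r) t‖ ^ 2 *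
      perturbedStructureFactor (2 * h) t) / (2 * r) ^ 2 := integral_div _ _
    have h4 := div_nonneg h2 (sq_nonneg (2 * r))
    rw [h3]
    refine h4.trans (le_of_eq ?_)
    rw [← hlam]
    field_simp
  have hlim : Tendsto (fun r : ℝ => ∫ t, F r t) atTop (𝓝 (∫ _ : ℝ, (0 : ℝ))) := by
    have hdom : Integrable fun t : ℝ => 2 * K * ((1 + t ^ 2)⁻¹ * spectralMajorant (2 * h) t) := by
      refine (integrable_mul_spectralMajorant hα2 integrable_inv_one_add_sq (M := 1)
        fun t => ?_).const_mul _
      rw [abs_of_nonneg (by positivity)]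
      exact inv_le_one_of_one_le₀ (by nlinarith [sq_nonneg t])
    refine tendsto_integral_filter_of_dominated_convergence _ ?_ ?_ hdom ?_
    · refine Eventually.of_forall fun r => Measurable.aestronglyMeasurable ?_
      have h1 := (continuous_fourierTransform
        ((isTestFunction_ballIndicator r).integrable volume)).measurable
      have h2 := measurable_perturbedStructureFactor (α := 2 * h) (by positivity)
      fun_prop
    · filter_upwards [eventually_ge_atTop 1] with r hr
      filter_upwards [ae_ne_zero] with t ht
      have h1 := norm_sq_fourierTransform_ballIndicator_le (by linarith : 0 ≤ r) ht
      have hm := one_le_spectralMajorant (2 * h) t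
      rw [norm_div, norm_mul, Real.norm_eq_abs, Real.norm_eq_abs, Real.norm_eq_abs,
        abs_of_nonneg (by positivity : 0 ≤ (2 * r) ^ 2), abs_of_nonneg (by positivity :
        0 ≤ ‖fourierTransform (ballIndicator r) t‖ ^ 2), div_le_iff₀ (by positivity)]
      have hinv : 0 < (1 + t ^ 2)⁻¹ := by positivity
      have h2 : ‖fourierTransform (ballIndicator r) t‖ ^ 2 ≤ 8 * r ^ 2 * (1 + t ^ 2)⁻¹ :=
        h1.trans (mul_le_mul_of_nonneg_right (by nlinarith) hinv.le)
      refine (mul_le_mul h2 (hs t ht) (abs_nonneg _) (by positivity)).trans (le_of_eq ?_)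
      ring
    · filter_upwards [ae_ne_zero] with t ht
      have h1 : Tendsto (fun r : ℝ => |perturbedStructureFactor (2 * h) t| / t ^ 2 * (r⁻¹) ^ 2)
          atTop (𝓝 0) := by
        simpa using (tendsto_inv_atTop_zero.pow 2).const_mul
          (|perturbedStructureFactor (2 * h) t| / t ^ 2)
      refine squeeze_zero_norm' ?_ h1
      filter_upwards [eventually_ge_atTop 1] with r hr
      have hr0 : 0 < r := by linarith
      simp only [hF]
      rw [norm_sq_fourierTransform_ballIndicator hr0.le ht, norm_div, norm_mul, Real.norm_eq_abs,
        Real.norm_eq_abs, Real.norm_eq_abs, abs_of_nonneg (sq_nonneg (2 * Real.sin (r * t) / t)),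
        abs_of_nonneg (sq_nonneg (2 * r)), div_pow, mul_pow, mul_pow]
      have h2 := mul_le_mul_of_nonneg_right (Real.sin_sq_le_one (r * t))
        (abs_nonneg (perturbedStructureFactor (2 * h) t))
      rw [inv_pow]
      have : 0 < t ^ 2 := by positivity
      field_simp
      exact div_le_div_of_nonneg_right (by linarith) this.le
  rw [integral_zero] at hlim
  have hlim2 := ((hlim.const_mul (2 * Real.pi)⁻¹).const_mul lam).add_const (lam - lam ^ 2)
  rw [mul_zero, mul_zero, zero_add] at hlim2
  have h1 : 0 ≤ lam - lam ^ 2 := ge_of_tendsto hlim2 (by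
    filter_upwards [eventually_ge_atTop 1] with r hr using hvar r hr)
  have h2 : 0 < lam := ENNReal.toReal_pos hpalm.intensity_pos.ne' hpalm.intensity_lt_top.ne
  have h3 : lam ≤ 1 := by nlinarith
  rw [← ENNReal.ofReal_toReal hpalm.intensity_lt_top.ne, ← ENNReal.ofReal_one]
  exact ENNReal.ofReal_le_ofReal h3

/-- The variance of a linear statistic in the frequency domain. -/
lemma IsTestFunction.lintegral_enorm_sub_sq {φ : ℝ → ℂ} {C m : ℝ} (hφ : IsTestFunction φ C m)
    (hc : Continuous (autocorrelation φ))
    (hG : Integrable fun t => ‖fourierTransform φ t‖ ^ 2)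
    (hξ : IsPointProcess ξ) (hξ_nonempty : ∀ᵐ ω ∂P', ξ ω ≠ 0)
    (hB : IsFractionalBrownianMotion P h B) (h_pos : 0 < h)
    (h_lt_one : h < 1) (hpalm : HasPalmVersion P' ξ P (perturbedLattice B)) :
    ∫⁻ ω, ‖(∫ x, φ x ∂ξ ω) - ∫ ω', ∫ x, φ x ∂ξ ω' ∂P'‖ₑ ^ 2 ∂P' =
      ENNReal.ofReal ((2 * Real.pi)⁻¹ *
        ∫ t, ‖fourierTransform φ t‖ ^ 2 * perturbedStructureFactor (2 * h) t) := by
  have hpi := Real.pi_pos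
  have hone : intensity P' ξ = 1 := le_antisymm (hpalm.intensity_le_one hξ hB h_pos h_lt_one)
    (hpalm.one_le_intensity hξ hξ_nonempty hB h_pos h_lt_one)
  have h1 := hφ.integral_norm_sub_sq hc hG hξ hB h_pos h_lt_one hpalm
  rw [hone, ENNReal.toReal_one, one_mul, one_pow, sub_self, zero_mul, add_zero] at h1
  have hXL := hφ.memLp_integral hξ hB h_lt_one hpalm
  have h2 : Integrable (fun ω => ‖(∫ x, φ x ∂ξ ω) - ∫ ω', ∫ x, φ x ∂ξ ω' ∂P'‖ ^ 2) P' :=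
    (hXL.sub (memLp_const _)).integrable_norm_pow (by norm_num)
  rw [← h1, ofReal_integral_eq_lintegral_ofReal h2 (Eventually.of_forall fun ω => by positivity)]
  refine lintegral_congr fun ω => ?_
  rw [ENNReal.ofReal_pow (norm_nonneg _), ofReal_norm]

lemma IsFractionalBrownianMotion.lintegral_fourierTransform_mul
    (hB : IsFractionalBrownianMotion P h B) (h_pos : 0 < h) (h_lt_one : h < 1) {φ : ℝ → ℂ}
    {C m : ℝ} (hφ : IsTestFunction φ C m) (hG : Integrable fun t => ‖fourierTransform φ t‖ ^ 2) :
    ∫⁻ t, ‖fourierTransform φ t‖ₑ ^ 2 ∂(volume.withDensity fun t =>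
      ENNReal.ofReal (perturbedStructureFactor (2 * h) t)) =
      ENNReal.ofReal (∫ t, ‖fourierTransform φ t‖ ^ 2 * perturbedStructureFactor (2 * h) t) := by
  have hsm := measurable_perturbedStructureFactor (α := 2 * h) (by positivity)
  have hφc := continuous_fourierTransform (hφ.integrable volume)
  have h2 := integrable_norm_sq_fourierTransform_mul_perturbedStructureFactor (α := 2 * h)
    (by positivity) (by linarith) hφ hG
  rw [lintegral_withDensity_eq_lintegral_mul _ hsm.ennreal_ofReal (by fun_prop),
    ofReal_integral_eq_lintegral_ofReal h2]
  · refine lintegral_congr fun t => ?_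
    rw [Pi.mul_apply, ENNReal.ofReal_mul (by positivity), ENNReal.ofReal_pow (norm_nonneg _),
      ofReal_norm, mul_comm]
  · filter_upwards [ae_ne_zero] with t ht
    exact mul_nonneg (by positivity) (hB.perturbedStructureFactor_nonneg h_pos ht)

end PointProcess

/-! ### Bartlett spectrum and hyperuniformity -/

lemma exists_isTestFunction {φ : ℝ → ℂ} (hc : Continuous φ) (hs : HasCompactSupport φ) :
    ∃ C m : ℝ, IsTestFunction φ C m := by
  obtain ⟨C, hC⟩ := hs.exists_bound_of_continuous hc
  obtain ⟨m, hm⟩ := hs.isCompact.isBounded.subset_closedBall (0 : ℝ)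
  refine ⟨C, m, hc.measurable, fun x => ?_⟩
  by_cases hx : x ∈ Metric.closedBall (0 : ℝ) m
  · rw [Set.indicator_of_mem hx]
    exact hC x
  · rw [Set.indicator_of_notMem hx, image_eq_zero_of_notMem_tsupport fun h => hx (hm h), norm_zero]

lemma continuous_autocorrelation {φ : ℝ → ℂ} (hc : Continuous φ) (hs : HasCompactSupport φ) :
    Continuous (autocorrelation φ) := by
  obtain ⟨C, hC⟩ := hs.exists_bound_of_continuous hc
  refine continuous_of_dominated (bound := fun x => ‖φ x‖ * C) (fun u => ?_) (fun u => ?_)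
    ((hc.integrable_of_hasCompactSupport hs).norm.mul_const C) ?_
  · exact Continuous.aestronglyMeasurable (by fun_prop)
  · refine Eventually.of_forall fun x => ?_
    rw [norm_mul, RCLike.norm_conj]
    exact mul_le_mul_of_nonneg_left (hC _) (norm_nonneg _)
  · exact Eventually.of_forall fun x => by fun_prop

lemma integrable_norm_sq_fourierTransform {φ : ℝ → ℂ} (hφ : ContDiff ℝ (⊤ : ℕ∞) φ)
    (hs : HasCompactSupport φ) : Integrable fun t => ‖fourierTransform φ t‖ ^ 2 := by
  have hpi := Real.pi_pos
  have h1 := ((FourierTransform.fourier (hs.toSchwartzMap hφ)).memLp 2).integrable_norm_pow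
    (by norm_num)
  have h2 := h1.comp_mul_left' (R := (2 * Real.pi)⁻¹) (by positivity)
  refine h2.congr (Eventually.of_forall fun t => ?_)
  simp only [fourierTransform_eq_fourier, SchwartzMap.fourier_coe]
  rw [div_eq_inv_mul]
  rfl

section StructureFactor

variable {Ω Ω' : Type*} [MeasurableSpace Ω] [MeasurableSpace Ω'] {ξ : Ω' → Measure ℝ}
  {P' : Measure Ω'} [IsProbabilityMeasure P'] {P : Measure Ω} [IsProbabilityMeasure P]
  {B : ℝ → Ω → ℝ} {h : ℝ}

lemma isLocallyFiniteMeasure_withDensity_perturbedStructureFactor {α : ℝ} (hα : 0 < α)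
    (hα2 : α < 2) : IsLocallyFiniteMeasure (volume.withDensity fun t =>
      ENNReal.ofReal (perturbedStructureFactor α t)) := by
  obtain ⟨K, hK, hs⟩ := exists_abs_perturbedStructureFactor_le hα hα2
  have h1 : LocallyIntegrable (perturbedStructureFactor α) := by
    refine ((locallyIntegrable_spectralMajorant hα2).smul K).mono
      (measurable_perturbedStructureFactor hα).aestronglyMeasurable ?_
    filter_upwards [ae_ne_zero] with t ht
    have hm := one_le_spectralMajorant α t
    rw [Pi.smul_apply, smul_eq_mul, Real.norm_eq_abs, Real.norm_eq_abs,
      abs_of_nonneg (by positivity : 0 ≤ K * spectralMajorant α t)]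
    exact hs t ht
  refine ⟨fun x => ?_⟩
  obtain ⟨s, hs, hint⟩ := h1 x
  refine ⟨s, hs, ?_⟩
  rw [withDensity_apply' _ s]
  exact hint.lintegral_lt_top

lemma HasPalmVersion.isStructureFactor (hξ : IsPointProcess ξ)
    (hξ_nonempty : ∀ᵐ ω ∂P', ξ ω ≠ 0)
    (hB : IsFractionalBrownianMotion P h B) (h_pos : 0 < h)
    (h_lt_one : h < 1) (hpalm : HasPalmVersion P' ξ P (perturbedLattice B)) :
    IsStructureFactor P' ξ (perturbedStructureFactor (2 * h)) where
  measurable := measurable_perturbedStructureFactor (by positivity)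
  nonneg := by
    filter_upwards [ae_ne_zero] with t ht using hB.perturbedStructureFactor_nonneg h_pos ht
  isBartlettSpectrum :=
    { second_moment := fun K hK => by
        obtain ⟨m, hm⟩ := hK.isBounded.subset_closedBall (0 : ℝ)
        refine lt_of_le_of_lt (lintegral_mono fun ω => ?_)
          (hpalm.lintegral_sq_closedBall_lt_top hξ hB h_lt_one m)
        exact pow_le_pow_left₀ zero_le (measure_mono hm) 2
      locallyFinite := isLocallyFiniteMeasure_withDensity_perturbedStructureFactor
        (by positivity) (by linarith)
      variance_eq := fun φ hφ hs => by
        obtain ⟨C, m, hT⟩ := exists_isTestFunction hφ.continuous hs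
        have hG := integrable_norm_sq_fourierTransform hφ hs
        rw [hT.lintegral_enorm_sub_sq (continuous_autocorrelation hφ.continuous hs) hG hξ
          hξ_nonempty hB h_pos h_lt_one hpalm,
          hB.lintegral_fourierTransform_mul h_pos h_lt_one hT hG,
          ENNReal.ofReal_mul (by positivity)] }

/-- The number variance of a ball, in the frequency domain. -/
lemma HasPalmVersion.evariance_closedBall (hξ : IsPointProcess ξ)
    (hξ_nonempty : ∀ᵐ ω ∂P', ξ ω ≠ 0)
    (hB : IsFractionalBrownianMotion P h B) (h_pos : 0 < h)
    (h_lt_one : h < 1) (hpalm : HasPalmVersion P' ξ P (perturbedLattice B)) {r : ℝ} (hr : 0 ≤ r) :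
    evariance (fun ω => (ξ ω (Metric.closedBall 0 r)).toReal) P' =
      ENNReal.ofReal ((2 * Real.pi)⁻¹ * ∫ t, ‖fourierTransform (ballIndicator r) t‖ ^ 2 *
        perturbedStructureFactor (2 * h) t) := by
  rw [← (isTestFunction_ballIndicator r).lintegral_enorm_sub_sq
    (continuous_autocorrelation_ballIndicator r)
    (integrable_norm_sq_fourierTransform_ballIndicator hr) hξ hξ_nonempty hB h_pos h_lt_one hpalm,
    evariance]
  refine lintegral_congr fun ω => ?_
  simp only [integral_ballIndicator]
  rw [integral_complex_ofReal, ← Complex.ofReal_sub, ← ofReal_norm, ← ofReal_norm,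
    Complex.norm_real]

/-- The substitution `t = u / r`
turns the Fejér kernel of the ball of radius `r` into that of the unit ball. -/
lemma integral_norm_sq_fourierTransform_ballIndicator_mul {r : ℝ} (hr : 0 < r) (s : ℝ → ℝ) :
    (∫ t, ‖fourierTransform (ballIndicator r) t‖ ^ 2 * s t) =
      r * ∫ u, ‖fourierTransform (ballIndicator 1) u‖ ^ 2 * s (r⁻¹ * u) := by
  have h1 := Measure.integral_comp_inv_mul_left
    (fun t => ‖fourierTransform (ballIndicator r) t‖ ^ 2 * s t) r
  rw [abs_of_pos hr, smul_eq_mul] at h1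
  have h2 : ∫ u, ‖fourierTransform (ballIndicator r) (r⁻¹ * u)‖ ^ 2 * s (r⁻¹ * u) =
      r ^ 2 * ∫ u, ‖fourierTransform (ballIndicator 1) u‖ ^ 2 * s (r⁻¹ * u) := by
    rw [← integral_const_mul]
    refine integral_congr_ae ?_
    filter_upwards [ae_ne_zero] with u hu
    rw [norm_sq_fourierTransform_ballIndicator hr.le (by positivity),
      norm_sq_fourierTransform_ballIndicator zero_le_one hu, mul_inv_cancel_left₀ hr.ne', one_mul]
    field_simp
  rw [h1] at h2
  exact mul_left_cancel₀ hr.ne' (by linear_combination h2)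

/-- For `h < 1 / 2` the structure factor is bounded and tends to `0` at the origin. -/
lemma HasPalmVersion.isHyperuniform (hξ : IsPointProcess ξ)
    (hξ_nonempty : ∀ᵐ ω ∂P', ξ ω ≠ 0)
    (hB : IsFractionalBrownianMotion P h B) (h_pos : 0 < h)
    (h_lt : h < 1 / 2) (hpalm : HasPalmVersion P' ξ P (perturbedLattice B)) :
    IsHyperuniform P' ξ := by
  have hpi := Real.pi_pos
  have hα : 0 < 2 * h := by positivity
  have hα2 : 2 * h < 2 := by linarith
  obtain ⟨K, hK, hs⟩ := exists_abs_perturbedStructureFactor_le hα hα2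
  have hsb : ∀ t : ℝ, |perturbedStructureFactor (2 * h) t| ≤ 2 * K := by
    intro t
    rcases eq_or_ne t 0 with rfl | ht
    · rw [perturbedStructureFactor_zero, abs_zero]
      positivity
    · refine (hs t ht).trans ?_
      have : spectralMajorant (2 * h) t ≤ 2 := by
        rw [spectralMajorant]
        have : (Set.Icc (-1 : ℝ) 1).indicator (fun t => |t| ^ (1 - 2 * h)) t ≤ 1 := by
          refine Set.indicator_apply_le' (fun ht => ?_) (fun _ => zero_le_one)
          exact Real.rpow_le_one (abs_nonneg t) (abs_le.2 ht) (by linarith)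
        linarith
      nlinarith
  have hs0 : Tendsto (perturbedStructureFactor (2 * h)) (𝓝[≠] 0) (𝓝 0) := by
    have h1 : Tendsto (fun t : ℝ => |t| ^ (1 - 2 * h)) (𝓝[≠] 0) (𝓝 0) := by
      have h2 : Continuous fun t : ℝ => |t| ^ (1 - 2 * h) :=
        continuous_abs.rpow_const fun t => Or.inr (by linarith)
      have h3 := (h2.tendsto 0).mono_left (nhdsWithin_le_nhds (s := {0}ᶜ))
      rwa [abs_zero, Real.zero_rpow (by linarith)] at h3
    have h2 := (tendsto_perturbedStructureFactor_div hα hα2).mul h1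
    rw [mul_zero] at h2
    refine h2.congr' ?_
    filter_upwards [self_mem_nhdsWithin] with t ht
    exact div_mul_cancel₀ _ (Real.rpow_pos_of_pos (abs_pos.2 ht) _).ne'
  have hG := integrable_norm_sq_fourierTransform_ballIndicator zero_le_one
  have hlim : Tendsto (fun r : ℝ => ∫ u, ‖fourierTransform (ballIndicator 1) u‖ ^ 2 *
      perturbedStructureFactor (2 * h) (r⁻¹ * u)) atTop (𝓝 (∫ _ : ℝ, (0 : ℝ))) := by
    refine tendsto_integral_filter_of_dominated_convergence _ ?_ ?_ (hG.mul_const (2 * K)) ?_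
    · refine Eventually.of_forall fun r => Measurable.aestronglyMeasurable ?_
      have h1 := (continuous_fourierTransform
        ((isTestFunction_ballIndicator 1).integrable volume)).measurable
      have h2 := measurable_perturbedStructureFactor hα
      fun_prop
    · refine Eventually.of_forall fun r => Eventually.of_forall fun u => ?_
      rw [norm_mul, Real.norm_eq_abs, Real.norm_eq_abs, abs_of_nonneg (sq_nonneg _)]
      exact mul_le_mul_of_nonneg_left (hsb _) (sq_nonneg _)
    · filter_upwards [ae_ne_zero] with u hu
      have h1 : Tendsto (fun r : ℝ => r⁻¹ * u) atTop (𝓝[≠] 0) := by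
        refine tendsto_nhdsWithin_iff.2 ⟨?_, ?_⟩
        · simpa using tendsto_inv_atTop_zero.mul_const u
        · filter_upwards [eventually_gt_atTop 0] with r hr
          exact mul_ne_zero (inv_ne_zero hr.ne') hu
      simpa using (hs0.comp h1).const_mul (‖fourierTransform (ballIndicator 1) u‖ ^ 2)
  rw [integral_zero] at hlim
  have hlim2 := ENNReal.tendsto_ofReal (hlim.const_mul (4 * Real.pi)⁻¹)
  rw [mul_zero, ENNReal.ofReal_zero] at hlim2
  refine hlim2.congr' ?_
  filter_upwards [eventually_gt_atTop 0] with r hr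
  rw [hpalm.evariance_closedBall hξ hξ_nonempty hB h_pos (by linarith) hr.le,
    Real.volume_closedBall, ← ENNReal.ofReal_div_of_pos (by positivity),
    integral_norm_sq_fourierTransform_ballIndicator_mul hr]
  congr 1
  field_simp
  norm_num

lemma gamma_mul_sin_pos (h_pos : 0 < h) (h_lt_one : h < 1) :
    0 < Real.Gamma (2 * h + 1) * Real.sin (2 * h * (Real.pi / 2)) := by
  have hpi := Real.pi_pos
  refine mul_pos (Real.Gamma_pos_of_pos (by positivity))
    (Real.sin_pos_of_pos_of_lt_pi (by positivity) ?_)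
  nlinarith

/-- For `1 / 2 ≤ h` the structure factor is bounded below near the origin, and the frequencies up to
`1 / r` already contribute a nonvanishing part of the normalized variance. -/
lemma HasPalmVersion.not_isHyperuniform (hξ : IsPointProcess ξ)
    (hξ_nonempty : ∀ᵐ ω ∂P', ξ ω ≠ 0)
    (hB : IsFractionalBrownianMotion P h B) (h_pos : 0 < h) (h_lt_one : h < 1)
    (h_ge : 1 / 2 ≤ h) (hpalm : HasPalmVersion P' ξ P (perturbedLattice B)) :
    ¬ IsHyperuniform P' ξ := by
  have hpi := Real.pi_pos
  have hα : 0 < 2 * h := by positivity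
  have hα2 : 2 * h < 2 := by linarith
  have hnn : 0 ≤ᵐ[volume] perturbedStructureFactor (2 * h) := by
    filter_upwards [ae_ne_zero] with t ht using hB.perturbedStructureFactor_nonneg h_pos ht
  set c : ℝ := Real.Gamma (2 * h + 1) * Real.sin (2 * h * (Real.pi / 2)) / 2 with hc
  have hc0 : 0 < c := half_pos (gamma_mul_sin_pos h_pos h_lt_one)
  have h1 : ∀ᶠ t : ℝ in 𝓝[≠] 0, c ≤ perturbedStructureFactor (2 * h) t := by
    filter_upwards [(tendsto_perturbedStructureFactor_div hα hα2).eventually_const_lt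
      (half_lt_self (gamma_mul_sin_pos h_pos h_lt_one)), self_mem_nhdsWithin,
      nhdsWithin_le_nhds (Metric.closedBall_mem_nhds (0 : ℝ) one_pos)] with t ht ht0 ht1
    have h2 : 0 < |t| := abs_pos.2 ht0
    have h3 : 1 ≤ |t| ^ (1 - 2 * h) :=
      Real.one_le_rpow_of_pos_of_le_one_of_nonpos h2 (by simpa using ht1) (by linarith)
    rw [lt_div_iff₀ (by positivity)] at ht
    nlinarith
  obtain ⟨δ, hδ, h2⟩ := Metric.mem_nhdsWithin_iff.1 h1
  have key : ∀ r : ℝ, 0 < r → δ⁻¹ < r → 16 / Real.pi ^ 2 * c * r ≤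
      ∫ t, ‖fourierTransform (ballIndicator r) t‖ ^ 2 * perturbedStructureFactor (2 * h) t := by
    intro r hr hrδ
    have hG := integrable_norm_sq_fourierTransform_ballIndicator hr.le
    have hrδ' : r⁻¹ < δ := inv_lt_of_inv_lt₀ hδ hrδ
    have hint : Integrable fun t => ‖fourierTransform (ballIndicator r) t‖ ^ 2 *
        perturbedStructureFactor (2 * h) t :=
      integrable_norm_sq_fourierTransform_mul_perturbedStructureFactor hα hα2
        (isTestFunction_ballIndicator r) hG
    have h3 : ∫ t, (Set.Ioc 0 r⁻¹).indicator (fun _ => (4 * r / Real.pi) ^ 2 * c) t =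
        16 / Real.pi ^ 2 * c * r := by
      rw [integral_indicator_const _ measurableSet_Ioc, Real.volume_real_Ioc, sub_zero,
        max_eq_left (by positivity), smul_eq_mul]
      field_simp
      norm_num
    rw [← h3]
    refine integral_mono_ae ?_ hint ?_
    · rw [integrable_indicator_iff measurableSet_Ioc]
      exact integrableOn_const measure_Ioc_lt_top.ne
    filter_upwards [hnn] with t ht
    refine Set.indicator_apply_le' (fun htm => ?_) fun _ => mul_nonneg (sq_nonneg _) ht
    obtain ⟨ht0, ht1⟩ := htm
    have h4 : c ≤ perturbedStructureFactor (2 * h) t := by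
      refine h2 ⟨?_, ht0.ne'⟩
      rw [Metric.mem_ball, dist_zero_right, Real.norm_eq_abs, abs_of_pos ht0]
      linarith
    have h5 : r * t ≤ 1 := by
      have := mul_le_mul_of_nonneg_left ht1 hr.le
      rwa [mul_inv_cancel₀ hr.ne'] at this
    have h6 : 2 / Real.pi * (r * t) ≤ Real.sin (r * t) :=
      Real.mul_le_sin (by positivity) (by linarith [Real.pi_gt_three])
    rw [norm_sq_fourierTransform_ballIndicator hr.le ht0.ne']
    refine mul_le_mul (pow_le_pow_left₀ (by positivity) ?_ 2) h4 hc0.le (sq_nonneg _)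
    rw [le_div_iff₀ ht0]
    calc 4 * r / Real.pi * t = 2 * (2 / Real.pi * (r * t)) := by ring
      _ ≤ _ := by linarith
  intro hyp
  have h3 : ENNReal.ofReal (4 * c / Real.pi ^ 3) ≤ 0 := by
    refine ge_of_tendsto hyp ?_
    filter_upwards [eventually_gt_atTop 0, eventually_gt_atTop δ⁻¹] with r hr hrδ
    rw [hpalm.evariance_closedBall hξ hξ_nonempty hB h_pos h_lt_one hr.le,
      Real.volume_closedBall, ← ENNReal.ofReal_div_of_pos (by positivity)]
    refine ENNReal.ofReal_le_ofReal ?_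
    rw [le_div_iff₀ (by positivity)]
    calc 4 * c / Real.pi ^ 3 * (2 * r) = (2 * Real.pi)⁻¹ * (16 / Real.pi ^ 2 * c * r) := by
          field_simp
          norm_num
      _ ≤ _ := mul_le_mul_of_nonneg_left (key r hr hrδ) (by positivity)
  rw [nonpos_iff_eq_zero, ENNReal.ofReal_eq_zero] at h3
  have : 0 < 4 * c / Real.pi ^ 3 := by positivity
  linarith

end StructureFactor

lemma hasSum_perturbedStructureFactor {h t : ℝ} (h_pos : 0 < h) (ht : t ≠ 0) :
    HasSum (fun n : ℤ => (Real.exp (-(1 / 2) * |(n : ℝ)| ^ (2 * h) * t ^ 2) : ℂ) *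
      Complex.exp (-Complex.I * n * t)) (perturbedStructureFactor (2 * h) t : ℂ) := by
  have h1 := hasSum_latticeSum (α := 2 * h) (a := t ^ 2 / 2) (by positivity) (by positivity) (-t)
  rw [latticeSum_neg] at h1
  convert h1 using 1
  · ext n
    rw [stretchedExp]
    congr 2
    · congr 1
      ring
    · push_cast
      ring
  · rw [perturbedStructureFactor]

lemma isEquivalent_perturbedStructureFactor {h : ℝ} (h_pos : 0 < h) (h_lt_one : h < 1) :
    perturbedStructureFactor (2 * h) ~[𝓝[≠] 0] (fun t : ℝ =>
      2 * h * Real.Gamma (2 * h) * Real.sin (Real.pi * h) * |t| ^ (1 - 2 * h)) := by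
  have h1 := gamma_mul_sin_pos h_pos h_lt_one
  have h2 : 2 * h * Real.Gamma (2 * h) * Real.sin (Real.pi * h) =
      Real.Gamma (2 * h + 1) * Real.sin (2 * h * (Real.pi / 2)) := by
    rw [Real.Gamma_add_one (by positivity)]
    congr 2
    ring
  rw [h2]
  refine isEquivalent_of_tendsto_one ?_
  have h3 := (tendsto_perturbedStructureFactor_div (α := 2 * h) (by positivity)
    (by linarith)).div_const (Real.Gamma (2 * h + 1) * Real.sin (2 * h * (Real.pi / 2)))
  rw [div_self h1.ne'] at h3
  refine h3.congr fun t => ?_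
  rw [Pi.div_apply, div_div, mul_comm (|t| ^ _)]

theorem proposition1p2 {Ω Ω' : Type*} [MeasurableSpace Ω] [MeasurableSpace Ω']
    (P : Measure Ω) [IsProbabilityMeasure P] (P' : Measure Ω') [IsProbabilityMeasure P']
    (h : ℝ) (h_pos : 0 < h) (h_lt_one : h < 1)
    (B : ℝ → Ω → ℝ) (hB : IsFractionalBrownianMotion P h B)
    (ξ : Ω' → Measure ℝ) (hξ : IsPointProcess ξ) (hξ_stationary : IsStationaryProcess P' ξ)
    (hξ_nonempty : ∀ᵐ ω ∂P', ξ ω ≠ 0)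
    (hξ_palm : HasPalmVersion P' ξ P (perturbedLattice B)) :
    (∃ s : ℝ → ℝ,
      (∀ t : ℝ, t ≠ 0 → HasSum
        (fun n : ℤ => (Real.exp (-(1 / 2) * |(n : ℝ)| ^ (2 * h) * t ^ 2) : ℂ) *
          Complex.exp (-Complex.I * n * t)) (s t : ℂ)) ∧
      IsStructureFactor P' ξ s ∧
      s ~[𝓝[≠] 0] (fun t : ℝ =>
        2 * h * Real.Gamma (2 * h) * Real.sin (Real.pi * h) * |t| ^ (1 - 2 * h))) ∧
    (IsHyperuniform P' ξ ↔ h < 1 / 2) := by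

  refine ⟨⟨perturbedStructureFactor (2 * h), fun t ht => hasSum_perturbedStructureFactor h_pos ht,
    hξ_palm.isStructureFactor hξ hξ_nonempty hB h_pos h_lt_one,
    isEquivalent_perturbedStructureFactor h_pos h_lt_one⟩, fun hyp => ?_, fun h_lt =>
    hξ_palm.isHyperuniform hξ hξ_nonempty hB h_pos h_lt⟩
  by_contra! h_ge
  exact hξ_palm.not_isHyperuniform hξ hξ_nonempty hB h_pos h_lt_one h_ge hyp
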